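/- Conventions. Let $K$ be a field and $(C,\Delta,\varepsilon)$ a $K$-coalgebra, $\Delta(c)=c_1\otimes c_2$. The dual $C^*$ is an algebra under convolution $(fg)(c)=f(c_1)g(c_2)$, and $C$ is a right $C^*$-module by $c\cdot f=f(c_1)c_2$. $C$ is *right semiperfect* if the injective envelope of every simple left $C$-comodule is finite dimensional. $C$ satisfies the *right generating condition* if every right $C$-comodule is a quotient of a direct sum of copies of $C$. $C$ is *right QcF* (quasi-co-Frobenius) if it embeds, as a right $C^*$-module, in a direct sum of copies of $C^*$. The *coradical* of $C$ is the sum of its simple subcoalgebras. $C$ is *connected* (pointed colocal) if its coradical is $Kg$ for a group-like element $g$ (i.e. $\Delta(g)=g\otimes g$, $\varepsilon(g)=1$). Constructions. For a finite dimensional right $C$-comodule $(M,\rho_M)$ let $A_M$ be the coalgebra dual to the algebra of comodule endomorphisms of $M$ with opposite composition as multiplication, and let $r_M:M\to A_M\otimes M$ be the left $A_M$-comodule structure corresponding to the right action $m\cdot a=a(m)$ of that algebra. Given a set of finite dimensional right $C$-comodules $M$, the space $\bigoplus_M A_M\oplus\bigoplus_M M\oplus C$ is a coalgebra whose comultiplication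 is that of $A_M$ on $A_M$, is $r_M+\rho_M$ on $M$, and is $\Delta$ on $C$, and whose counit is that of $A_M$ on $A_M$, is $0$ on $M$, and is $\varepsilon$ on $C$. (a) Let $C'$ be this coalgebra for a set of representatives of the isomorphism types of all finite dimensional right $C$-comodules. Put $C^{(0)}=C$, $C^{(n+1)}=(C^{(n)})'$ and $C_\infty=\bigcup_n C^{(n)}$. (b) Let $K$ be algebraically closed and $C$ connected with group-like element $g$. Let $C^{\sim}$ be this coalgebra for a set of representatives of the isomorphism types of indecomposable finite dimensional right $C$-comodules. Each $A_M$ then has a unique group-like element $g_M$. Let $C^\vee=C^{\sim}/I$, where $I$ is the coideal spanned by the elements $g-g_M$; it is again connected. Put $C^{[0]}=C$, $C^{[n+1]}=(C^{[n]})^\vee$ and $C_\infty^\vee=\bigcup_n C^{[n]}$. Statement. (1) Let $C$ be a coalgebra over a field which is not right semiperfect. Then $C_\infty$ satisfies the right generating condition, but $C_\infty$ is not right semiperfect, is not right QcF, and is not projective as a left $C_\infty$-comodule. (2) Let $K$ be algebraically closed and let $C$ be a connected $K$-coalgebra, with coradical $Kg$, which is not right semiperfect. Then $C_\infty^\vee$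 is connected, its coradical being spanned by the image of $g$, and it satisfies the right generating condition, but it is not right semiperfect, is not right QcF, and is not projective as a left $C_\infty^\vee$-comodule. (3) The divided power coalgebra $C$ over $\mathbb C$, with basis $c_n$ ($n\ge 0$), $\Delta(c_n)=\sum_{i+j=n}c_i\otimes c_j$ and $\varepsilon(c_n)=\delta_{0,n}$, is connected with group-like element $c_0$ and is not right semiperfect. Consequently $C_\infty^\vee$ is connected (so its coradical is finite dimensional) and satisfies the right generating condition, but it is not right semiperfect, is not right QcF, and is not projective as a left comodule over itself. In particular the right generating condition does not imply right QcF, even for coalgebras with finite dimensional coradical. -/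

import Mathlib

open scoped TensorProduct

universe u

set_option linter.unusedSectionVars false

noncomputable section

namespace Comod

/-! ### Comodules over a coalgebra -/

section Comodules

variable (K : Type*) [Field K] (C : Type*) [AddCommGroup C] [Module K C] [Coalgebra K C]

/-- A right `C`-comodule structure `M → M ⊗ C` on the `K`-vector space `M`. -/
class RightComodule (M : Type*) [AddCommGroup M] [Module K M] where
  coact : M →ₗ[K] M ⊗[K] C
  coassoc : (TensorProduct.assoc K M C C).toLinearMap ∘ₗ coact.rTensor C ∘ₗ coact =
    (Coalgebra.comul (R := K) (A := C)).lTensor M ∘ₗ coact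
  counit_coact : (Coalgebra.counit (R := K) (A := C)).lTensor M ∘ₗ coact =
    (TensorProduct.mk K M K).flip 1

/-- A left `C`-comodule structure `M → C ⊗ M` on the `K`-vector space `M`. -/
class LeftComodule (M : Type*) [AddCommGroup M] [Module K M] where
  coact : M →ₗ[K] C ⊗[K] M
  coassoc : (TensorProduct.assoc K C C M).toLinearMap ∘ₗ
      (Coalgebra.comul (R := K) (A := C)).rTensor M ∘ₗ coact =
    coact.lTensor C ∘ₗ coact
  counit_coact : (Coalgebra.counit (R := K) (A := C)).rTensor M ∘ₗ coact =
    TensorProduct.mk K K M 1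

/-- The coaction of a right comodule. -/
abbrev rcoact (M : Type*) [AddCommGroup M] [Module K M] [RightComodule K C M] :
    M →ₗ[K] M ⊗[K] C :=
  RightComodule.coact

/-- The coaction of a left comodule. -/
abbrev lcoact (M : Type*) [AddCommGroup M] [Module K M] [LeftComodule K C M] :
    M →ₗ[K] C ⊗[K] M :=
  LeftComodule.coact

/-- The coalgebra `C` as a right comodule over itself. -/
instance instRightComoduleSelf : RightComodule K C C where
  coact := Coalgebra.comul
  coassoc := Coalgebra.coassoc
  counit_coact := Coalgebra.lTensor_counit_comp_comul

/-- The coalgebra `C` as a left comodule over itself. -/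
instance instLeftComoduleSelf : LeftComodule K C C where
  coact := Coalgebra.comul
  coassoc := Coalgebra.coassoc
  counit_coact := Coalgebra.rTensor_counit_comp_comul

variable {M N : Type*} [AddCommGroup M] [Module K M] [AddCommGroup N] [Module K N]

/-- Morphisms of right comodules. -/
def IsRightComoduleHom [RightComodule K C M] [RightComodule K C N] (f : M →ₗ[K] N) : Prop :=
  f.rTensor C ∘ₗ rcoact K C M = rcoact K C N ∘ₗ f

/-- Morphisms of left comodules. -/
def IsLeftComoduleHom [LeftComodule K C M] [LeftComodule K C N] (f : M →ₗ[K] N) : Prop :=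
  f.lTensor C ∘ₗ lcoact K C M = lcoact K C N ∘ₗ f

/-- `P` is a right subcomodule of `M`: the coaction maps `P` into `P ⊗ C ⊆ M ⊗ C`. -/
def IsRightSubcomodule [RightComodule K C M] (P : Submodule K M) : Prop :=
  ∀ m ∈ P, rcoact K C M m ∈ LinearMap.range (P.subtype.rTensor C)

/-- `P` is a left subcomodule of `M`: the coaction maps `P` into `C ⊗ P ⊆ C ⊗ M`. -/
def IsLeftSubcomodule [LeftComodule K C M] (P : Submodule K M) : Prop :=
  ∀ m ∈ P, lcoact K C M m ∈ LinearMap.range (P.subtype.lTensor C)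

/-- The direct sum of copies of a right comodule indexed by `ι`. -/
instance instRightComoduleFinsupp {ι : Type*} [RightComodule K C M] :
    RightComodule K C (ι →₀ M) where
  coact := Finsupp.lsum ℕ fun i =>
    (Finsupp.lsingle (R := K) (M := M) i).rTensor C ∘ₗ rcoact K C M
  coassoc := by
    refine Finsupp.lhom_ext' fun i => ?_
    set T : (ι →₀ M) →ₗ[K] (ι →₀ M) ⊗[K] C := Finsupp.lsum ℕ fun i =>
      (Finsupp.lsingle (R := K) (M := M) i).rTensor C ∘ₗ rcoact K C M
    have hT : T ∘ₗ Finsupp.lsingle i = (Finsupp.lsingle i).rTensor C ∘ₗ rcoact K C M := by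
      ext m; simp [T]
    have h1 : (TensorProduct.assoc K (ι →₀ M) C C).toLinearMap ∘ₗ
        ((Finsupp.lsingle (R := K) (M := M) i).rTensor C).rTensor C =
        (Finsupp.lsingle (R := K) (M := M) i).rTensor (C ⊗[K] C) ∘ₗ
          (TensorProduct.assoc K M C C).toLinearMap :=
      TensorProduct.ext_threefold fun _ _ _ => rfl
    calc ((TensorProduct.assoc K (ι →₀ M) C C).toLinearMap ∘ₗ T.rTensor C ∘ₗ T) ∘ₗ
          Finsupp.lsingle i
        = (TensorProduct.assoc K (ι →₀ M) C C).toLinearMap ∘ₗ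
            (T ∘ₗ Finsupp.lsingle i).rTensor C ∘ₗ rcoact K C M := by
          rw [LinearMap.comp_assoc, LinearMap.comp_assoc, hT,
            ← LinearMap.comp_assoc _ _ (T.rTensor C), ← LinearMap.rTensor_comp, hT]
      _ = ((TensorProduct.assoc K (ι →₀ M) C C).toLinearMap ∘ₗ
            ((Finsupp.lsingle (R := K) (M := M) i).rTensor C).rTensor C) ∘ₗ
            (rcoact K C M).rTensor C ∘ₗ rcoact K C M := by
          rw [hT, LinearMap.rTensor_comp, LinearMap.comp_assoc, LinearMap.comp_assoc]
      _ = (Finsupp.lsingle (R := K) (M := M) i).rTensor (C ⊗[K] C) ∘ₗ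
            (Coalgebra.comul (R := K) (A := C)).lTensor M ∘ₗ rcoact K C M := by
          rw [h1, LinearMap.comp_assoc, RightComodule.coassoc]
      _ = _ := by
          rw [LinearMap.comp_assoc, hT, ← LinearMap.comp_assoc, ← LinearMap.comp_assoc,
            LinearMap.rTensor_comp_lTensor, LinearMap.lTensor_comp_rTensor]
  counit_coact := by
    refine Finsupp.lhom_ext' fun i => ?_
    set T : (ι →₀ M) →ₗ[K] (ι →₀ M) ⊗[K] C := Finsupp.lsum ℕ fun i =>
      (Finsupp.lsingle (R := K) (M := M) i).rTensor C ∘ₗ rcoact K C M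
    have hT : T ∘ₗ Finsupp.lsingle i = (Finsupp.lsingle i).rTensor C ∘ₗ rcoact K C M := by
      ext m; simp [T]
    rw [LinearMap.comp_assoc, hT, ← LinearMap.comp_assoc, LinearMap.lTensor_comp_rTensor,
      ← LinearMap.rTensor_comp_lTensor, LinearMap.comp_assoc, RightComodule.counit_coact]
    ext m
    simp

variable (M)

/-- A simple left comodule. -/
def IsSimpleLeftComodule [LeftComodule K C M] : Prop :=
  Nontrivial M ∧ ∀ P : Submodule K M, IsLeftSubcomodule K C P → P = ⊥ ∨ P = ⊤

/-- An indecomposable right comodule: it is nonzero and it is not the direct sum of two nonzero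
subcomodules. -/
def IsIndecomposable [RightComodule K C M] : Prop :=
  Nontrivial M ∧ ∀ P Q : Submodule K M, IsRightSubcomodule K C P → IsRightSubcomodule K C Q →
    IsCompl P Q → P = ⊥ ∨ Q = ⊥

end Comodules

/-! ### Properties of coalgebras -/

section Properties

variable (K : Type u) [Field K] (C : Type u) [AddCommGroup C] [Module K C] [Coalgebra K C]

/-- `E` is an injective object of the category of left `C`-comodules. -/
def IsInjectiveLeftComodule (E : Type u) [AddCommGroup E] [Module K E] [LeftComodule K C E] :
    Prop :=
  ∀ (X Y : Type u) [AddCommGroup X] [Module K X] [LeftComodule K C X]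
    [AddCommGroup Y] [Module K Y] [LeftComodule K C Y] (i : X →ₗ[K] Y) (f : X →ₗ[K] E),
    IsLeftComoduleHom K C i → Function.Injective i → IsLeftComoduleHom K C f →
    ∃ g : Y →ₗ[K] E, IsLeftComoduleHom K C g ∧ g ∘ₗ i = f

/-- `P` is a projective object of the category of left `C`-comodules. -/
def IsProjectiveLeftComodule (P : Type u) [AddCommGroup P] [Module K P] [LeftComodule K C P] :
    Prop :=
  ∀ (X Y : Type u) [AddCommGroup X] [Module K X] [LeftComodule K C X]
    [AddCommGroup Y] [Module K Y] [LeftComodule K C Y] (p : X →ₗ[K] Y) (f : P →ₗ[K] Y),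
    IsLeftComoduleHom K C p → Function.Surjective p → IsLeftComoduleHom K C f →
    ∃ g : P →ₗ[K] X, IsLeftComoduleHom K C g ∧ p ∘ₗ g = f

/-- `i : S → E` is an injective envelope of the left comodule `S`: an embedding of comodules into
an injective comodule, such that every nonzero subcomodule of `E` meets the image of `S`. -/
def IsLeftInjectiveEnvelope {S E : Type u} [AddCommGroup S] [Module K S] [LeftComodule K C S]
    [AddCommGroup E] [Module K E] [LeftComodule K C E] (i : S →ₗ[K] E) : Prop :=
  IsLeftComoduleHom K C i ∧ Function.Injective i ∧ IsInjectiveLeftComodule K C E ∧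
    ∀ P : Submodule K E, IsLeftSubcomodule K C P → P ≠ ⊥ → P ⊓ LinearMap.range i ≠ ⊥

/-- `C` is right semiperfect: the injective envelope of every simple left `C`-comodule is finite
dimensional. -/
def IsRightSemiperfect : Prop :=
  ∀ (S E : Type u) [AddCommGroup S] [Module K S] [LeftComodule K C S]
    [AddCommGroup E] [Module K E] [LeftComodule K C E] (i : S →ₗ[K] E),
    IsSimpleLeftComodule K C S → IsLeftInjectiveEnvelope K C i → FiniteDimensional K E

/-- `C` satisfies the right generating condition: every right `C`-comodule is a quotient of a
direct sum of copies of `C`. -/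
def IsRightGenerating : Prop :=
  ∀ (M : Type u) [AddCommGroup M] [Module K M] [RightComodule K C M],
    ∃ (ι : Type u) (f : (ι →₀ C) →ₗ[K] M), IsRightComoduleHom K C f ∧ Function.Surjective f

/-- The right action `c · f = f(c₁) c₂` of `f ∈ C*` on `c ∈ C`. -/
def rightHit (f : C →ₗ[K] K) : C →ₗ[K] C :=
  (TensorProduct.lid K C).toLinearMap ∘ₗ f.rTensor C ∘ₗ Coalgebra.comul

/-- `C` is right quasi-co-Frobenius: it embeds in a direct sum of copies of `C*` as a right module
over the convolution algebra `C* = WithConv (C →ₗ[K] K)`. -/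
def IsRightQcF : Prop :=
  ∃ (ι : Type u) (φ : C →ₗ[K] (ι →₀ WithConv (C →ₗ[K] K))), Function.Injective φ ∧
    ∀ (c : C) (f : WithConv (C →ₗ[K] K)) (i : ι), φ (rightHit K C f.ofConv c) i = φ c i * f

variable {C} in
/-- `D` is a subcoalgebra of `C`: `Δ(D) ⊆ D ⊗ D`. -/
def IsSubcoalgebra (D : Submodule K C) : Prop :=
  ∀ d ∈ D, Coalgebra.comul (R := K) d ∈
    LinearMap.range (TensorProduct.map D.subtype D.subtype)

variable {C} in
/-- `D` is a simple subcoalgebra of `C`. -/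
def IsSimpleSubcoalgebra (D : Submodule K C) : Prop :=
  IsSubcoalgebra K D ∧ D ≠ ⊥ ∧ ∀ D' ≤ D, IsSubcoalgebra K D' → D' = ⊥ ∨ D' = D

/-- The coradical of `C`: the sum of its simple subcoalgebras. -/
def coradical : Submodule K C :=
  sSup {D | IsSimpleSubcoalgebra K D}

variable {C} in
/-- `C` is connected (pointed colocal): its coradical is `K g` with `g` group-like. -/
def IsConnectedAt (g : C) : Prop :=
  IsGroupLikeElem K g ∧ coradical K C = Submodule.span K {g}

end Properties

/-! ### The coalgebra dual to a finite dimensional algebra -/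

section Dual

variable (K : Type*) [Field K] (A : Type*) [Ring A] [Algebra K A]

/-- The dual `A*` of an algebra, which carries a coalgebra structure when `A` is finite
dimensional. -/
def DualCoalg : Type _ := Module.Dual K A

instance : AddCommGroup (DualCoalg K A) := inferInstanceAs (AddCommGroup (Module.Dual K A))
instance : Module K (DualCoalg K A) := inferInstanceAs (Module K (Module.Dual K A))

variable [FiniteDimensional K A]

/-- The isomorphism `A* ⊗ N ≃ Hom(A, N)`, `α ⊗ n ↦ (a ↦ α(a) n)`. -/
def dualTensorEquiv (N : Type*) [AddCommGroup N] [Module K N] :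
    DualCoalg K A ⊗[K] N ≃ₗ[K] (A →ₗ[K] N) :=
  dualTensorHomEquiv K A N

variable {K A}

@[simp]
theorem dualTensorEquiv_tmul {N : Type*} [AddCommGroup N] [Module K N] (α : DualCoalg K A) (n : N)
    (a : A) : dualTensorEquiv K A N (α ⊗ₜ n) a = (show Module.Dual K A from α) a • n :=
  rfl

variable (K A)

/-- The map `α ↦ (a ↦ (b ↦ α(ab)))`. -/
def dualMulMap : DualCoalg K A →ₗ[K] A →ₗ[K] DualCoalg K A :=
  LinearMap.mk₂ K (fun α a => (show Module.Dual K A from α) ∘ₗ LinearMap.mulLeft K a)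
    (fun _ _ _ => rfl) (fun _ _ _ => rfl)
    (fun α a b => LinearMap.ext fun x =>
      (congrArg (show Module.Dual K A from α) (add_mul a b x)).trans
        (map_add (show Module.Dual K A from α) _ _))
    (fun k α a => LinearMap.ext fun x =>
      (congrArg (show Module.Dual K A from α) (smul_mul_assoc k a x)).trans
        (map_smul (show Module.Dual K A from α) _ _))

/-- The comultiplication of `A*`: `δ(α) = α₁ ⊗ α₂` with `α₁(a) α₂(b) = α(ab)`. The counit is
`α ↦ α(1)`. -/
instance : CoalgebraStruct K (DualCoalg K A) where
  comul := (dualTensorEquiv K A (DualCoalg K A)).symm.toLinearMap ∘ₗ dualMulMap K A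
  counit := Module.Dual.eval K A 1

variable {K A}

theorem dualTensorEquiv_comul (α : DualCoalg K A) :
    dualTensorEquiv K A _ (Coalgebra.comul (R := K) α) = dualMulMap K A α := by
  simp [Coalgebra.comul]

theorem dualCoalg_counit (α : DualCoalg K A) :
    Coalgebra.counit (R := K) α = (show Module.Dual K A from α) 1 := rfl

theorem dualTensor_ext {N : Type*} [AddCommGroup N] [Module K N] {x y : DualCoalg K A ⊗[K] N}
    (h : ∀ a, dualTensorEquiv K A N x a = dualTensorEquiv K A N y a) : x = y :=
  (dualTensorEquiv K A N).injective (LinearMap.ext h)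

theorem dualTensorEquiv_lTensor {N P : Type*} [AddCommGroup N] [Module K N] [AddCommGroup P]
    [Module K P] (f : N →ₗ[K] P) (x : DualCoalg K A ⊗[K] N) (a : A) :
    dualTensorEquiv K A P (f.lTensor _ x) a = f (dualTensorEquiv K A N x a) := by
  induction x using TensorProduct.induction_on with
  | zero => simp
  | tmul α n => simp
  | add x y hx hy => simp [hx, hy]

theorem dualTensorEquiv_assoc_comul {N : Type*} [AddCommGroup N] [Module K N]
    (x : DualCoalg K A ⊗[K] N) (a b : A) :
    dualTensorEquiv K A N (dualTensorEquiv K A _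
      (TensorProduct.assoc K _ _ N ((Coalgebra.comul (R := K)).rTensor N x)) a) b =
    dualTensorEquiv K A N x (a * b) := by
  have key : ∀ (y : DualCoalg K A ⊗[K] DualCoalg K A) (n : N),
      dualTensorEquiv K A N (dualTensorEquiv K A _ (TensorProduct.assoc K _ _ N (y ⊗ₜ n)) a) b =
      (show Module.Dual K A from dualTensorEquiv K A _ y a) b • n := by
    intro y n
    induction y using TensorProduct.induction_on with
    | zero =>
      simp only [TensorProduct.zero_tmul, map_zero, LinearMap.zero_apply]
      exact (zero_smul K n).symm
    | tmul α β =>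
      simp [smul_smul]
      rfl
    | add x y hx hy =>
      rw [TensorProduct.add_tmul, map_add, map_add, LinearMap.add_apply, map_add,
        LinearMap.add_apply, hx, hy, map_add, LinearMap.add_apply, ← add_smul]
      rfl
  induction x using TensorProduct.induction_on with
  | zero => simp
  | tmul α n => rw [LinearMap.rTensor_tmul, key, dualTensorEquiv_comul]; rfl
  | add x y hx hy => simp only [map_add, LinearMap.add_apply, hx, hy]

theorem dualTensor_counit {N : Type*} [AddCommGroup N] [Module K N] (x : DualCoalg K A ⊗[K] N) :
    (Coalgebra.counit (R := K)).rTensor N x = 1 ⊗ₜ dualTensorEquiv K A N x 1 := by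
  induction x using TensorProduct.induction_on with
  | zero => simp
  | tmul α n => simp [dualCoalg_counit, TensorProduct.tmul_smul, TensorProduct.smul_tmul']
  | add x y hx hy => simp [hx, hy, TensorProduct.tmul_add]

variable (K A)

/-- The coalgebra dual to a finite dimensional algebra. -/
instance : Coalgebra K (DualCoalg K A) where
  coassoc := by
    refine LinearMap.ext fun α => dualTensor_ext fun a => dualTensor_ext fun b => ?_
    simp only [LinearMap.comp_apply, LinearEquiv.coe_coe]
    rw [dualTensorEquiv_assoc_comul, dualTensorEquiv_lTensor]
    simp only [dualTensorEquiv_comul]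
    refine LinearMap.ext fun c => ?_
    exact congrArg (show Module.Dual K A from α) (mul_assoc a b c)
  rTensor_counit_comp_comul := by
    refine LinearMap.ext fun α => ?_
    simp only [LinearMap.comp_apply]
    rw [dualTensor_counit, dualTensorEquiv_comul]
    refine congrArg (fun β : DualCoalg K A => (1 : K) ⊗ₜ[K] β) (LinearMap.ext fun c => ?_)
    exact congrArg (show Module.Dual K A from α) (one_mul c)
  lTensor_counit_comp_comul := by
    refine LinearMap.ext fun α => dualTensor_ext fun a => ?_
    simp only [LinearMap.comp_apply]
    rw [dualTensorEquiv_lTensor, dualTensorEquiv_comul]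
    simp [dualCoalg_counit]
    exact congrArg (show Module.Dual K A from α) (mul_one a)

end Dual

/-! ### The coalgebra `A_M` dual to the endomorphism algebra of a finite dimensional comodule -/

section EndCoalgebra

variable (K : Type*) [Field K] (C : Type*) [AddCommGroup C] [Module K C] [Coalgebra K C]
  (M : Type*) [AddCommGroup M] [Module K M] [RightComodule K C M]

/-- The algebra of comodule endomorphisms of `M`, with composition as multiplication. -/
def comodEnd : Subalgebra K (Module.End K M) where
  carrier := {f | IsRightComoduleHom K C f}
  mul_mem' {f g} hf hg := by
    change (f ∘ₗ g).rTensor C ∘ₗ rcoact K C M = rcoact K C M ∘ₗ (f ∘ₗ g)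
    have hf' : f.rTensor C ∘ₗ rcoact K C M = rcoact K C M ∘ₗ f := hf
    have hg' : g.rTensor C ∘ₗ rcoact K C M = rcoact K C M ∘ₗ g := hg
    rw [LinearMap.rTensor_comp, LinearMap.comp_assoc, hg', ← LinearMap.comp_assoc, hf',
      LinearMap.comp_assoc]
  add_mem' {f g} hf hg := by
    change (f + g).rTensor C ∘ₗ rcoact K C M = rcoact K C M ∘ₗ (f + g)
    have hf' : f.rTensor C ∘ₗ rcoact K C M = rcoact K C M ∘ₗ f := hf
    have hg' : g.rTensor C ∘ₗ rcoact K C M = rcoact K C M ∘ₗ g := hg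
    rw [LinearMap.rTensor_add, LinearMap.add_comp, LinearMap.comp_add, hf', hg']
  algebraMap_mem' k := by
    change (k • (LinearMap.id : M →ₗ[K] M)).rTensor C ∘ₗ rcoact K C M =
      rcoact K C M ∘ₗ (k • LinearMap.id)
    rw [LinearMap.rTensor_smul, LinearMap.rTensor_id, LinearMap.smul_comp, LinearMap.comp_smul,
      LinearMap.id_comp, LinearMap.comp_id]

/-- The algebra `End(M^C)` with opposite composition as multiplication. -/
abbrev EndOp : Type _ := (comodEnd K C M)ᵐᵒᵖ

/-- The coalgebra `A_M` dual to `End(M^C)`. -/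
def EndCoalg : Type _ := DualCoalg K (EndOp K C M)

instance : AddCommGroup (EndCoalg K C M) := inferInstanceAs (AddCommGroup (DualCoalg K _))
instance : Module K (EndCoalg K C M) := inferInstanceAs (Module K (DualCoalg K _))

variable [FiniteDimensional K M]

instance : Coalgebra K (EndCoalg K C M) := inferInstanceAs (Coalgebra K (DualCoalg K (EndOp K C M)))

/-- The map `m ↦ (a ↦ m · a)`, where `m · a = a(m)`. -/
def endActionMap : M →ₗ[K] EndOp K C M →ₗ[K] M :=
  LinearMap.mk₂ K (fun m a => (a.unop : Module.End K M) m)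
    (fun _ _ _ => map_add _ _ _) (fun _ _ _ => map_smul _ _ _)
    (fun _ _ _ => rfl) (fun _ _ _ => rfl)

/-- The map `endCoact` below, with values in `End(M^C)* ⊗ M`. -/
def endCoactAux : M →ₗ[K] DualCoalg K (EndOp K C M) ⊗[K] M :=
  (dualTensorEquiv K (EndOp K C M) M).symm.toLinearMap ∘ₗ endActionMap K C M

/-- The left `A_M`-comodule structure `r_M` of `M`, corresponding to its structure of a right
module over `End(M^C)`: if `r_M(m) = m₋₁ ⊗ m₀` then `m₋₁(a) m₀ = m · a`. -/
def endCoact : M →ₗ[K] EndCoalg K C M ⊗[K] M :=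
  endCoactAux K C M

variable {K C M}

theorem dualTensorEquiv_endCoactAux (m : M) (a : EndOp K C M) :
    dualTensorEquiv K (EndOp K C M) M (endCoactAux K C M m) a = (a.unop : Module.End K M) m := by
  simp only [endCoactAux, LinearMap.comp_apply, LinearEquiv.coe_coe, LinearEquiv.apply_symm_apply]
  rfl

theorem endCoactAux_coassoc (m : M) :
    TensorProduct.assoc K _ _ M ((Coalgebra.comul (R := K)).rTensor M (endCoactAux K C M m)) =
      (endCoactAux K C M).lTensor _ (endCoactAux K C M m) := by
  refine dualTensor_ext fun a => dualTensor_ext fun b => ?_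
  rw [dualTensorEquiv_assoc_comul, dualTensorEquiv_lTensor]
  simp only [dualTensorEquiv_endCoactAux]
  rfl

theorem endCoactAux_counit (m : M) :
    (Coalgebra.counit (R := K)).rTensor M (endCoactAux K C M m) = 1 ⊗ₜ m := by
  rw [dualTensor_counit, dualTensorEquiv_endCoactAux]
  rfl

theorem endCoactAux_compat (m : M) :
    TensorProduct.assoc K _ M C ((endCoactAux K C M).rTensor C (rcoact K C M m)) =
      (rcoact K C M).lTensor _ (endCoactAux K C M m) := by
  refine dualTensor_ext fun a => ?_
  rw [dualTensorEquiv_lTensor, dualTensorEquiv_endCoactAux]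
  have key : ∀ x : M ⊗[K] C, dualTensorEquiv K (EndOp K C M) _
      (TensorProduct.assoc K _ M C ((endCoactAux K C M).rTensor C x)) a =
      (a.unop : Module.End K M).rTensor C x := by
    have key2 : ∀ (y : DualCoalg K (EndOp K C M) ⊗[K] M) (c : C),
        dualTensorEquiv K (EndOp K C M) _ (TensorProduct.assoc K _ M C (y ⊗ₜ c)) a =
        dualTensorEquiv K (EndOp K C M) _ y a ⊗ₜ c := by
      intro y c
      induction y using TensorProduct.induction_on with
      | zero => simp
      | tmul α m => simp [TensorProduct.smul_tmul']
      | add x y hx hy => simp [TensorProduct.add_tmul, hx, hy]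
    intro x
    induction x using TensorProduct.induction_on with
    | zero => simp
    | tmul m c => rw [LinearMap.rTensor_tmul, key2, dualTensorEquiv_endCoactAux]; rfl
    | add x y hx hy => simp only [map_add, LinearMap.add_apply, hx, hy]
  rw [key]
  exact LinearMap.congr_fun a.unop.2 m

variable (K C M)

/-- Coassociativity of the left coaction `r_M`. -/
theorem endCoact_coassoc : (TensorProduct.assoc K _ _ M).toLinearMap ∘ₗ
    (Coalgebra.comul (R := K) (A := EndCoalg K C M)).rTensor M ∘ₗ endCoact K C M =
      (endCoact K C M).lTensor _ ∘ₗ endCoact K C M :=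
  LinearMap.ext endCoactAux_coassoc

/-- Counitality of the left coaction `r_M`. -/
theorem endCoact_counit : (Coalgebra.counit (R := K) (A := EndCoalg K C M)).rTensor M ∘ₗ
    endCoact K C M = TensorProduct.mk K K M 1 :=
  LinearMap.ext endCoactAux_counit

/-- `M` is an `A_M`-`C`-bicomodule. -/
theorem endCoact_compat : (TensorProduct.assoc K _ M C).toLinearMap ∘ₗ
    (endCoact K C M).rTensor C ∘ₗ rcoact K C M =
      (rcoact K C M).lTensor (EndCoalg K C M) ∘ₗ endCoact K C M :=
  LinearMap.ext endCoactAux_compat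

end EndCoalgebra

/-! ### The coalgebra `(⨁ A_{M_i}) ⊕ (⨁ M_i) ⊕ C` -/

section Extension

variable (K : Type*) [Field K] (C : Type*) [AddCommGroup C] [Module K C] [Coalgebra K C]
  {ι : Type*} (M : ι → Type*) [∀ i, AddCommGroup (M i)] [∀ i, Module K (M i)]
  [∀ i, RightComodule K C (M i)] [∀ i, FiniteDimensional K (M i)]

/-- The vector space `(⨁ A_{M_i}) ⊕ (⨁ M_i) ⊕ C` for a family `M_i` of finite dimensional right
`C`-comodules. -/
def ExtCoalg : Type _ := (Π₀ i, EndCoalg K C (M i)) × (Π₀ i, M i) × C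

namespace ExtCoalg

instance : AddCommGroup (ExtCoalg K C M) :=
  inferInstanceAs (AddCommGroup ((Π₀ i, EndCoalg K C (M i)) × (Π₀ i, M i) × C))

instance : Module K (ExtCoalg K C M) :=
  inferInstanceAs (Module K ((Π₀ i, EndCoalg K C (M i)) × (Π₀ i, M i) × C))

open scoped Classical in
/-- The inclusion of `A_{M_i}`. -/
def inA (i : ι) : EndCoalg K C (M i) →ₗ[K] ExtCoalg K C M :=
  LinearMap.inl K (Π₀ i, EndCoalg K C (M i)) ((Π₀ i, M i) × C) ∘ₗ
    DFinsupp.lsingle (M := fun i => EndCoalg K C (M i)) i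

open scoped Classical in
/-- The inclusion of `M_i`. -/
def inM (i : ι) : M i →ₗ[K] ExtCoalg K C M :=
  LinearMap.inr K (Π₀ i, EndCoalg K C (M i)) ((Π₀ i, M i) × C) ∘ₗ
    LinearMap.inl K (Π₀ i, M i) C ∘ₗ DFinsupp.lsingle i

/-- The inclusion of `C`. -/
def inC : C →ₗ[K] ExtCoalg K C M :=
  LinearMap.inr K (Π₀ i, EndCoalg K C (M i)) ((Π₀ i, M i) × C) ∘ₗ LinearMap.inr K (Π₀ i, M i) C

open scoped Classical in
/-- The linear map on `(⨁ A_{M_i}) ⊕ (⨁ M_i) ⊕ C` with the given components. -/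
def desc {N : Type*} [AddCommGroup N] [Module K N] (a : ∀ i, EndCoalg K C (M i) →ₗ[K] N)
    (m : ∀ i, M i →ₗ[K] N) (c : C →ₗ[K] N) : ExtCoalg K C M →ₗ[K] N :=
  LinearMap.coprod (DFinsupp.lsum ℕ a) (LinearMap.coprod (DFinsupp.lsum ℕ m) c)

variable {K C M}

section desc

variable {N : Type*} [AddCommGroup N] [Module K N] (a : ∀ i, EndCoalg K C (M i) →ₗ[K] N)
  (m : ∀ i, M i →ₗ[K] N) (c : C →ₗ[K] N)

theorem desc_inA (i : ι) : desc K C M a m c ∘ₗ inA K C M i = a i := by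
  classical
  refine LinearMap.ext fun x => ?_
  refine (LinearMap.coprod_apply _ _ _).trans ?_
  exact (congrArg₂ (· + ·) (DFinsupp.lsum_single _ _ _ _) (map_zero _)).trans (add_zero _)

theorem desc_inM (i : ι) : desc K C M a m c ∘ₗ inM K C M i = m i := by
  classical
  refine LinearMap.ext fun x => ?_
  refine (LinearMap.coprod_apply _ _ _).trans ?_
  refine (congrArg₂ (· + ·) (map_zero _) (LinearMap.coprod_apply _ _ _)).trans
    ((zero_add _).trans ?_)
  exact (congrArg₂ (· + ·) (DFinsupp.lsum_single _ _ _ _) (map_zero _)).trans (add_zero _)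

theorem desc_inC : desc K C M a m c ∘ₗ inC K C M = c := by
  refine LinearMap.ext fun x => ?_
  change LinearMap.coprod _ _ ((0, (0, x)) : _ × _ × _) = _
  simp

theorem hom_ext {f g : ExtCoalg K C M →ₗ[K] N}
    (hA : ∀ i, f ∘ₗ inA K C M i = g ∘ₗ inA K C M i)
    (hM : ∀ i, f ∘ₗ inM K C M i = g ∘ₗ inM K C M i)
    (hC : f ∘ₗ inC K C M = g ∘ₗ inC K C M) : f = g := by
  have h : f = (g : (Π₀ i, EndCoalg K C (M i)) × (Π₀ i, M i) × C →ₗ[K] N) := by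
    let _ : DecidableEq ι := Classical.decEq ι
    refine LinearMap.prod_ext (DFinsupp.lhom_ext' fun i => ?_)
      (LinearMap.prod_ext (DFinsupp.lhom_ext' fun i => ?_) hC)
    · exact hA i
    · exact hM i
  exact h

end desc

variable (K C M)

/-- The comultiplication: `δ(a) = a₁ ⊗ a₂` for `a ∈ A_{M_i}`, `δ(m) = m₋₁ ⊗ m₀ + m₀ ⊗ m₁` for
`m ∈ M_i`, `δ(c) = c₁ ⊗ c₂` for `c ∈ C`. The counit is that of `A_{M_i}` and of `C`, and it
vanishes on `M_i`. -/
instance : CoalgebraStruct K (ExtCoalg K C M) where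
  comul := desc K C M
    (fun i => TensorProduct.map (inA K C M i) (inA K C M i) ∘ₗ Coalgebra.comul)
    (fun i => TensorProduct.map (inA K C M i) (inM K C M i) ∘ₗ endCoact K C (M i) +
      TensorProduct.map (inM K C M i) (inC K C M) ∘ₗ rcoact K C (M i))
    (TensorProduct.map (inC K C M) (inC K C M) ∘ₗ Coalgebra.comul)
  counit := desc K C M (fun _ => Coalgebra.counit) (fun _ => 0) Coalgebra.counit

variable {K C M}

theorem comul_inA (i : ι) : Coalgebra.comul ∘ₗ inA K C M i =
    TensorProduct.map (inA K C M i) (inA K C M i) ∘ₗ Coalgebra.comul := desc_inA _ _ _ i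

theorem comul_inM (i : ι) : Coalgebra.comul ∘ₗ inM K C M i =
    TensorProduct.map (inA K C M i) (inM K C M i) ∘ₗ endCoact K C (M i) +
      TensorProduct.map (inM K C M i) (inC K C M) ∘ₗ rcoact K C (M i) := desc_inM _ _ _ i

theorem comul_inC : Coalgebra.comul ∘ₗ inC K C M =
    TensorProduct.map (inC K C M) (inC K C M) ∘ₗ Coalgebra.comul := desc_inC _ _ _

theorem counit_inA (i : ι) : Coalgebra.counit ∘ₗ inA K C M i = Coalgebra.counit (R := K) :=
  desc_inA _ _ _ i

theorem counit_inM (i : ι) : Coalgebra.counit (R := K) ∘ₗ inM K C M i = 0 := desc_inM _ _ _ i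

theorem counit_inC : Coalgebra.counit ∘ₗ inC K C M = Coalgebra.counit (R := K) := desc_inC _ _ _

section aux

variable {E P Q R S : Type*} [AddCommGroup E] [Module K E] [AddCommGroup P] [Module K P]
  [AddCommGroup Q] [Module K Q] [AddCommGroup R] [Module K R] [AddCommGroup S] [Module K S]

theorem assoc_aux (f₁ : Q →ₗ[K] E) (f₂ : R →ₗ[K] E) (d : P →ₗ[K] Q ⊗[K] R) (g : S →ₗ[K] E) :
    (TensorProduct.assoc K E E E).toLinearMap ∘ₗ
        TensorProduct.map (TensorProduct.map f₁ f₂ ∘ₗ d) g =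
      TensorProduct.map f₁ (TensorProduct.map f₂ g) ∘ₗ
        (TensorProduct.assoc K Q R S).toLinearMap ∘ₗ d.rTensor S := by
  have h : TensorProduct.map (TensorProduct.map f₁ f₂ ∘ₗ d) g =
      TensorProduct.map (TensorProduct.map f₁ f₂) g ∘ₗ d.rTensor S := by
    rw [LinearMap.map_comp_rTensor]
  rw [h, ← LinearMap.comp_assoc, ← LinearMap.comp_assoc]
  congr 1
  exact TensorProduct.ext_threefold fun _ _ _ => rfl

theorem lTensor_aux (f₁ : Q →ₗ[K] E) (f₂ : R →ₗ[K] E) (d : P →ₗ[K] Q ⊗[K] R) (g : S →ₗ[K] E) :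
    TensorProduct.map g (TensorProduct.map f₁ f₂ ∘ₗ d) =
      TensorProduct.map g (TensorProduct.map f₁ f₂) ∘ₗ d.lTensor S := by
  rw [LinearMap.map_comp_lTensor]

end aux

variable (K C M)

instance : Coalgebra K (ExtCoalg K C M) where
  coassoc := by
    refine hom_ext (fun i => ?_) (fun i => ?_) ?_
    · simp only [LinearMap.comp_assoc, comul_inA]
      simp only [← LinearMap.comp_assoc _ _ (LinearMap.rTensor _ _),
        ← LinearMap.comp_assoc _ _ (LinearMap.lTensor _ _), LinearMap.rTensor_comp_map,
        LinearMap.lTensor_comp_map, comul_inA]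
      rw [← LinearMap.comp_assoc, assoc_aux, lTensor_aux, LinearMap.comp_assoc,
        LinearMap.comp_assoc, LinearMap.comp_assoc, Coalgebra.coassoc]
    · simp only [LinearMap.comp_assoc, comul_inM, LinearMap.comp_add]
      simp only [← LinearMap.comp_assoc _ _ (LinearMap.rTensor _ _),
        ← LinearMap.comp_assoc _ _ (LinearMap.lTensor _ _), LinearMap.rTensor_comp_map,
        LinearMap.lTensor_comp_map, comul_inA, comul_inM, comul_inC, TensorProduct.map_add_left,
        TensorProduct.map_add_right, LinearMap.add_comp, LinearMap.comp_add]
      simp only [← LinearMap.comp_assoc _ _ (LinearEquiv.toLinearMap _), assoc_aux, lTensor_aux]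
      simp only [LinearMap.comp_assoc]
      rw [endCoact_coassoc, endCoact_compat, RightComodule.coassoc]
      abel
    · simp only [LinearMap.comp_assoc, comul_inC]
      simp only [← LinearMap.comp_assoc _ _ (LinearMap.rTensor _ _),
        ← LinearMap.comp_assoc _ _ (LinearMap.lTensor _ _), LinearMap.rTensor_comp_map,
        LinearMap.lTensor_comp_map, comul_inC]
      rw [← LinearMap.comp_assoc, assoc_aux, lTensor_aux, LinearMap.comp_assoc,
        LinearMap.comp_assoc, LinearMap.comp_assoc, Coalgebra.coassoc]
  rTensor_counit_comp_comul := by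
    refine hom_ext (fun i => ?_) (fun i => ?_) ?_
    · rw [LinearMap.comp_assoc, comul_inA, ← LinearMap.comp_assoc, LinearMap.rTensor_comp_map,
        counit_inA, ← LinearMap.lTensor_comp_rTensor, LinearMap.comp_assoc,
        Coalgebra.rTensor_counit_comp_comul]
      rfl
    · rw [LinearMap.comp_assoc, comul_inM, LinearMap.comp_add, ← LinearMap.comp_assoc,
        ← LinearMap.comp_assoc, LinearMap.rTensor_comp_map, LinearMap.rTensor_comp_map,
        counit_inA, counit_inM, TensorProduct.map_zero_left, LinearMap.zero_comp, add_zero,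
        ← LinearMap.lTensor_comp_rTensor, LinearMap.comp_assoc, endCoact_counit]
      rfl
    · rw [LinearMap.comp_assoc, comul_inC, ← LinearMap.comp_assoc, LinearMap.rTensor_comp_map,
        counit_inC, ← LinearMap.lTensor_comp_rTensor, LinearMap.comp_assoc,
        Coalgebra.rTensor_counit_comp_comul]
      rfl
  lTensor_counit_comp_comul := by
    refine hom_ext (fun i => ?_) (fun i => ?_) ?_
    · rw [LinearMap.comp_assoc, comul_inA, ← LinearMap.comp_assoc, LinearMap.lTensor_comp_map,
        counit_inA, ← LinearMap.rTensor_comp_lTensor, LinearMap.comp_assoc,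
        Coalgebra.lTensor_counit_comp_comul]
      rfl
    · rw [LinearMap.comp_assoc, comul_inM, LinearMap.comp_add, ← LinearMap.comp_assoc,
        ← LinearMap.comp_assoc, LinearMap.lTensor_comp_map, LinearMap.lTensor_comp_map,
        counit_inC, counit_inM, TensorProduct.map_zero_right, LinearMap.zero_comp, zero_add,
        ← LinearMap.rTensor_comp_lTensor, LinearMap.comp_assoc, RightComodule.counit_coact]
      rfl
    · rw [LinearMap.comp_assoc, comul_inC, ← LinearMap.comp_assoc, LinearMap.lTensor_comp_map,
        counit_inC, ← LinearMap.rTensor_comp_lTensor, LinearMap.comp_assoc,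
        Coalgebra.lTensor_counit_comp_comul]
      rfl

/-- The inclusion of `A_{M_i}` as a coalgebra map. -/
def inACoalg (i : ι) : EndCoalg K C (M i) →ₗc[K] ExtCoalg K C M where
  __ := inA K C M i
  counit_comp := counit_inA i
  map_comp_comul := (comul_inA i).symm

/-- The inclusion of `C` as a coalgebra map. -/
def inCCoalg : C →ₗc[K] ExtCoalg K C M where
  __ := inC K C M
  counit_comp := counit_inC
  map_comp_comul := comul_inC.symm

end ExtCoalg

end Extension

/-! ### Representatives of the finite dimensional right comodules -/

section Representatives

variable (K : Type*) [Field K] (C : Type*) [AddCommGroup C] [Module K C] [Coalgebra K C]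

/-- A right `C`-comodule structure on some `Kⁿ`. -/
structure FinRightComodule where
  dim : ℕ
  str : RightComodule K C (Fin dim → K)

namespace FinRightComodule

variable {K C}

/-- The underlying vector space `Kⁿ`. -/
def carrier (X : FinRightComodule K C) : Type _ := Fin X.dim → K

instance (X : FinRightComodule K C) : AddCommGroup X.carrier :=
  inferInstanceAs (AddCommGroup (Fin X.dim → K))
instance (X : FinRightComodule K C) : Module K X.carrier :=
  inferInstanceAs (Module K (Fin X.dim → K))
instance (X : FinRightComodule K C) : FiniteDimensional K X.carrier :=
  inferInstanceAs (FiniteDimensional K (Fin X.dim → K))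
instance (X : FinRightComodule K C) : RightComodule K C X.carrier := X.str

variable (K C)

/-- Isomorphism of right comodules. -/
instance isoSetoid : Setoid (FinRightComodule K C) where
  r X Y := ∃ e : X.carrier ≃ₗ[K] Y.carrier, IsRightComoduleHom K C e.toLinearMap
  iseqv := by
    refine ⟨fun X => ⟨LinearEquiv.refl K _, ?_⟩, ?_, ?_⟩
    · change (LinearMap.id : X.carrier →ₗ[K] X.carrier).rTensor C ∘ₗ _ = _ ∘ₗ LinearMap.id
      rw [LinearMap.rTensor_id, LinearMap.id_comp, LinearMap.comp_id]
    · rintro X Y ⟨e, he⟩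
      refine ⟨e.symm, ?_⟩
      have he' : e.toLinearMap.rTensor C ∘ₗ rcoact K C X.carrier =
        rcoact K C Y.carrier ∘ₗ e.toLinearMap := he
      have h₁ : e.symm.toLinearMap ∘ₗ e.toLinearMap = LinearMap.id := by ext; simp
      have h₂ : e.toLinearMap ∘ₗ e.symm.toLinearMap = LinearMap.id := by ext; simp
      change e.symm.toLinearMap.rTensor C ∘ₗ rcoact K C Y.carrier =
        rcoact K C X.carrier ∘ₗ e.symm.toLinearMap
      calc _ = e.symm.toLinearMap.rTensor C ∘ₗ (rcoact K C Y.carrier ∘ₗ e.toLinearMap) ∘ₗ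
              e.symm.toLinearMap := by rw [LinearMap.comp_assoc, h₂, LinearMap.comp_id]
        _ = _ := by
          rw [← he', LinearMap.comp_assoc, ← LinearMap.comp_assoc, ← LinearMap.rTensor_comp, h₁,
            LinearMap.rTensor_id, LinearMap.id_comp]
    · rintro X Y Z ⟨e, he⟩ ⟨f, hf⟩
      refine ⟨e.trans f, ?_⟩
      have he' : e.toLinearMap.rTensor C ∘ₗ rcoact K C X.carrier =
        rcoact K C Y.carrier ∘ₗ e.toLinearMap := he
      have hf' : f.toLinearMap.rTensor C ∘ₗ rcoact K C Y.carrier =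
        rcoact K C Z.carrier ∘ₗ f.toLinearMap := hf
      change (f.toLinearMap ∘ₗ e.toLinearMap).rTensor C ∘ₗ rcoact K C X.carrier =
        rcoact K C Z.carrier ∘ₗ f.toLinearMap ∘ₗ e.toLinearMap
      rw [LinearMap.rTensor_comp, LinearMap.comp_assoc, he', ← LinearMap.comp_assoc, hf',
        LinearMap.comp_assoc]

end FinRightComodule

/-- The set of isomorphism types of finite dimensional right `C`-comodules. -/
def IsoType : Type _ := Quotient (FinRightComodule.isoSetoid K C)

variable {K C} in
/-- The chosen representative of an isomorphism type. -/
def IsoType.rep (q : IsoType K C) : FinRightComodule K C := Quotient.out q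

/-- The set of isomorphism types of indecomposable finite dimensional right `C`-comodules. -/
def IndecType : Type _ := {q : IsoType K C // IsIndecomposable K C q.rep.carrier}

variable {K C} in
/-- The chosen representative of an isomorphism type. -/
def IndecType.rep (q : IndecType K C) : FinRightComodule K C := IsoType.rep q.1

/-- The coalgebra `C' = (⨁ A_M) ⊕ (⨁ M) ⊕ C`, the sums being over representatives `M` of all
finite dimensional right `C`-comodules. -/
abbrev PrimeCoalg : Type _ := ExtCoalg K C (fun q : IsoType K C => q.rep.carrier)

/-- The coalgebra `C~ = (⨁ A_M) ⊕ (⨁ M) ⊕ C`, the sums being over representatives `M` of the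
indecomposable finite dimensional right `C`-comodules. -/
abbrev TildeCoalg : Type _ := ExtCoalg K C (fun q : IndecType K C => q.rep.carrier)

variable {C}

/-- The subspace of `C~` spanned by the elements `g - h`, with `h` a group-like element of some
`A_M`. (If `K` is algebraically closed, each `A_M` has exactly one group-like element.) -/
def veeCoideal (g : C) : Submodule K (TildeCoalg K C) :=
  Submodule.span K {x | ∃ (q : IndecType K C) (h : EndCoalg K C q.rep.carrier),
    IsGroupLikeElem K h ∧ x = ExtCoalg.inCCoalg K C _ g - ExtCoalg.inACoalg K C _ q h}

theorem isCoideal_veeCoideal {g : C} (hg : IsGroupLikeElem K g) : (veeCoideal K g).IsCoideal := by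
  have key : ∀ x y : TildeCoalg K C, IsGroupLikeElem K x → IsGroupLikeElem K y →
      x - y ∈ veeCoideal K g → Coalgebra.counit (R := K) (x - y) = 0 ∧
      TensorProduct.map (veeCoideal K g).mkQ (veeCoideal K g).mkQ (Coalgebra.comul (x - y)) = 0 := by
    intro x y hx hy hxy
    refine ⟨by simp [hx.counit_eq_one, hy.counit_eq_one], ?_⟩
    have h : (veeCoideal K g).mkQ x = (veeCoideal K g).mkQ y := by
      simpa using (Submodule.Quotient.eq _).2 hxy
    rw [map_sub, hx.comul_eq_tmul_self, hy.comul_eq_tmul_self, map_sub, TensorProduct.map_tmul,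
      TensorProduct.map_tmul, h, sub_self]
  have hgen : ∀ x ∈ {x | ∃ (q : IndecType K C) (h : EndCoalg K C q.rep.carrier),
      IsGroupLikeElem K h ∧ x = ExtCoalg.inCCoalg K C (fun q : IndecType K C => q.rep.carrier) g -
        ExtCoalg.inACoalg K C _ q h}, Coalgebra.counit (R := K) x = 0 ∧
      TensorProduct.map (veeCoideal K g).mkQ (veeCoideal K g).mkQ (Coalgebra.comul x) = 0 := by
    rintro x ⟨q, h, hh, rfl⟩
    exact key _ _ (hg.map _) (hh.map _) (Submodule.subset_span ⟨q, h, hh, rfl⟩)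
  constructor
  · intro x hx
    exact (Submodule.span_le (p := LinearMap.ker (Coalgebra.counit (R := K)))).2
      (fun y hy => (hgen y hy).1) hx
  · intro x hx
    exact (Submodule.span_le (p := LinearMap.ker (TensorProduct.map (veeCoideal K g).mkQ
      (veeCoideal K g).mkQ ∘ₗ Coalgebra.comul))).2 (fun y hy => (hgen y hy).2) hx

end Representatives

/-! ### The union of a sequence of coalgebras -/

section SeqColim

variable (K : Type*) [Field K] (X : ℕ → Type*) [∀ n, AddCommGroup (X n)] [∀ n, Module K (X n)]
  [∀ n, Coalgebra K (X n)] (f : ∀ n, X n →ₗc[K] X (n + 1))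

/-- The subspace of `⨁ X n` spanned by the elements `x - f n x`, `x ∈ X n`. -/
def seqRel : Submodule K (Π₀ n, X n) :=
  Submodule.span K {x | ∃ (n : ℕ) (y : X n),
    x = DFinsupp.lsingle (R := K) n y - DFinsupp.lsingle (R := K) (n + 1) (f n y)}

instance isCoideal_seqRel : (seqRel K X f).IsCoideal := by
  have hgen : ∀ x ∈ {x : Π₀ n, X n | ∃ (n : ℕ) (y : X n),
      x = DFinsupp.lsingle (R := K) n y - DFinsupp.lsingle (R := K) (n + 1) (f n y)},
      Coalgebra.counit (R := K) x = 0 ∧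
      TensorProduct.map (seqRel K X f).mkQ (seqRel K X f).mkQ (Coalgebra.comul x) = 0 := by
    rintro x ⟨n, y, rfl⟩
    constructor
    · simp
    · have h : (seqRel K X f).mkQ ∘ₗ DFinsupp.lsingle n =
          ((seqRel K X f).mkQ ∘ₗ DFinsupp.lsingle (n + 1)) ∘ₗ (f n).toLinearMap := by
        refine LinearMap.ext fun y => ?_
        exact (Submodule.Quotient.eq _).2 (Submodule.subset_span ⟨n, y, rfl⟩)
      have hf : TensorProduct.map (f n).toLinearMap (f n).toLinearMap (Coalgebra.comul y) =
          Coalgebra.comul (R := K) (f n y) := LinearMap.congr_fun (f n).map_comp_comul y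
      rw [map_sub, map_sub, sub_eq_zero, DFinsupp.lsingle_apply, DFinsupp.lsingle_apply,
        DFinsupp.comul_single, DFinsupp.comul_single, ← hf]
      rw [TensorProduct.map_map, TensorProduct.map_map, TensorProduct.map_map, h]
  constructor
  · intro x hx
    exact (Submodule.span_le (p := LinearMap.ker (Coalgebra.counit (R := K)))).2
      (fun y hy => (hgen y hy).1) hx
  · intro x hx
    exact (Submodule.span_le (p := LinearMap.ker (TensorProduct.map (seqRel K X f).mkQ
      (seqRel K X f).mkQ ∘ₗ Coalgebra.comul))).2 (fun y hy => (hgen y hy).2) hx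

/-- The direct limit (the union, when the maps are injective) of a sequence of coalgebras
`X 0 → X 1 → ⋯`. -/
abbrev SeqColim : Type _ := (Π₀ n, X n) ⧸ seqRel K X f

/-- The canonical map `X n → SeqColim`. -/
def SeqColim.of (n : ℕ) : X n →ₗc[K] SeqColim K X f where
  __ := (seqRel K X f).mkQ ∘ₗ DFinsupp.lsingle n
  counit_comp := by
    ext x
    simp
  map_comp_comul := by
    ext x
    simp [TensorProduct.map_map]

end SeqColim

/-! ### The coalgebras `C_∞` and `C_∞^∨` -/

section Towers

/-- A coalgebra, as a bundled object. -/
structure CoalgObj (K : Type u) [Field K] where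
  carrier : Type u
  [instAddCommGroup : AddCommGroup carrier]
  [instModule : Module K carrier]
  [instCoalgebra : Coalgebra K carrier]

attribute [instance] CoalgObj.instAddCommGroup CoalgObj.instModule CoalgObj.instCoalgebra

/-- A coalgebra with a chosen group-like element, as a bundled object. -/
structure PointedCoalgObj (K : Type u) [Field K] extends CoalgObj K where
  point : carrier
  isGroupLike : IsGroupLikeElem K point

variable (K : Type u) [Field K]

/-- `C ↦ C'`. -/
def CoalgObj.prime (X : CoalgObj K) : CoalgObj K where
  carrier := PrimeCoalg K X.carrier

/-- The embedding `C → C'`. -/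
def CoalgObj.toPrime (X : CoalgObj K) : X.carrier →ₗc[K] (X.prime K).carrier :=
  ExtCoalg.inCCoalg K X.carrier _

/-- `C ↦ C^∨ = C~ / I`, where `I` is spanned by the elements `g - g_M`. -/
def PointedCoalgObj.vee (X : PointedCoalgObj K) : PointedCoalgObj K :=
  haveI := isCoideal_veeCoideal K X.isGroupLike
  { carrier := TildeCoalg K X.carrier ⧸ veeCoideal K X.point
    point := Coalgebra.Quotient.mkQCoalgHom _ (ExtCoalg.inCCoalg K X.carrier _ X.point)
    isGroupLike := (X.isGroupLike.map _).map _ }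

/-- The canonical map `C → C^∨`. -/
def PointedCoalgObj.toVee (X : PointedCoalgObj K) : X.carrier →ₗc[K] (X.vee K).carrier :=
  haveI := isCoideal_veeCoideal K X.isGroupLike
  (Coalgebra.Quotient.mkQCoalgHom (R := K) (veeCoideal K X.point)).comp
    (ExtCoalg.inCCoalg K X.carrier _)

/-- The sequence `X, X', X'', …`. -/
def primeTower (X : CoalgObj K) : ℕ → CoalgObj K
  | 0 => X
  | n + 1 => (primeTower X n).prime K

/-- The embeddings in the sequence `X, X', X'', …`. -/
def primeTowerMap (X : CoalgObj K) (n : ℕ) :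
    (primeTower K X n).carrier →ₗc[K] (primeTower K X (n + 1)).carrier :=
  (primeTower K X n).toPrime K

/-- The sequence `X, X^∨, X^∨^∨, …`. -/
def veeTower (X : PointedCoalgObj K) : ℕ → PointedCoalgObj K
  | 0 => X
  | n + 1 => (veeTower X n).vee K

/-- The canonical maps in the sequence `X, X^∨, X^∨^∨, …`. -/
def veeTowerMap (X : PointedCoalgObj K) (n : ℕ) :
    (veeTower K X n).carrier →ₗc[K] (veeTower K X (n + 1)).carrier :=
  (veeTower K X n).toVee K

variable (C : Type u) [AddCommGroup C] [Module K C] [Coalgebra K C]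

/-- The coalgebra `C_∞ = ⋃ C^{(n)}`, where `C^{(0)} = C` and `C^{(n+1)} = (C^{(n)})'`. -/
def CInfty : Type u :=
  SeqColim K (fun n => (primeTower K ⟨C⟩ n).carrier) (primeTowerMap K ⟨C⟩)

instance : AddCommGroup (CInfty K C) := inferInstanceAs (AddCommGroup (SeqColim K _ _))
instance : Module K (CInfty K C) := inferInstanceAs (Module K (SeqColim K _ _))
instance : Coalgebra K (CInfty K C) := inferInstanceAs (Coalgebra K (SeqColim K _ _))

variable {C} {g : C} (hg : IsGroupLikeElem K g)

/-- The coalgebra `C_∞^∨ = ⋃ C^{[n]}`, where `C^{[0]} = C` and `C^{[n+1]} = (C^{[n]})^∨`, for a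
coalgebra `C` with group-like element `g`. -/
def CInftyVee : Type u :=
  SeqColim K (fun n => (veeTower K ⟨⟨C⟩, g, hg⟩ n).carrier) (veeTowerMap K ⟨⟨C⟩, g, hg⟩)

instance : AddCommGroup (CInftyVee K hg) := inferInstanceAs (AddCommGroup (SeqColim K _ _))
instance : Module K (CInftyVee K hg) := inferInstanceAs (Module K (SeqColim K _ _))
instance : Coalgebra K (CInftyVee K hg) := inferInstanceAs (Coalgebra K (SeqColim K _ _))

/-- The image of `g` in `C_∞^∨`. -/
def CInftyVee.point : CInftyVee K hg :=
  SeqColim.of K (fun n => (veeTower K ⟨⟨C⟩, g, hg⟩ n).carrier) (veeTowerMap K ⟨⟨C⟩, g, hg⟩) 0 g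

end Towers

/-! ### The divided power coalgebra -/

section DividedPower

variable (K : Type*) [Field K]

/-- The vector space with basis `c_n`, `n ≥ 0`. -/
def DividedPower : Type _ := ℕ →₀ K

namespace DividedPower

instance : AddCommGroup (DividedPower K) := inferInstanceAs (AddCommGroup (ℕ →₀ K))
instance : Module K (DividedPower K) := inferInstanceAs (Module K (ℕ →₀ K))

/-- The basis `c_n`. -/
def basis : Module.Basis ℕ K (DividedPower K) := ⟨LinearEquiv.refl K (ℕ →₀ K)⟩

/-- `Δ(c_n) = ∑_{i+j=n} c_i ⊗ c_j` and `ε(c_n) = δ_{0,n}`. -/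
instance : CoalgebraStruct K (DividedPower K) where
  comul := (basis K).constr ℕ fun n =>
    ∑ p ∈ Finset.HasAntidiagonal.antidiagonal n, basis K p.1 ⊗ₜ[K] basis K p.2
  counit := (basis K).constr ℕ fun n => if n = 0 then 1 else 0

theorem comul_basis (n : ℕ) : Coalgebra.comul (R := K) (basis K n) =
    ∑ p ∈ Finset.HasAntidiagonal.antidiagonal n, basis K p.1 ⊗ₜ[K] basis K p.2 :=
  (basis K).constr_basis ℕ _ n

theorem counit_basis (n : ℕ) : Coalgebra.counit (R := K) (basis K n) = if n = 0 then 1 else 0 :=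
  (basis K).constr_basis ℕ _ n

instance : Coalgebra K (DividedPower K) where
  coassoc := by
    refine (basis K).ext fun n => ?_
    simp only [LinearMap.comp_apply, LinearEquiv.coe_coe, comul_basis, map_sum,
      LinearMap.rTensor_tmul, LinearMap.lTensor_tmul, TensorProduct.sum_tmul,
      TensorProduct.tmul_sum, TensorProduct.assoc_tmul]
    rw [Finset.sum_sigma', Finset.sum_sigma']
    refine Finset.sum_bij' (fun x _ => ⟨(x.2.1, x.2.2 + x.1.2), (x.2.2, x.1.2)⟩)
      (fun x _ => ⟨(x.1.1 + x.2.1, x.2.2), (x.1.1, x.2.1)⟩) ?_ ?_ ?_ ?_ ?_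
    · rintro ⟨⟨a, b⟩, c, d⟩ h
      simp only [Finset.mem_sigma, Finset.HasAntidiagonal.mem_antidiagonal] at h ⊢
      obtain ⟨h₁, h₂⟩ := h
      refine ⟨?_, ?_⟩ <;> (try dsimp only) <;> omega
    · rintro ⟨⟨a, b⟩, c, d⟩ h
      simp only [Finset.mem_sigma, Finset.HasAntidiagonal.mem_antidiagonal] at h ⊢
      obtain ⟨h₁, h₂⟩ := h
      refine ⟨?_, ?_⟩ <;> (try dsimp only) <;> omega
    · rintro ⟨⟨a, b⟩, c, d⟩ h
      simp only [Finset.mem_sigma, Finset.HasAntidiagonal.mem_antidiagonal] at h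
      obtain ⟨-, rfl⟩ := h
      rfl
    · rintro ⟨⟨a, b⟩, c, d⟩ h
      simp only [Finset.mem_sigma, Finset.HasAntidiagonal.mem_antidiagonal] at h
      obtain ⟨-, rfl⟩ := h
      rfl
    · rintro ⟨⟨a, b⟩, c, d⟩ h
      rfl
  rTensor_counit_comp_comul := by
    refine (basis K).ext fun n => ?_
    simp only [LinearMap.comp_apply, comul_basis, map_sum, LinearMap.rTensor_tmul, counit_basis]
    rw [Finset.sum_eq_single (0, n)]
    · simp
    · rintro ⟨i, j⟩ hij hne
      have : i ≠ 0 := by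
        rintro rfl
        simp_all
      simp [this]
    · simp
  lTensor_counit_comp_comul := by
    refine (basis K).ext fun n => ?_
    simp only [LinearMap.comp_apply, comul_basis, map_sum, LinearMap.lTensor_tmul, counit_basis]
    rw [Finset.sum_eq_single (n, 0)]
    · simp
    · rintro ⟨i, j⟩ hij hne
      have : j ≠ 0 := by
        rintro rfl
        simp_all
      simp [this]
    · simp

/-- The element `c_0` is group-like. -/
theorem isGroupLikeElem_zero : IsGroupLikeElem K (basis K 0) where
  counit_eq_one := by simp [counit_basis]
  comul_eq_tmul_self := by simp [comul_basis]

end DividedPower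

end DividedPower

end Comod

end

/-! The negative and the positive assertions have independent proofs.

The negative ones rest on a single property, `HasLargeMonolithic`: there is an infinite dimensional
left coideal E with a nonzero element s lying in every nonzero left subcomodule of E. Then s
generates the simple essential socle of E, and a comodule map that does not kill s is injective on
E. This property is equivalent to the failure of right semiperfectness: an infinite dimensional
injective envelope of a simple comodule embeds in C through a suitable functional, and conversely E
sits in an injective hull inside C (`IsMonolithic.exists_retract`). It excludes projectivity, since
a splitting of the sum of all finite dimensional coideals onto C would embed E in one of them. It
excludes QcF, since E* would be finite dimensional. Finally it passes along injective coalgebra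
maps, hence from C to both unions.

For the generating condition, a finite dimensional piece of a comodule over the union has its
coefficients in some term X n, and it is a sum of images of indecomposable X n-comodules N. The next
term contains a copy of N. The projection onto it is a comodule map: in Δ(m) = m₋₁ ⊗ m₀ + m₀ ⊗ m₁
the first summand has its left leg in A_N, which is killed. The same computation extends a comodule
map from each term to the next, by zero on the new summands, and so to the whole union. In the case
of C^∨ the maps must descend to the quotient by I, which they do when they vanish on g. This
condition is carried along in `IsGeneratingStep`.

Connectedness of C^∨ is proved by convolution. Let S be a simple subcoalgebra not containing g. It
meets neither the image of C nor the image of any A_M: the endomorphism algebra of an indecomposable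
M is local with residue field K, so a simple subcoalgebra inside the image of A_M contains the image
of g_M, which is the image of g. Hence there are functionals equal to ε on S and vanishing on these
images. Convolution preserves equality with ε on S, and a product of two such functionals vanishes
on the wedge of the two subspaces. Since M lies in the wedge of A_M and C, every element of C^∨ lies
in a subcoalgebra separated from S, S included, which is absurd because ε is not zero on S. -/

noncomputable section

namespace Comod

/-! ### Contractions of tensors -/

section Contraction

variable {K : Type*} [Field K] {V W V' W' : Type*} [AddCommGroup V] [Module K V]
  [AddCommGroup W] [Module K W] [AddCommGroup V'] [Module K V'] [AddCommGroup W'] [Module K W']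

/-- Contraction of the left leg of a tensor with a functional. -/
def contractL (f : V →ₗ[K] K) : V ⊗[K] W →ₗ[K] W :=
  (TensorProduct.lid K W).toLinearMap ∘ₗ f.rTensor W

/-- Contraction of the right leg of a tensor with a functional. -/
def contractR (f : W →ₗ[K] K) : V ⊗[K] W →ₗ[K] V :=
  (TensorProduct.rid K V).toLinearMap ∘ₗ f.lTensor V

@[simp]
theorem contractL_tmul (f : V →ₗ[K] K) (v : V) (w : W) : contractL f (v ⊗ₜ[K] w) = f v • w := by
  simp [contractL]

@[simp]
theorem contractR_tmul (f : W →ₗ[K] K) (v : V) (w : W) : contractR f (v ⊗ₜ[K] w) = f w • v := by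
  simp [contractR]

theorem contractL_map (g : V →ₗ[K] V') (h : W →ₗ[K] W') (f : V' →ₗ[K] K) (x : V ⊗[K] W) :
    contractL f (TensorProduct.map g h x) = h (contractL (f ∘ₗ g) x) := by
  induction x using TensorProduct.induction_on with
  | zero => simp
  | tmul v w => simp
  | add x y hx hy => simp only [map_add, hx, hy]

theorem contractR_map (g : V →ₗ[K] V') (h : W →ₗ[K] W') (f : W' →ₗ[K] K) (x : V ⊗[K] W) :
    contractR f (TensorProduct.map g h x) = g (contractR (f ∘ₗ h) x) := by
  induction x using TensorProduct.induction_on with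
  | zero => simp
  | tmul v w => simp
  | add x y hx hy => simp only [map_add, hx, hy]

theorem contractR_comm (f : V →ₗ[K] K) (x : V ⊗[K] W) :
    contractR f (TensorProduct.comm K V W x) = contractL f x := by
  induction x using TensorProduct.induction_on with
  | zero => simp
  | tmul v w => simp
  | add x y hx hy => simp only [map_add, hx, hy]

theorem contractR_lTensor (f : W' →ₗ[K] K) (g : W →ₗ[K] W') (x : V ⊗[K] W) :
    contractR f (g.lTensor V x) = contractR (f ∘ₗ g) x :=
  contractR_map LinearMap.id g f x

theorem contractL_rTensor (f : V' →ₗ[K] K) (g : V →ₗ[K] V') (x : V ⊗[K] W) :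
    contractL f (g.rTensor W x) = contractL (f ∘ₗ g) x :=
  contractL_map g LinearMap.id f x

theorem contractR_rTensor (f : W →ₗ[K] K) (g : V →ₗ[K] V') (x : V ⊗[K] W) :
    contractR f (g.rTensor W x) = g (contractR f x) :=
  contractR_map g LinearMap.id f x

theorem contractL_lTensor (f : V →ₗ[K] K) (g : W →ₗ[K] W') (x : V ⊗[K] W) :
    contractL f (g.lTensor V x) = g (contractL f x) :=
  contractL_map LinearMap.id g f x

/-- A tensor vanishes if all its right contractions vanish. -/
theorem eq_zero_of_contractR {x : V ⊗[K] W} (h : ∀ f : W →ₗ[K] K, contractR f x = 0) : x = 0 := by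
  classical
  set b := Module.Free.chooseBasis K W
  have key : ∀ (y : V ⊗[K] W) i,
      TensorProduct.equivFinsuppOfBasisRight b y i = contractR (b.coord i) y := by
    intro y i
    induction y using TensorProduct.induction_on with
    | zero => simp
    | tmul v w => simp
    | add x y hx hy => simp only [map_add, Finsupp.add_apply, hx, hy]
  refine (TensorProduct.equivFinsuppOfBasisRight b).injective (Finsupp.ext fun i => ?_)
  rw [key, h, map_zero, Finsupp.zero_apply]

theorem mem_range_rTensor_subtype {P : Submodule K V} {x : V ⊗[K] W} :
    x ∈ LinearMap.range (P.subtype.rTensor W) ↔ ∀ f : W →ₗ[K] K, contractR f x ∈ P := by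
  constructor
  · rintro ⟨y, rfl⟩ f
    rw [contractR_rTensor]
    exact (contractR f y).2
  · intro h
    refine (rTensor_exact W (LinearMap.exact_subtype_mkQ P) P.mkQ_surjective x).1
      (eq_zero_of_contractR fun f => ?_)
    rw [contractR_rTensor]
    exact (Submodule.Quotient.mk_eq_zero P).2 (h f)

/-- A tensor vanishes if all its left contractions vanish. -/
theorem eq_zero_of_contractL {x : V ⊗[K] W} (h : ∀ f : V →ₗ[K] K, contractL f x = 0) : x = 0 :=
  (TensorProduct.comm K V W).injective <| by
    rw [map_zero]
    exact eq_zero_of_contractR fun f => by rw [contractR_comm, h]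

theorem mem_range_lTensor_subtype {Q : Submodule K W} {x : V ⊗[K] W} :
    x ∈ LinearMap.range (Q.subtype.lTensor V) ↔ ∀ f : V →ₗ[K] K, contractL f x ∈ Q := by
  constructor
  · rintro ⟨y, rfl⟩ f
    rw [contractL_lTensor]
    exact (contractL f y).2
  · intro h
    refine (lTensor_exact V (LinearMap.exact_subtype_mkQ Q) Q.mkQ_surjective x).1
      (eq_zero_of_contractL fun f => ?_)
    rw [contractL_lTensor]
    exact (Submodule.Quotient.mk_eq_zero Q).2 (h f)

/-- Over a field P ⊗ Q is the intersection of P ⊗ W and V ⊗ Q, because functionals on P extend to V.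
This makes the subcoalgebra condition testable one functional at a time. -/
theorem mem_range_map_subtype {P : Submodule K V} {Q : Submodule K W} {x : V ⊗[K] W} :
    x ∈ LinearMap.range (TensorProduct.map P.subtype Q.subtype) ↔
      (∀ f : W →ₗ[K] K, contractR f x ∈ P) ∧ ∀ f : V →ₗ[K] K, contractL f x ∈ Q := by
  constructor
  · rintro ⟨y, rfl⟩
    refine ⟨fun f => ?_, fun f => ?_⟩
    · rw [contractR_map]
      exact (contractR _ y).2
    · rw [contractL_map]
      exact (contractL _ y).2
  · rintro ⟨hP, hQ⟩
    obtain ⟨y, rfl⟩ := mem_range_rTensor_subtype.2 hP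
    have hy : y ∈ LinearMap.range (Q.subtype.lTensor P) := by
      refine mem_range_lTensor_subtype.2 fun f => ?_
      obtain ⟨g, rfl⟩ := f.exists_extend
      rw [← contractL_rTensor]
      exact hQ g
    obtain ⟨z, rfl⟩ := hy
    exact ⟨z, by rw [← LinearMap.comp_apply, LinearMap.rTensor_comp_lTensor]⟩

end Contraction

/-! ### Convolution and contraction of coactions -/

section Conv

variable {K : Type*} [Field K] {C : Type*} [AddCommGroup C] [Module K C] [Coalgebra K C]

/-- The convolution product `c ↦ f(c₁) g(c₂)` of two functionals. -/
def conv (f g : C →ₗ[K] K) : C →ₗ[K] K :=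
  LinearMap.mul' K K ∘ₗ TensorProduct.map f g ∘ₗ Coalgebra.comul

theorem mul_map_eq_contractL {V W : Type*} [AddCommGroup V] [Module K V] [AddCommGroup W]
    [Module K W] (f : V →ₗ[K] K) (g : W →ₗ[K] K) (x : V ⊗[K] W) :
    LinearMap.mul' K K (TensorProduct.map f g x) = g (contractL f x) := by
  induction x using TensorProduct.induction_on with
  | zero => simp
  | tmul v w => simp
  | add x y hx hy => simp only [map_add, hx, hy]

theorem mul_map_eq_contractR {V W : Type*} [AddCommGroup V] [Module K V] [AddCommGroup W]
    [Module K W] (f : V →ₗ[K] K) (g : W →ₗ[K] K) (x : V ⊗[K] W) :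
    LinearMap.mul' K K (TensorProduct.map f g x) = f (contractR g x) := by
  induction x using TensorProduct.induction_on with
  | zero => simp
  | tmul v w => simp [mul_comm]
  | add x y hx hy => simp only [map_add, hx, hy]

theorem conv_apply_eq_contractL (f g : C →ₗ[K] K) (c : C) :
    conv f g c = g (contractL f (Coalgebra.comul c)) :=
  mul_map_eq_contractL f g _

theorem conv_apply_eq_contractR (f g : C →ₗ[K] K) (c : C) :
    conv f g c = f (contractR g (Coalgebra.comul c)) :=
  mul_map_eq_contractR f g _

section Right

variable {M : Type*} [AddCommGroup M] [Module K M] [RightComodule K C M]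

/-- Coassociativity read through functionals: a right comodule is a left module over the convolution
algebra. -/
theorem contractR_rcoact_contractR (f g : C →ₗ[K] K) (m : M) :
    contractR f (rcoact K C M (contractR g (rcoact K C M m))) =
      contractR (conv f g) (rcoact K C M m) := by
  have key : ∀ x : M ⊗[K] C, contractR f (rcoact K C M (contractR g x)) =
      contractR (LinearMap.mul' K K ∘ₗ TensorProduct.map f g)
        (TensorProduct.assoc K M C C ((rcoact K C M).rTensor C x)) := by
    have key2 : ∀ (y : M ⊗[K] C) (c : C), g c • contractR f y =
        contractR (LinearMap.mul' K K ∘ₗ TensorProduct.map f g)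
          (TensorProduct.assoc K M C C (y ⊗ₜ c)) := by
      intro y c
      induction y using TensorProduct.induction_on with
      | zero => simp
      | tmul m d => simp [smul_smul, mul_comm]
      | add x y hx hy => simp only [map_add, smul_add, TensorProduct.add_tmul, hx, hy]
    intro x
    induction x using TensorProduct.induction_on with
    | zero => simp
    | tmul m c => rw [contractR_tmul, map_smul, map_smul, LinearMap.rTensor_tmul, key2]
    | add x y hx hy => simp only [map_add, hx, hy]
  have h := LinearMap.congr_fun (RightComodule.coassoc (K := K) (C := C) (M := M)) m
  simp only [LinearMap.comp_apply, LinearEquiv.coe_coe] at h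
  rw [key, h, contractR_lTensor]
  rfl

theorem contractR_counit_rcoact (m : M) :
    contractR Coalgebra.counit (rcoact K C M m) = m := by
  have h := LinearMap.congr_fun (RightComodule.counit_coact (K := K) (C := C) (M := M)) m
  change TensorProduct.rid K M (Coalgebra.counit.lTensor M (rcoact K C M m)) = m
  simp only [LinearMap.comp_apply] at h
  rw [h]
  simp

variable (K C) in
theorem isRightSubcomodule_iff {P : Submodule K M} : IsRightSubcomodule K C P ↔
    ∀ m ∈ P, ∀ f : C →ₗ[K] K, contractR f (rcoact K C M m) ∈ P := by
  simp only [IsRightSubcomodule, mem_range_rTensor_subtype]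

end Right

section Left

variable {M : Type*} [AddCommGroup M] [Module K M] [LeftComodule K C M]

/-- The left-handed version; the order of the factors is reversed, since a left comodule is a right
C*-module. -/
theorem contractL_lcoact_contractL (f g : C →ₗ[K] K) (m : M) :
    contractL f (lcoact K C M (contractL g (lcoact K C M m))) =
      contractL (conv g f) (lcoact K C M m) := by
  have key : ∀ x : C ⊗[K] M, contractL f (lcoact K C M (contractL g x)) =
      contractL (LinearMap.mul' K K ∘ₗ TensorProduct.map g f)
        ((TensorProduct.assoc K C C M).symm ((lcoact K C M).lTensor C x)) := by
    have key2 : ∀ (y : C ⊗[K] M) (c : C), g c • contractL f y =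
        contractL (LinearMap.mul' K K ∘ₗ TensorProduct.map g f)
          ((TensorProduct.assoc K C C M).symm (c ⊗ₜ y)) := by
      intro y c
      induction y using TensorProduct.induction_on with
      | zero => simp
      | tmul m d => simp [smul_smul]
      | add x y hx hy => simp only [map_add, smul_add, TensorProduct.tmul_add, hx, hy]
    intro x
    induction x using TensorProduct.induction_on with
    | zero => simp
    | tmul m c => rw [contractL_tmul, map_smul, map_smul, LinearMap.lTensor_tmul, key2]
    | add x y hx hy => simp only [map_add, hx, hy]
  have h := LinearMap.congr_fun (LeftComodule.coassoc (K := K) (C := C) (M := M)) m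
  simp only [LinearMap.comp_apply, LinearEquiv.coe_coe] at h
  rw [key, ← h, LinearEquiv.symm_apply_apply, contractL_rTensor]
  rfl

theorem contractL_counit_lcoact (m : M) :
    contractL Coalgebra.counit (lcoact K C M m) = m := by
  have h := LinearMap.congr_fun (LeftComodule.counit_coact (K := K) (C := C) (M := M)) m
  change TensorProduct.lid K M (Coalgebra.counit.rTensor M (lcoact K C M m)) = m
  simp only [LinearMap.comp_apply] at h
  rw [h]
  simp

variable (K C) in
theorem isLeftSubcomodule_iff {P : Submodule K M} : IsLeftSubcomodule K C P ↔
    ∀ m ∈ P, ∀ f : C →ₗ[K] K, contractL f (lcoact K C M m) ∈ P := by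
  simp only [IsLeftSubcomodule, mem_range_lTensor_subtype]

end Left

theorem contractL_counit_comul (c : C) :
    contractL Coalgebra.counit (Coalgebra.comul (R := K) c) = c :=
  contractL_counit_lcoact (K := K) (C := C) c

theorem contractR_counit_comul (c : C) :
    contractR Coalgebra.counit (Coalgebra.comul (R := K) c) = c :=
  contractR_counit_rcoact (K := K) (C := C) c

end Conv

theorem isSubcoalgebra_iff {K C : Type u} [Field K] [AddCommGroup C] [Module K C]
    [Coalgebra K C] {D : Submodule K C} : IsSubcoalgebra K D ↔ ∀ d ∈ D,
    (∀ f : C →ₗ[K] K, contractR f (Coalgebra.comul d) ∈ D) ∧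
      ∀ f : C →ₗ[K] K, contractL f (Coalgebra.comul d) ∈ D := by
  simp only [IsSubcoalgebra, mem_range_map_subtype]

/-! ### Comodule structures induced along injections -/

section Restrict

variable {K : Type*} [Field K] {C D : Type*} [AddCommGroup C] [Module K C] [Coalgebra K C]
  [AddCommGroup D] [Module K D] [Coalgebra K D] {N M : Type*} [AddCommGroup M] [Module K M]
  [AddCommGroup N] [Module K N]

/-- A right coaction over `C` that becomes the coaction of a right `D`-comodule along injections
`C → D` and `N → M` is a comodule structure. -/
abbrev RightComodule.ofInjective [RightComodule K D M] (φ : C →ₗc[K] D) (hφ : Function.Injective φ)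
    (j : N →ₗ[K] M) (hj : Function.Injective j) (ρ : N →ₗ[K] N ⊗[K] C)
    (hρ : TensorProduct.map j φ.toLinearMap ∘ₗ ρ = rcoact K D M ∘ₗ j) : RightComodule K C N where
  coact := ρ
  coassoc := by
    have hinj : Function.Injective (TensorProduct.map j
        (TensorProduct.map φ.toLinearMap φ.toLinearMap)) :=
      TensorProduct.map_injective_of_flat_flat _ _ hj
        (TensorProduct.map_injective_of_flat_flat _ _ hφ hφ)
    refine LinearMap.cancel_left hinj |>.1 ?_
    have h1 : TensorProduct.map j (TensorProduct.map φ.toLinearMap φ.toLinearMap) ∘ₗ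
        (TensorProduct.assoc K N C C).toLinearMap =
        (TensorProduct.assoc K M D D).toLinearMap ∘ₗ
          TensorProduct.map (TensorProduct.map j φ.toLinearMap) φ.toLinearMap :=
      TensorProduct.ext_threefold fun _ _ _ => rfl
    calc _ = (TensorProduct.assoc K M D D).toLinearMap ∘ₗ
          (TensorProduct.map (TensorProduct.map j φ.toLinearMap) φ.toLinearMap ∘ₗ
            ρ.rTensor C) ∘ₗ ρ := by
          rw [← LinearMap.comp_assoc, h1]
          simp only [LinearMap.comp_assoc]
      _ = (TensorProduct.assoc K M D D).toLinearMap ∘ₗ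
          (rcoact K D M).rTensor D ∘ₗ TensorProduct.map j φ.toLinearMap ∘ₗ ρ := by
          rw [LinearMap.map_comp_rTensor, hρ, ← LinearMap.rTensor_comp_map, ← hρ]
          simp only [LinearMap.comp_assoc]
      _ = (Coalgebra.comul.lTensor M ∘ₗ TensorProduct.map j φ.toLinearMap) ∘ₗ ρ := by
          rw [hρ, LinearMap.comp_assoc, hρ, ← LinearMap.comp_assoc, ← LinearMap.comp_assoc,
            ← LinearMap.comp_assoc]
          congr 1
          exact RightComodule.coassoc
      _ = _ := by
          rw [LinearMap.lTensor_comp_map]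
          have : Coalgebra.comul ∘ₗ φ.toLinearMap =
              TensorProduct.map φ.toLinearMap φ.toLinearMap ∘ₗ Coalgebra.comul :=
            φ.map_comp_comul.symm
          rw [this, ← LinearMap.map_comp_lTensor, LinearMap.comp_assoc]
  counit_coact := by
    have hinj : Function.Injective (j.rTensor K) :=
      TensorProduct.map_injective_of_flat_flat _ _ hj Function.injective_id
    refine LinearMap.cancel_left hinj |>.1 ?_
    have h : (Coalgebra.counit (R := K) (A := D)) ∘ₗ φ.toLinearMap = Coalgebra.counit :=
      φ.counit_comp
    rw [← LinearMap.comp_assoc, LinearMap.rTensor_comp_lTensor, ← h, ← LinearMap.lTensor_comp_map,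
      LinearMap.comp_assoc, hρ, ← LinearMap.comp_assoc, RightComodule.counit_coact]
    ext
    simp

/-- A left coaction that becomes the coaction of a left `C`-comodule along an injection
`N → M` is a comodule structure. -/
abbrev LeftComodule.ofInjective [LeftComodule K C M]
    (j : N →ₗ[K] M) (hj : Function.Injective j) (ρ : N →ₗ[K] C ⊗[K] N)
    (hρ : j.lTensor C ∘ₗ ρ = lcoact K C M ∘ₗ j) : LeftComodule K C N where
  coact := ρ
  coassoc := by
    have hinj : Function.Injective ((j.lTensor C).lTensor C) :=
      TensorProduct.map_injective_of_flat_flat _ _ Function.injective_id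
        (TensorProduct.map_injective_of_flat_flat _ _ Function.injective_id hj)
    refine LinearMap.cancel_left hinj |>.1 ?_
    have h1 : (j.lTensor C).lTensor C ∘ₗ (TensorProduct.assoc K C C N).toLinearMap =
        (TensorProduct.assoc K C C M).toLinearMap ∘ₗ j.lTensor (C ⊗[K] C) :=
      TensorProduct.ext_threefold fun _ _ _ => rfl
    calc _ = (TensorProduct.assoc K C C M).toLinearMap ∘ₗ Coalgebra.comul.rTensor M ∘ₗ
          j.lTensor C ∘ₗ ρ := by
          rw [← LinearMap.comp_assoc, h1, LinearMap.comp_assoc, ← LinearMap.comp_assoc ρ,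
            LinearMap.lTensor_comp_rTensor, ← LinearMap.rTensor_comp_lTensor]
          simp only [LinearMap.comp_assoc]
      _ = (lcoact K C M).lTensor C ∘ₗ j.lTensor C ∘ₗ ρ := by
          rw [hρ, ← LinearMap.comp_assoc, ← LinearMap.comp_assoc, ← LinearMap.comp_assoc]
          congr 1
          exact LeftComodule.coassoc
      _ = _ := by
          rw [← LinearMap.comp_assoc, ← LinearMap.lTensor_comp, ← hρ, LinearMap.lTensor_comp,
            LinearMap.comp_assoc]
  counit_coact := by
    have hinj : Function.Injective (j.lTensor K) :=
      TensorProduct.map_injective_of_flat_flat _ _ Function.injective_id hj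
    refine LinearMap.cancel_left hinj |>.1 ?_
    rw [← LinearMap.comp_assoc, LinearMap.lTensor_comp_rTensor, ← LinearMap.rTensor_comp_lTensor,
      LinearMap.comp_assoc, hρ, ← LinearMap.comp_assoc, LeftComodule.counit_coact]
    ext
    simp

/-- A linear map taking values in the range of an injective one factors through it. -/
theorem exists_comp_eq_of_forall_mem_range {V W U : Type*} [AddCommGroup V] [Module K V]
    [AddCommGroup W] [Module K W] [AddCommGroup U] [Module K U] {i : V →ₗ[K] W}
    (hi : Function.Injective i) {f : U →ₗ[K] W} (hf : ∀ x, f x ∈ LinearMap.range i) :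
    ∃ g : U →ₗ[K] V, i ∘ₗ g = f := by
  refine ⟨(LinearEquiv.ofInjective i hi).symm.toLinearMap ∘ₗ f.codRestrict _ hf, ?_⟩
  ext x
  have := (LinearEquiv.ofInjective i hi).apply_symm_apply ⟨f x, hf x⟩
  exact congrArg Subtype.val this

theorem exists_lcoact_of_isLeftSubcomodule [LeftComodule K C M] {P : Submodule K M}
    (hP : IsLeftSubcomodule K C P) :
    ∃ ρ : P →ₗ[K] C ⊗[K] P, P.subtype.lTensor C ∘ₗ ρ = lcoact K C M ∘ₗ P.subtype :=
  exists_comp_eq_of_forall_mem_range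
    (TensorProduct.map_injective_of_flat_flat _ _ Function.injective_id P.injective_subtype)
    fun x => hP x x.2

/-- The comodule structure of a left subcomodule. -/
abbrev IsLeftSubcomodule.leftComodule [LeftComodule K C M] {P : Submodule K M}
    (hP : IsLeftSubcomodule K C P) : LeftComodule K C P :=
  .ofInjective P.subtype P.injective_subtype (exists_lcoact_of_isLeftSubcomodule hP).choose
    (exists_lcoact_of_isLeftSubcomodule hP).choose_spec

theorem IsLeftSubcomodule.isLeftComoduleHom_subtype [LeftComodule K C M] {P : Submodule K M}
    (hP : IsLeftSubcomodule K C P) :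
    letI := hP.leftComodule
    IsLeftComoduleHom K C P.subtype :=
  (exists_lcoact_of_isLeftSubcomodule hP).choose_spec

/-- The direct sum of a family of left comodules. -/
instance instLeftComoduleDFinsupp {ι : Type*} [DecidableEq ι] {M : ι → Type*}
    [∀ i, AddCommGroup (M i)] [∀ i, Module K (M i)] [∀ i, LeftComodule K C (M i)] :
    LeftComodule K C (Π₀ i, M i) where
  coact := DFinsupp.lsum ℕ fun i =>
    (DFinsupp.lsingle (R := K) (M := M) i).lTensor C ∘ₗ lcoact K C (M i)
  coassoc := by
    refine DFinsupp.lhom_ext' fun i => ?_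
    set T : (Π₀ i, M i) →ₗ[K] C ⊗[K] (Π₀ i, M i) := DFinsupp.lsum ℕ fun i =>
      (DFinsupp.lsingle (R := K) (M := M) i).lTensor C ∘ₗ lcoact K C (M i)
    have hT : T ∘ₗ DFinsupp.lsingle i =
        (DFinsupp.lsingle i).lTensor C ∘ₗ lcoact K C (M i) := by
      ext m; simp [T]
    have h1 : (TensorProduct.assoc K C C (Π₀ i, M i)).toLinearMap ∘ₗ
        (DFinsupp.lsingle (R := K) (M := M) i).lTensor (C ⊗[K] C) =
        ((DFinsupp.lsingle (R := K) (M := M) i).lTensor C).lTensor C ∘ₗ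
          (TensorProduct.assoc K C C (M i)).toLinearMap :=
      TensorProduct.ext_threefold fun _ _ _ => rfl
    calc _ = (TensorProduct.assoc K C C (Π₀ i, M i)).toLinearMap ∘ₗ
            (Coalgebra.comul.rTensor _ ∘ₗ (DFinsupp.lsingle i).lTensor C) ∘ₗ lcoact K C (M i) := by
          simp only [LinearMap.comp_assoc, hT]
      _ = ((DFinsupp.lsingle (R := K) (M := M) i).lTensor C).lTensor C ∘ₗ
            (lcoact K C (M i)).lTensor C ∘ₗ lcoact K C (M i) := by
          rw [LinearMap.rTensor_comp_lTensor, ← LinearMap.lTensor_comp_rTensor,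
            ← LeftComodule.coassoc, ← LinearMap.comp_assoc, ← LinearMap.comp_assoc, h1]
          simp only [LinearMap.comp_assoc]
      _ = _ := by
          rw [LinearMap.comp_assoc, hT, ← LinearMap.comp_assoc, ← LinearMap.comp_assoc,
            ← LinearMap.lTensor_comp, ← LinearMap.lTensor_comp, hT]
  counit_coact := by
    refine DFinsupp.lhom_ext' fun i => ?_
    set T : (Π₀ i, M i) →ₗ[K] C ⊗[K] (Π₀ i, M i) := DFinsupp.lsum ℕ fun i =>
      (DFinsupp.lsingle (R := K) (M := M) i).lTensor C ∘ₗ lcoact K C (M i)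
    have hT : T ∘ₗ DFinsupp.lsingle i =
        (DFinsupp.lsingle i).lTensor C ∘ₗ lcoact K C (M i) := by
      ext m; simp [T]
    rw [LinearMap.comp_assoc, hT, ← LinearMap.comp_assoc, LinearMap.rTensor_comp_lTensor,
      ← LinearMap.lTensor_comp_rTensor, LinearMap.comp_assoc, LeftComodule.counit_coact]
    ext m : 1
    simp

theorem lcoact_comp_lsingle {ι : Type*} [DecidableEq ι] {M : ι → Type*}
    [∀ i, AddCommGroup (M i)] [∀ i, Module K (M i)] [∀ i, LeftComodule K C (M i)] (i : ι) :
    lcoact K C (Π₀ i, M i) ∘ₗ DFinsupp.lsingle i =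
      (DFinsupp.lsingle i).lTensor C ∘ₗ lcoact K C (M i) := by
  refine LinearMap.ext fun m => ?_
  exact DFinsupp.lsum_single (S := ℕ) (fun i =>
    (DFinsupp.lsingle (R := K) (M := M) i).lTensor C ∘ₗ lcoact K C (M i)) i m

end Restrict

/-! ### Contractions as functions of the functional -/

section ContractHom

variable {K : Type*} [Field K] {V W : Type*} [AddCommGroup V] [Module K V]
  [AddCommGroup W] [Module K W]

/-- The map `f ↦ contractL f x`. -/
def contractLHom (x : V ⊗[K] W) : (V →ₗ[K] K) →ₗ[K] W where
  toFun f := contractL f x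
  map_add' f g := by simp [contractL, LinearMap.rTensor_add]
  map_smul' a f := by simp [contractL, LinearMap.rTensor_smul]

/-- The map `f ↦ contractR f x`. -/
def contractRHom (x : V ⊗[K] W) : (W →ₗ[K] K) →ₗ[K] V where
  toFun f := contractR f x
  map_add' f g := by simp [contractR, LinearMap.lTensor_add]
  map_smul' a f := by simp [contractR, LinearMap.lTensor_smul]

/-- Tensors have finite rank. Applied to the coaction of an element, this is the local finiteness of
comodules. -/
theorem finiteDimensional_range_contractRHom (x : V ⊗[K] W) :
    FiniteDimensional K (LinearMap.range (contractRHom x)) := by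
  induction x using TensorProduct.induction_on with
  | zero =>
    have : LinearMap.range (contractRHom (0 : V ⊗[K] W)) ≤ ⊥ := by
      rintro _ ⟨f, rfl⟩
      simp [contractRHom]
    exact Submodule.finiteDimensional_of_le this
  | tmul v w =>
    have : LinearMap.range (contractRHom (v ⊗ₜ[K] w)) ≤ Submodule.span K {v} := by
      rintro _ ⟨f, rfl⟩
      simpa [contractRHom] using
        Submodule.smul_mem _ _ (Submodule.mem_span_singleton_self (R := K) v)
    exact Submodule.finiteDimensional_of_le this
  | add x y hx hy =>
    have : LinearMap.range (contractRHom (x + y)) ≤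
        LinearMap.range (contractRHom x) ⊔ LinearMap.range (contractRHom y) := by
      rintro _ ⟨f, rfl⟩
      exact Submodule.mem_sup.2 ⟨_, ⟨f, rfl⟩, _, ⟨f, rfl⟩,
        (map_add (contractR f) x y).symm⟩
    exact Submodule.finiteDimensional_of_le this

theorem finiteDimensional_range_contractLHom (x : V ⊗[K] W) :
    FiniteDimensional K (LinearMap.range (contractLHom x)) := by
  have : contractLHom x = contractRHom (TensorProduct.comm K V W x) :=
    LinearMap.ext fun f => (contractR_comm f x).symm
  rw [this]
  exact finiteDimensional_range_contractRHom _

end ContractHom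

/-! ### Left comodules and functionals -/

section LeftHom

variable {K : Type*} [Field K] {C : Type*} [AddCommGroup C] [Module K C] [Coalgebra K C]
  {M N L : Type*} [AddCommGroup M] [Module K M] [LeftComodule K C M]
  [AddCommGroup N] [Module K N] [LeftComodule K C N]
  [AddCommGroup L] [Module K L] [LeftComodule K C L]

/-- Contractions separate tensors, so comodule maps are the same as C*-linear maps. -/
theorem isLeftComoduleHom_iff {f : M →ₗ[K] N} : IsLeftComoduleHom K C f ↔
    ∀ (m : M) (g : C →ₗ[K] K), f (contractL g (lcoact K C M m)) =
      contractL g (lcoact K C N (f m)) := by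
  constructor
  · intro hf m g
    rw [← contractL_lTensor]
    exact congrArg _ (LinearMap.congr_fun hf m)
  · intro h
    refine LinearMap.ext fun m => sub_eq_zero.1 (eq_zero_of_contractL fun g => ?_)
    rw [map_sub, LinearMap.comp_apply, LinearMap.comp_apply, contractL_lTensor, h, sub_self]

theorem IsLeftComoduleHom.comp {f : N →ₗ[K] L} {g : M →ₗ[K] N} (hf : IsLeftComoduleHom K C f)
    (hg : IsLeftComoduleHom K C g) : IsLeftComoduleHom K C (f ∘ₗ g) := by
  rw [isLeftComoduleHom_iff] at *
  intro m h
  simp only [LinearMap.comp_apply, hg, hf]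

theorem IsLeftSubcomodule.comap {f : M →ₗ[K] N} (hf : IsLeftComoduleHom K C f)
    {P : Submodule K N} (hP : IsLeftSubcomodule K C P) :
    IsLeftSubcomodule K C (P.comap f) := by
  rw [isLeftSubcomodule_iff] at *
  intro m hm g
  rw [Submodule.mem_comap, isLeftComoduleHom_iff.1 hf]
  exact hP _ hm g

theorem IsLeftSubcomodule.map {f : M →ₗ[K] N} (hf : IsLeftComoduleHom K C f)
    {P : Submodule K M} (hP : IsLeftSubcomodule K C P) :
    IsLeftSubcomodule K C (P.map f) := by
  rw [isLeftSubcomodule_iff] at *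
  rintro _ ⟨m, hm, rfl⟩ g
  rw [← isLeftComoduleHom_iff.1 hf]
  exact ⟨_, hP m hm g, rfl⟩

theorem IsLeftSubcomodule.inf {P Q : Submodule K M} (hP : IsLeftSubcomodule K C P)
    (hQ : IsLeftSubcomodule K C Q) : IsLeftSubcomodule K C (P ⊓ Q) := by
  rw [isLeftSubcomodule_iff] at *
  exact fun m hm g => ⟨hP m hm.1 g, hQ m hm.2 g⟩

variable (K C) in
theorem isLeftSubcomodule_bot : IsLeftSubcomodule K C (⊥ : Submodule K M) := by
  rw [isLeftSubcomodule_iff]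
  rintro _ rfl g
  simp

variable (K C) in
theorem isLeftSubcomodule_top : IsLeftSubcomodule K C (⊤ : Submodule K M) := by
  rw [isLeftSubcomodule_iff]
  exact fun _ _ _ => trivial

theorem IsLeftComoduleHom.isLeftSubcomodule_ker {f : M →ₗ[K] N} (hf : IsLeftComoduleHom K C f) :
    IsLeftSubcomodule K C (LinearMap.ker f) :=
  (isLeftSubcomodule_bot K C).comap hf

theorem IsLeftComoduleHom.isLeftSubcomodule_range {f : M →ₗ[K] N}
    (hf : IsLeftComoduleHom K C f) : IsLeftSubcomodule K C (LinearMap.range f) := by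
  rw [LinearMap.range_eq_map]
  exact (isLeftSubcomodule_top K C).map hf

variable (K C) in
theorem isLeftSubcomodule_sSup_of_isChain {c : Set (Submodule K M)} (hc : IsChain (· ≤ ·) c)
    (hne : c.Nonempty) (h : ∀ P ∈ c, IsLeftSubcomodule K C P) :
    IsLeftSubcomodule K C (sSup c) := by
  rw [isLeftSubcomodule_iff]
  intro m hm g
  obtain ⟨P, hP, hmP⟩ := (Submodule.mem_sSup_of_directed hne hc.directedOn).1 hm
  exact le_sSup hP ((isLeftSubcomodule_iff K C).1 (h P hP) m hmP g)

variable (K C) in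
/-- The left subcomodule generated by an element. -/
def leftGen (m : M) : Submodule K M := LinearMap.range (contractLHom (lcoact K C M m))

theorem mem_leftGen_self (m : M) : m ∈ leftGen K C m :=
  ⟨Coalgebra.counit, contractL_counit_lcoact m⟩

theorem isLeftSubcomodule_leftGen (m : M) : IsLeftSubcomodule K C (leftGen K C m) := by
  rw [isLeftSubcomodule_iff]
  rintro _ ⟨f, rfl⟩ g
  exact ⟨conv f g, (contractL_lcoact_contractL g f m).symm⟩

theorem leftGen_le {m : M} {P : Submodule K M} (hP : IsLeftSubcomodule K C P) (hm : m ∈ P) :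
    leftGen K C m ≤ P := by
  rintro _ ⟨f, rfl⟩
  exact (isLeftSubcomodule_iff K C).1 hP m hm f

instance (m : M) : FiniteDimensional K (leftGen K C m) :=
  finiteDimensional_range_contractLHom _

/-- The map `m ↦ m₋₁ l(m₀)` from a left comodule to the coalgebra. -/
def coeffMap (l : M →ₗ[K] K) : M →ₗ[K] C := contractR l ∘ₗ lcoact K C M

/-- With `coeffMap_counit_comp` this shows that C is cofree: functionals on M correspond bijectively
to comodule maps from M to C. All comodule maps into C below are built by choosing a functional. -/
theorem counit_coeffMap (l : M →ₗ[K] K) (m : M) :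
    Coalgebra.counit (R := K) (coeffMap (C := C) l m) = l m := by
  conv_rhs => rw [← contractL_counit_lcoact (K := K) (C := C) m]
  rw [← mul_map_eq_contractL, mul_map_eq_contractR]
  rfl

theorem isLeftComoduleHom_coeffMap (l : M →ₗ[K] K) :
    IsLeftComoduleHom K C (coeffMap (C := C) l) := by
  rw [isLeftComoduleHom_iff]
  intro m g
  have h1 : ∀ x : C ⊗[K] M, contractL g (Coalgebra.comul (R := K) (contractR l x)) =
      contractR l (contractL g
        (TensorProduct.assoc K C C M ((Coalgebra.comul (R := K)).rTensor M x))) := by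
    have key : ∀ (y : C ⊗[K] C) (m : M), l m • contractL g y =
        contractR l (contractL g (TensorProduct.assoc K C C M (y ⊗ₜ m))) := by
      intro y m
      induction y using TensorProduct.induction_on with
      | zero => simp
      | tmul c d => simp [smul_comm (l m)]
      | add x y hx hy => simp only [map_add, smul_add, TensorProduct.add_tmul, hx, hy]
    intro x
    induction x using TensorProduct.induction_on with
    | zero => simp
    | tmul c m => rw [contractR_tmul, map_smul, map_smul, LinearMap.rTensor_tmul, key]
    | add x y hx hy => simp only [map_add, hx, hy]
  have h := LinearMap.congr_fun (LeftComodule.coassoc (K := K) (C := C) (M := M)) m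
  simp only [LinearMap.comp_apply, LinearEquiv.coe_coe] at h
  change contractR l (lcoact K C M (contractL g (lcoact K C M m))) =
    contractL g (Coalgebra.comul (contractR l (lcoact K C M m)))
  rw [h1, h, contractL_lTensor]

theorem coeffMap_comp {f : M →ₗ[K] N} (hf : IsLeftComoduleHom K C f) (l : N →ₗ[K] K) :
    coeffMap l ∘ₗ f = coeffMap (C := C) (l ∘ₗ f) := by
  refine LinearMap.ext fun m => ?_
  change contractR l (lcoact K C N (f m)) = contractR (l ∘ₗ f) (lcoact K C M m)
  rw [← contractR_lTensor]
  exact congrArg _ (LinearMap.congr_fun hf m).symm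

theorem coeffMap_counit_comp {f : M →ₗ[K] C} (hf : IsLeftComoduleHom K C f) :
    coeffMap (Coalgebra.counit ∘ₗ f) = f := by
  rw [← coeffMap_comp hf]
  exact LinearMap.ext fun m => contractR_counit_comul (f m)

theorem isLeftComoduleHom_dfinsupp {ι : Type*} [DecidableEq ι] {M : ι → Type*}
    [∀ i, AddCommGroup (M i)] [∀ i, Module K (M i)] [∀ i, LeftComodule K C (M i)]
    {f : (Π₀ i, M i) →ₗ[K] N} (hf : ∀ i, IsLeftComoduleHom K C (f ∘ₗ DFinsupp.lsingle i)) :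
    IsLeftComoduleHom K C f := by
  refine DFinsupp.lhom_ext' fun i => ?_
  rw [LinearMap.comp_assoc, lcoact_comp_lsingle, ← LinearMap.comp_assoc, ← LinearMap.lTensor_comp]
  exact hf i

end LeftHom

/-! ### Large monolithic left coideals -/

section Monolithic

/-- Every nonzero left subcomodule of `C` contained in `E` contains `s`. -/
def IsMonolithic (K : Type*) [Field K] {C : Type*} [AddCommGroup C] [Module K C] [Coalgebra K C]
    (s : C) (E : Submodule K C) : Prop :=
  ∀ P ≤ E, IsLeftSubcomodule K C P → P ≠ ⊥ → s ∈ P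

/-- `C` has an infinite dimensional left coideal with a simple essential socle. -/
def HasLargeMonolithic (K : Type*) [Field K] (C : Type*) [AddCommGroup C] [Module K C]
    [Coalgebra K C] : Prop :=
  ∃ (s : C) (E : Submodule K C), IsLeftSubcomodule K C E ∧ ¬ FiniteDimensional K E ∧ s ∈ E ∧
    s ≠ 0 ∧ IsMonolithic K s E

variable {K : Type u} [Field K] {C D : Type u} [AddCommGroup C] [Module K C] [Coalgebra K C]
  [AddCommGroup D] [Module K D] [Coalgebra K D]

/-- A morphism which does not kill `s` is injective on a coideal with socle generated by `s`. -/
theorem IsMonolithic.injOn {s : C} {E : Submodule K C} (hE : IsLeftSubcomodule K C E)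
    (h : IsMonolithic K s E) {N : Type*} [AddCommGroup N] [Module K N] [LeftComodule K C N]
    {f : C →ₗ[K] N} (hf : IsLeftComoduleHom K C f) (hs : f s ≠ 0) :
    Function.Injective (f ∘ₗ E.subtype) := by
  rw [← LinearMap.ker_eq_bot, LinearMap.ker_eq_bot']
  intro x hx
  by_contra hne
  have := h (E ⊓ LinearMap.ker f) inf_le_left (hE.inf hf.isLeftSubcomodule_ker) (by
    intro hbot
    have : (x : C) ∈ E ⊓ LinearMap.ker f := ⟨x.2, hx⟩
    rw [hbot] at this
    exact hne (Subtype.ext this))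
  exact hs this.2

/-- An infinite dimensional envelope of a simple comodule is embedded in C by one functional that
does not vanish on the socle; its image is the required coideal. -/
theorem hasLargeMonolithic_of_not_isRightSemiperfect (h : ¬ IsRightSemiperfect K C) :
    HasLargeMonolithic K C := by
  simp only [IsRightSemiperfect, not_forall] at h
  obtain ⟨S, E, _, _, _, _, _, _, i, ⟨hnt, hS⟩, ⟨hi, hinj, -, hess⟩, hfin⟩ := h
  obtain ⟨t, ht⟩ := exists_ne (0 : S)
  have ht' : i t ≠ 0 := by rwa [Ne, map_eq_zero_iff i hinj]
  have hmem : ∀ P : Submodule K E, IsLeftSubcomodule K C P → P ≠ ⊥ → i t ∈ P := by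
    intro P hP hne
    rcases hS _ (hP.comap hi) with h0 | h1
    · refine absurd ?_ (hess P hP hne)
      rw [eq_bot_iff]
      rintro _ ⟨hx, y, rfl⟩
      have : y ∈ P.comap i := hx
      rw [h0, Submodule.mem_bot] at this
      simp [this]
    · have : t ∈ P.comap i := by rw [h1]; trivial
      exact this
  obtain ⟨l, hl⟩ : ∃ l : E →ₗ[K] K, l (i t) ≠ 0 := by
    by_contra! hcon
    exact ht' ((Module.forall_dual_apply_eq_zero_iff K (i t)).1 hcon)
  have hh := isLeftComoduleHom_coeffMap (C := C) l
  have hst : coeffMap (C := C) l (i t) ≠ 0 := by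
    intro h0
    apply hl
    rw [← counit_coeffMap (C := C), h0, map_zero]
  -- The kernel is a subcomodule; were it nonzero it would contain `i t`.
  have hker : LinearMap.ker (coeffMap (C := C) l) = ⊥ := by
    by_contra hne
    exact hst (hmem _ hh.isLeftSubcomodule_ker hne)
  refine ⟨coeffMap l (i t), LinearMap.range (coeffMap l), hh.isLeftSubcomodule_range, ?_, ⟨_, rfl⟩,
    hst, ?_⟩
  · intro hfd
    exact hfin (LinearEquiv.finiteDimensional
      (LinearEquiv.ofInjective _ (LinearMap.ker_eq_bot.1 hker)).symm)
  · intro P hPle hP hne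
    refine hmem _ (hP.comap hh) fun hbot => hne ?_
    rw [eq_bot_iff]
    intro x hx
    obtain ⟨y, rfl⟩ := hPle hx
    have : y ∈ P.comap (coeffMap l) := hx
    rw [hbot, Submodule.mem_bot] at this
    simp [this]

theorem contractL_comul_coalgHom (φ : C →ₗc[K] D) (f : D →ₗ[K] K) (c : C) :
    contractL f (Coalgebra.comul (R := K) (φ c)) =
      φ (contractL (f ∘ₗ φ.toLinearMap) (Coalgebra.comul (R := K) c)) := by
  have : Coalgebra.comul (R := K) (φ c) = TensorProduct.map φ.toLinearMap φ.toLinearMap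
      (Coalgebra.comul (R := K) c) := (LinearMap.congr_fun φ.map_comp_comul c).symm
  rw [this, contractL_map]
  rfl

theorem contractR_comul_coalgHom (φ : C →ₗc[K] D) (f : D →ₗ[K] K) (c : C) :
    contractR f (Coalgebra.comul (R := K) (φ c)) =
      φ (contractR (f ∘ₗ φ.toLinearMap) (Coalgebra.comul (R := K) c)) := by
  have : Coalgebra.comul (R := K) (φ c) = TensorProduct.map φ.toLinearMap φ.toLinearMap
      (Coalgebra.comul (R := K) c) := (LinearMap.congr_fun φ.map_comp_comul c).symm
  rw [this, contractR_map]
  rfl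

theorem exists_comp_eq_of_injective {V W : Type*} [AddCommGroup V] [Module K V] [AddCommGroup W]
    [Module K W] {i : V →ₗ[K] W} (hi : Function.Injective i) (f : V →ₗ[K] K) :
    ∃ g : W →ₗ[K] K, g ∘ₗ i = f := by
  obtain ⟨r, hr⟩ := i.exists_leftInverse_of_injective (LinearMap.ker_eq_bot.2 hi)
  exact ⟨f ∘ₗ r, by rw [LinearMap.comp_assoc, hr, LinearMap.comp_id]⟩

/-- Functionals can be prescribed on one of two disjoint subspaces while vanishing on the other. -/
theorem exists_functional_of_inf_eq_bot {V : Type*} [AddCommGroup V] [Module K V]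
    {P Q : Submodule K V} (h : P ⊓ Q = ⊥) (f : V →ₗ[K] K) :
    ∃ l : V →ₗ[K] K, (∀ v ∈ P, l v = f v) ∧ ∀ v ∈ Q, l v = 0 := by
  have hinj : Function.Injective (Q.mkQ ∘ₗ P.subtype) := by
    rw [← LinearMap.ker_eq_bot, LinearMap.ker_eq_bot']
    intro x hx
    have : (x : V) ∈ P ⊓ Q := ⟨x.2, (Submodule.Quotient.mk_eq_zero Q).1 hx⟩
    rw [h] at this
    exact Subtype.ext this
  obtain ⟨g, hg⟩ := exists_comp_eq_of_injective hinj (f ∘ₗ P.subtype)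
  refine ⟨g ∘ₗ Q.mkQ, fun v hv => LinearMap.congr_fun hg ⟨v, hv⟩, fun v hv => ?_⟩
  rw [LinearMap.comp_apply, Submodule.mkQ_apply, (Submodule.Quotient.mk_eq_zero Q).2 hv, map_zero]

/-- Functionals on C extend along φ, so a D-subcomodule of φ(E) is the image of a C-subcomodule of
E, and nothing changes when E is moved into D. -/
theorem HasLargeMonolithic.of_injective (h : HasLargeMonolithic K C) (φ : C →ₗc[K] D)
    (hφ : Function.Injective φ) : HasLargeMonolithic K D := by
  obtain ⟨s, E, hE, hfin, hsE, hs, hmon⟩ := h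
  have hlc : ∀ c, lcoact K C C c = Coalgebra.comul c := fun _ => rfl
  have hld : ∀ d, lcoact K D D d = Coalgebra.comul d := fun _ => rfl
  refine ⟨φ s, E.map φ.toLinearMap, ?_, ?_, ⟨s, hsE, rfl⟩,
    fun h0 => hs (hφ (h0.trans (map_zero φ).symm)), ?_⟩
  · rw [isLeftSubcomodule_iff] at hE ⊢
    rintro _ ⟨c, hc, rfl⟩ f
    exact ⟨_, hE c hc _, (contractL_comul_coalgHom φ f c).symm⟩
  · intro hfd
    exact hfin (LinearEquiv.finiteDimensional
      (Submodule.equivMapOfInjective φ.toLinearMap hφ E).symm)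
  · intro P hPle hP hne
    have hcomap : P.comap φ.toLinearMap ≤ E := by
      intro c hc
      obtain ⟨e, he, hec⟩ := hPle hc
      exact hφ hec ▸ he
    refine hmon (P.comap φ.toLinearMap) hcomap ?_ fun hbot => hne ?_
    · rw [isLeftSubcomodule_iff] at hP ⊢
      intro c hc f
      obtain ⟨g, rfl⟩ := exists_comp_eq_of_injective (i := φ.toLinearMap) hφ f
      change φ _ ∈ P
      rw [hlc, ← contractL_comul_coalgHom, ← hld]
      exact hP _ hc g
    · rw [eq_bot_iff]
      intro x hx
      obtain ⟨e, he, rfl⟩ := hPle hx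
      have : e ∈ P.comap φ.toLinearMap := hx
      rw [hbot, Submodule.mem_bot] at this
      simp [this]

/-- A coideal which is a retract of `C` is an injective comodule. -/
theorem isInjectiveLeftComodule_of_retract {E : Submodule K C} (hE : IsLeftSubcomodule K C E)
    {p : C →ₗ[K] C} (hp : IsLeftComoduleHom K C p) (hpE : ∀ c, p c ∈ E)
    (hpid : ∀ c ∈ E, p c = c) :
    letI := hE.leftComodule
    IsInjectiveLeftComodule K C E := by
  let _ := hE.leftComodule
  intro X Y _ _ _ _ _ _ i f hi hinj hf
  have hf' := hE.isLeftComoduleHom_subtype.comp hf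
  -- By cofreeness it suffices to extend the functional ε ∘ f linearly to Y. The resulting comodule
  -- map lands in C, and p brings it back into E.
  obtain ⟨l, hl⟩ := exists_comp_eq_of_injective hinj (Coalgebra.counit ∘ₗ E.subtype ∘ₗ f)
  have hG := coeffMap_comp hi l
  rw [hl, coeffMap_counit_comp hf'] at hG
  refine ⟨(p ∘ₗ coeffMap l).codRestrict E fun y => hpE _, ?_, ?_⟩
  · rw [isLeftComoduleHom_iff]
    intro y g
    apply E.injective_subtype
    rw [isLeftComoduleHom_iff.1 hE.isLeftComoduleHom_subtype]
    exact isLeftComoduleHom_iff.1 (hp.comp (isLeftComoduleHom_coeffMap l)) y g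
  · ext x
    have := LinearMap.congr_fun hG x
    simp only [LinearMap.comp_apply, Submodule.subtype_apply] at this
    simp only [LinearMap.comp_apply, LinearMap.codRestrict_apply, this]
    exact hpid _ (f x).2

/-- The injective hull, inside `C`, of a monolithic left coideal. -/
theorem IsMonolithic.exists_retract {s : C} {E : Submodule K C} (hE : IsLeftSubcomodule K C E)
    (hs : s ≠ 0) (hsE : s ∈ E) (h : IsMonolithic K s E) :
    ∃ (E' : Submodule K C) (p : C →ₗ[K] C), E ≤ E' ∧ IsLeftSubcomodule K C E' ∧
      IsMonolithic K s E' ∧ IsLeftComoduleHom K C p ∧ (∀ c, p c ∈ E') ∧ ∀ c ∈ E', p c = c := by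
  -- E' is a maximal coideal above E in which s still lies in every nonzero subcomodule.
  obtain ⟨E', hEE', ⟨hE', hmon⟩, hmax⟩ := zorn_le_nonempty₀
    {F : Submodule K C | IsLeftSubcomodule K C F ∧ IsMonolithic K s F}
    (fun c hc hch F hF => ⟨sSup c, ⟨isLeftSubcomodule_sSup_of_isChain K C hch ⟨F, hF⟩
      fun P hP => (hc hP).1, fun P hPle hP hne => by
        obtain ⟨x, hx, hx0⟩ := (Submodule.ne_bot_iff P).1 hne
        obtain ⟨Q, hQ, hxQ⟩ := (Submodule.mem_sSup_of_directed ⟨F, hF⟩ hch.directedOn).1 (hPle hx)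
        exact ((hc hQ).2 (P ⊓ Q) inf_le_right (hP.inf (hc hQ).1)
          ((Submodule.ne_bot_iff _).2 ⟨x, ⟨hx, hxQ⟩, hx0⟩)).1⟩, fun _ => le_sSup⟩) E ⟨hE, h⟩
  -- P is a maximal coideal avoiding s. It will be the complement of E'.
  obtain ⟨P, -, ⟨hP, hsP⟩, hPmax⟩ := zorn_le_nonempty₀
    {F : Submodule K C | IsLeftSubcomodule K C F ∧ s ∉ F}
    (fun c hc hch F hF => ⟨sSup c, ⟨isLeftSubcomodule_sSup_of_isChain K C hch ⟨F, hF⟩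
      fun P hP => (hc hP).1, fun hsc => by
        obtain ⟨Q, hQ, hsQ⟩ := (Submodule.mem_sSup_of_directed ⟨F, hF⟩ hch.directedOn).1 hsc
        exact (hc hQ).2 hsQ⟩, fun _ => le_sSup⟩) ⊥ ⟨isLeftSubcomodule_bot K C, by simpa using hs⟩
  have hdisj : E' ⊓ P = ⊥ := by
    by_contra hne
    exact hsP (hmon _ inf_le_left (hE'.inf hP) hne).2
  obtain ⟨l, hlE, hlP⟩ : ∃ l : C →ₗ[K] K, (∀ c ∈ E', l c = Coalgebra.counit c) ∧
      ∀ c ∈ P, l c = 0 := by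
    exact exists_functional_of_inf_eq_bot hdisj Coalgebra.counit
  -- Since l is ε on E' and 0 on P, the map p is the identity on E' and 0 on P.
  set p : C →ₗ[K] C := coeffMap l with hp
  have hph : IsLeftComoduleHom K C p := isLeftComoduleHom_coeffMap l
  have hpE : ∀ c ∈ E', p c = c := by
    intro c hc
    obtain ⟨x, hx⟩ := hE' c hc
    change contractR l (lcoact K C C c) = c
    rw [← hx, contractR_lTensor]
    have : l ∘ₗ E'.subtype = Coalgebra.counit ∘ₗ E'.subtype := LinearMap.ext fun y => hlE y y.2
    rw [this, ← contractR_lTensor, hx]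
    exact contractR_counit_comul c
  have hpP : ∀ c ∈ P, p c = 0 := by
    intro c hc
    obtain ⟨x, hx⟩ := hP c hc
    change contractR l (lcoact K C C c) = 0
    rw [← hx, contractR_lTensor]
    have : l ∘ₗ P.subtype = 0 := LinearMap.ext fun y => hlP y y.2
    simp [this, contractR]
  have hker : LinearMap.ker p ≤ P := hPmax ⟨hph.isLeftSubcomodule_ker, fun h0 => hs (by
    rw [← hpE s (hEE' hsE)]; exact h0)⟩ fun c hc => hpP c hc
  -- The image of p is again monolithic over s: if Q in it avoids s, then the preimage of Q contains
  -- P and avoids s, hence equals P, and Q = 0. Maximality of E' does the rest.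
  have hrange : LinearMap.range p ≤ E' := by
    refine hmax ⟨hph.isLeftSubcomodule_range, ?_⟩ fun c hc => ⟨c, hpE c hc⟩
    intro Q hQle hQ hne
    by_contra hsQ
    obtain ⟨x, hx, hx0⟩ := (Submodule.ne_bot_iff Q).1 hne
    obtain ⟨y, rfl⟩ := hQle hx
    have hle : Q.comap p ≤ P := by
      refine hPmax ⟨hQ.comap hph, fun h0 => hsQ ?_⟩ fun c hc => ?_
      · rw [← hpE s (hEE' hsE)]
        exact h0
      · rw [Submodule.mem_comap, hpP c hc]
        exact Q.zero_mem
    exact hx0 (hpP y (hle hx))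
  exact ⟨E', p, hEE', hE', hmon, hph, fun c => hrange ⟨c, rfl⟩, hpE⟩

/-- The subcomodule generated by s is simple, and the hull E' of E inside C is its injective
envelope: injective as a retract of C, essential by monolithicity. It contains E, so it is infinite
dimensional. -/
theorem HasLargeMonolithic.not_isRightSemiperfect (h : HasLargeMonolithic K C) :
    ¬ IsRightSemiperfect K C := by
  obtain ⟨s, E₀, hE₀, hfin, hsE₀, hs, hmon₀⟩ := h
  obtain ⟨E, p, hle, hE, hmon, hp, hpE, hpid⟩ := hmon₀.exists_retract hE₀ hs hsE₀
  have hS := isLeftSubcomodule_leftGen (K := K) (C := C) s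
  have hSE : leftGen K C s ≤ E := leftGen_le hE (hle hsE₀)
  intro hsp
  let _ := hE.leftComodule
  let _ := hS.leftComodule
  refine hfin (@Submodule.finiteDimensional_of_le _ _ _ _ _ _ _
    (hsp (leftGen K C s) E (Submodule.inclusion hSE) ⟨?_, ?_⟩ ⟨?_, ?_, ?_, ?_⟩) hle)
  · exact ⟨⟨⟨s, mem_leftGen_self s⟩, 0, fun h0 => hs (congrArg Subtype.val h0)⟩⟩
  · intro P hP
    by_cases hne : P = ⊥
    · exact Or.inl hne
    · right
      have hP' := hP.map hS.isLeftComoduleHom_subtype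
      have hsP := hmon _ ((Submodule.map_subtype_le _ P).trans hSE) hP' fun h0 =>
        hne (Submodule.map_injective_of_injective (Submodule.injective_subtype _)
          (h0.trans (Submodule.map_bot _).symm))
      have := leftGen_le hP' hsP
      rw [eq_top_iff]
      intro x _
      obtain ⟨y, hy, hyx⟩ := this x.2
      exact Subtype.ext hyx ▸ hy
  · rw [isLeftComoduleHom_iff]
    intro m g
    apply E.injective_subtype
    rw [isLeftComoduleHom_iff.1 hE.isLeftComoduleHom_subtype]
    exact isLeftComoduleHom_iff.1 hS.isLeftComoduleHom_subtype m g
  · exact Submodule.inclusion_injective hSE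
  · exact isInjectiveLeftComodule_of_retract hE hp hpE hpid
  · intro P hP hne
    have hsP := hmon _ (Submodule.map_subtype_le _ P) (hP.map hE.isLeftComoduleHom_subtype) fun h0 =>
      hne (Submodule.map_injective_of_injective (Submodule.injective_subtype _)
        (h0.trans (Submodule.map_bot _).symm))
    obtain ⟨y, hy, hys⟩ := hsP
    refine (Submodule.ne_bot_iff _).2 ⟨y, ⟨hy, ⟨s, mem_leftGen_self s⟩, Subtype.ext hys.symm⟩, ?_⟩
    rintro rfl
    exact hs hys.symm

/-- C is a quotient of the direct sum of its finite dimensional coideals `leftGen K C c`. A section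
has a component that does not kill s, and this component embeds E in a finite dimensional space. -/
theorem HasLargeMonolithic.not_isProjectiveLeftComodule (h : HasLargeMonolithic K C) :
    ¬ IsProjectiveLeftComodule K C C := by
  classical
  obtain ⟨s, E, hE, hfin, hsE, hs, hmon⟩ := h
  intro hproj
  let _ : ∀ c : C, LeftComodule K C (leftGen K C c) := fun c =>
    (isLeftSubcomodule_leftGen c).leftComodule
  have hsub : ∀ c : C, IsLeftComoduleHom K C (leftGen K C c).subtype := fun c =>
    (isLeftSubcomodule_leftGen c).isLeftComoduleHom_subtype
  let q : (Π₀ c : C, leftGen K C c) →ₗ[K] C := DFinsupp.lsum ℕ fun c => (leftGen K C c).subtype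
  have hq : IsLeftComoduleHom K C q := isLeftComoduleHom_dfinsupp fun c => by
    have : q ∘ₗ DFinsupp.lsingle c = (leftGen K C c).subtype := by ext; simp [q]
    rw [this]
    exact hsub c
  have hid : IsLeftComoduleHom K C (LinearMap.id : C →ₗ[K] C) := by
    simp [isLeftComoduleHom_iff]
  obtain ⟨g, hg, hqg⟩ := hproj _ C q LinearMap.id hq
    (fun c => ⟨DFinsupp.lsingle (R := K) c ⟨c, mem_leftGen_self c⟩, by simp [q]⟩) hid
  have hgs : g s ≠ 0 := by
    intro h0
    have := LinearMap.congr_fun hqg s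
    rw [LinearMap.comp_apply, h0, map_zero] at this
    exact hs this.symm
  obtain ⟨c, hc⟩ : ∃ c, g s c ≠ 0 := by
    by_contra! hcon
    exact hgs (DFinsupp.ext hcon)
  have hcoord : IsLeftComoduleHom K C (DFinsupp.lapply (R := K)
      (M := fun c : C => leftGen K C c) c) := by
    refine isLeftComoduleHom_dfinsupp fun d => ?_
    by_cases hdc : d = c
    · subst hdc
      have : DFinsupp.lapply (R := K) (M := fun c : C => leftGen K C c) d ∘ₗ DFinsupp.lsingle d =
          LinearMap.id := by ext; simp
      rw [this]
      simp [isLeftComoduleHom_iff]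
    · have : DFinsupp.lapply (R := K) (M := fun c : C => leftGen K C c) c ∘ₗ DFinsupp.lsingle d =
          0 := by ext; simp [DFinsupp.single_apply, hdc]
      rw [this]
      simp [isLeftComoduleHom_iff]
  exact hfin (Module.Finite.of_injective _ (hmon.injOn hE (hcoord.comp hg) hc))

/-- A component of the embedding that does not kill s is a bilinear form B on C with B(e·f, c) =
B(e, c₁) f(c₂). Fixing c with B(s, c) ≠ 0, the functional l = B(-, c) embeds E in C. By the identity
for B, the whole dual of E is then induced by the finite dimensional space of elements c₁ g(c₂). -/
theorem HasLargeMonolithic.not_isRightQcF (h : HasLargeMonolithic K C) : ¬ IsRightQcF K C := by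
  obtain ⟨s, E, hE, hfin, hsE, hs, hmon⟩ := h
  rintro ⟨ι, φ, hφ, hmul⟩
  obtain ⟨i, hi⟩ : ∃ i, φ s i ≠ 0 := by
    by_contra! hcon
    exact hs (hφ ((Finsupp.ext hcon).trans (map_zero φ).symm))
  let B : C →ₗ[K] C →ₗ[K] K :=
    { toFun := fun e => (φ e i).ofConv
      map_add' := fun x y => by simp
      map_smul' := fun a x => by simp }
  have hB : ∀ e f, B (contractL f (Coalgebra.comul e)) = conv (B e) f := fun e f =>
    congrArg WithConv.ofConv (hmul e (WithConv.toConv f) i)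
  obtain ⟨c, hc⟩ : ∃ c, B s c ≠ 0 := by
    by_contra! hcon
    exact hi (WithConv.ofConv_injective (LinearMap.ext hcon))
  let l : C →ₗ[K] K := B.flip c
  have hinj := hmon.injOn hE (isLeftComoduleHom_coeffMap (C := C) l) (by
    intro h0
    apply hc
    have := counit_coeffMap (C := C) l s
    rw [h0, map_zero] at this
    exact this.symm)
  -- every functional on `E` is of the form `e ↦ B e (c₁ g(c₂))`
  have hfd : FiniteDimensional K (Module.Dual K E) := by
    let T : (LinearMap.range (contractRHom (Coalgebra.comul (R := K) c))) →ₗ[K] Module.Dual K E :=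
      (E.subtype.lcomp K K) ∘ₗ B.flip ∘ₗ Submodule.subtype _
    have := finiteDimensional_range_contractRHom (Coalgebra.comul (R := K) c)
    refine Module.Finite.of_surjective T fun μ => ?_
    obtain ⟨g, hg⟩ := exists_comp_eq_of_injective hinj μ
    refine ⟨⟨_, g, rfl⟩, ?_⟩
    rw [← hg]
    ext e
    change B e (contractR g (Coalgebra.comul c)) = g (contractR l (Coalgebra.comul (e : C)))
    -- Both sides equal B(e·g, c): the left one by the module property of B, the right one because
    -- it is g(e₁) l(e₂) = l(e·g).
    rw [← conv_apply_eq_contractR, ← conv_apply_eq_contractR, ← hB, conv_apply_eq_contractL]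
    rfl
  exact hfin ((Module.finite_dual_iff K).1 hfd)

end Monolithic

/-! ### Right comodules along a coalgebra map -/

section RightAlong

variable {K : Type*} [Field K] {X D : Type*} [AddCommGroup X] [Module K X] [Coalgebra K X]
  [AddCommGroup D] [Module K D] [Coalgebra K D] {N M : Type*}
  [AddCommGroup N] [Module K N] [AddCommGroup M] [Module K M] [RightComodule K D M]

/-- `f` is a morphism from a right `X`-comodule to a right `D`-comodule over the coalgebra map
`φ : X → D`. -/
def IsRightHomAlong [RightComodule K X N] (φ : X →ₗc[K] D) (f : N →ₗ[K] M) : Prop :=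
  TensorProduct.map f φ.toLinearMap ∘ₗ rcoact K X N = rcoact K D M ∘ₗ f

/-- The coaction of `M` restricts to `P → P ⊗ φ(X)`. -/
def HasCoeffsIn (φ : X →ₗc[K] D) (P : Submodule K M) : Prop :=
  ∀ p ∈ P, rcoact K D M p ∈ LinearMap.range (TensorProduct.map P.subtype φ.toLinearMap)

theorem HasCoeffsIn.map [RightComodule K X N] {φ : X →ₗc[K] D} {j : N →ₗ[K] M}
    (hj : IsRightHomAlong φ j) {U : Submodule K N} (hU : IsRightSubcomodule K X U) :
    HasCoeffsIn φ (U.map j) := by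
  rintro _ ⟨n, hn, rfl⟩
  obtain ⟨y, hy⟩ := hU n hn
  have h1 : rcoact K D M (j n) = TensorProduct.map j φ.toLinearMap (rcoact K X N n) :=
    (LinearMap.congr_fun hj n).symm
  have h2 : j ∘ₗ U.subtype = (U.map j).subtype ∘ₗ
      (j ∘ₗ U.subtype).codRestrict (U.map j) fun x => ⟨x, x.2, rfl⟩ := rfl
  rw [h1, ← hy, ← LinearMap.comp_apply, LinearMap.map_comp_rTensor, h2,
    ← LinearMap.map_comp_rTensor]
  exact ⟨_, rfl⟩

/-- As φ is injective, the coaction of P lifts to coefficients in X, and the comodule axioms can be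
checked after mapping back into M and D. A basis of P moves the structure to Kⁿ, where
`FinRightComodule` lives. -/
theorem HasCoeffsIn.exists_finRightComodule {φ : X →ₗc[K] D} (hφ : Function.Injective φ)
    {P : Submodule K M} [FiniteDimensional K P] (hP : HasCoeffsIn φ P) :
    ∃ (N : FinRightComodule K X) (j : N.carrier →ₗ[K] M), Function.Injective j ∧
      LinearMap.range j = P ∧ IsRightHomAlong φ j := by
  let e : (Fin (Module.finrank K P) → K) ≃ₗ[K] P := (Module.finBasis K P).equivFun.symm
  let j : (Fin (Module.finrank K P) → K) →ₗ[K] M := P.subtype ∘ₗ e.toLinearMap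
  have hj : Function.Injective j := P.injective_subtype.comp e.injective
  have hmem : ∀ x, (rcoact K D M ∘ₗ j) x ∈
      LinearMap.range (TensorProduct.map j φ.toLinearMap) := by
    intro x
    obtain ⟨y, hy⟩ := hP (e x) (e x).2
    refine ⟨e.symm.toLinearMap.rTensor X y, ?_⟩
    rw [← LinearMap.comp_apply, LinearMap.map_comp_rTensor]
    have : j ∘ₗ e.symm.toLinearMap = P.subtype := by ext; simp [j]
    rw [this, hy]
    rfl
  obtain ⟨ρ, hρ⟩ := exists_comp_eq_of_forall_mem_range
    (TensorProduct.map_injective_of_flat_flat j φ.toLinearMap hj hφ) hmem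
  refine ⟨⟨_, RightComodule.ofInjective φ hφ j hj ρ hρ⟩, j, hj, ?_, hρ⟩
  change LinearMap.range (P.subtype ∘ₗ e.toLinearMap) = P
  rw [LinearMap.range_comp, LinearEquiv.range, Submodule.map_top, Submodule.range_subtype]

/-- A subspace containing the images of the indecomposable comodules contains all finite
dimensional ones. -/
theorem HasCoeffsIn.le_of_indecomposable {φ : X →ₗc[K] D} (hφ : Function.Injective φ)
    {T : Submodule K M}
    (hT : ∀ (N : FinRightComodule K X) (j : N.carrier →ₗ[K] M),
      IsIndecomposable K X N.carrier → IsRightHomAlong φ j → LinearMap.range j ≤ T)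
    (P : Submodule K M) [FiniteDimensional K P] (hP : HasCoeffsIn φ P) : P ≤ T := by
  induction hn : Module.finrank K P using Nat.strong_induction_on generalizing P with
  | _ n ih =>
  obtain ⟨N, j, hj, rfl, hjφ⟩ := hP.exists_finRightComodule hφ
  by_cases hind : IsIndecomposable K X N.carrier
  · exact hT N j hind hjφ
  rcases subsingleton_or_nontrivial N.carrier with hsub | hnt
  · rintro _ ⟨x, rfl⟩
    rw [Subsingleton.elim x 0, map_zero]
    exact T.zero_mem
  simp only [IsIndecomposable, not_and, not_forall, not_or] at hind
  -- A decomposable comodule is the sum of two proper subcomodules, whose images have smaller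
  -- dimension and are covered by induction.
  obtain ⟨U, V, hU, hV, hUV, hU0, hV0⟩ := hind hnt
  have hfin : Module.finrank K (LinearMap.range j) = Module.finrank K N.carrier :=
    LinearMap.finrank_range_of_inj hj
  have key : ∀ W W' : Submodule K N.carrier, IsRightSubcomodule K X W → IsCompl W W' → W' ≠ ⊥ →
      W.map j ≤ T := by
    intro W W' hW hc hne
    refine ih _ ?_ (W.map j) (HasCoeffsIn.map hjφ hW) rfl
    rw [← hn, hfin, LinearEquiv.finrank_eq (Submodule.equivMapOfInjective j hj W).symm]
    refine Submodule.finrank_lt fun htop => hne ?_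
    rw [← hc.inf_eq_bot, htop, top_inf_eq]
  rw [LinearMap.range_eq_map, ← hUV.sup_eq_top, Submodule.map_sup]
  exact sup_le (key U V hU hUV hV0) (key V U hV hUV.symm hU0)

end RightAlong

/-! ### The right subcomodule generated by an element -/

section RightGen

variable (K : Type*) [Field K] (C : Type*) [AddCommGroup C] [Module K C] [Coalgebra K C]
  {M : Type*} [AddCommGroup M] [Module K M] [RightComodule K C M]

/-- The right subcomodule generated by an element. -/
def rightGen (m : M) : Submodule K M := LinearMap.range (contractRHom (rcoact K C M m))

theorem mem_rightGen_self (m : M) : m ∈ rightGen K C m :=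
  ⟨Coalgebra.counit, contractR_counit_rcoact m⟩

theorem isRightSubcomodule_rightGen (m : M) : IsRightSubcomodule K C (rightGen K C m) := by
  rw [isRightSubcomodule_iff]
  rintro _ ⟨f, rfl⟩ g
  exact ⟨conv g f, (contractR_rcoact_contractR g f m).symm⟩

instance (m : M) : FiniteDimensional K (rightGen K C m) :=
  finiteDimensional_range_contractRHom _

end RightGen

/-! ### Reduction of the generating condition to single elements -/

section Generating

variable {K : Type u} [Field K] {C : Type u} [AddCommGroup C] [Module K C] [Coalgebra K C]

/-- One copy of C is taken for each comodule map to M, so it is enough that the images of these maps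
span M. -/
theorem isRightGenerating_of_forall_mem_iSup
    (h : ∀ (M : Type u) [AddCommGroup M] [Module K M] [RightComodule K C M] (m : M),
      m ∈ ⨆ F : {F : C →ₗ[K] M // IsRightComoduleHom K C F}, LinearMap.range F.1) :
    IsRightGenerating K C := by
  intro M _ _ _
  refine ⟨{F : C →ₗ[K] M // IsRightComoduleHom K C F}, Finsupp.lsum ℕ fun F => F.1, ?_, ?_⟩
  · refine Finsupp.lhom_ext' fun F => ?_
    have h1 : rcoact K C ({F : C →ₗ[K] M // IsRightComoduleHom K C F} →₀ C) ∘ₗ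
        Finsupp.lsingle F = (Finsupp.lsingle F).rTensor C ∘ₗ rcoact K C C := by
      refine LinearMap.ext fun c => ?_
      exact Finsupp.sum_single_index (map_zero _)
    have h2 : (Finsupp.lsum ℕ fun F : {F : C →ₗ[K] M // IsRightComoduleHom K C F} => F.1) ∘ₗ
        Finsupp.lsingle F = F.1 := by ext; simp
    rw [LinearMap.comp_assoc, h1, LinearMap.comp_assoc, h2, ← LinearMap.comp_assoc,
      ← LinearMap.rTensor_comp, h2]
    exact F.2
  · intro m
    have hle : (⨆ F : {F : C →ₗ[K] M // IsRightComoduleHom K C F}, LinearMap.range F.1) ≤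
        LinearMap.range (Finsupp.lsum ℕ
          fun F : {F : C →ₗ[K] M // IsRightComoduleHom K C F} => F.1) := by
      refine iSup_le fun F => ?_
      rintro _ ⟨c, rfl⟩
      exact ⟨Finsupp.single F c, by simp⟩
    exact hle (h M m)

end Generating

/-! ### Sequential unions -/

namespace SeqColim

section

variable (K : Type*) [Field K] (X : ℕ → Type*) [∀ n, AddCommGroup (X n)] [∀ n, Module K (X n)]
  [∀ n, Coalgebra K (X n)] (f : ∀ n, X n →ₗc[K] X (n + 1))

theorem of_succ (n : ℕ) (y : X n) : of K X f (n + 1) (f n y) = of K X f n y := by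
  symm
  exact (Submodule.Quotient.eq _).2 (Submodule.subset_span ⟨n, y, rfl⟩)

theorem of_succ_comp (n : ℕ) : (of K X f (n + 1)).comp (f n) = of K X f n :=
  CoalgHom.ext fun y => of_succ K X f n y

theorem range_of_mono :
    Monotone fun n => LinearMap.range (of K X f n).toLinearMap :=
  monotone_nat_of_le_succ fun n => by
    rintro _ ⟨y, rfl⟩
    exact ⟨f n y, of_succ K X f n y⟩

theorem exists_of (x : SeqColim K X f) : ∃ n y, of K X f n y = x := by
  obtain ⟨z, rfl⟩ := Submodule.Quotient.mk_surjective _ x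
  induction z using DFinsupp.induction with
  | h0 => exact ⟨0, 0, by simp⟩
  | ha i b z _ _ ih =>
    obtain ⟨n, y, hy⟩ := ih
    obtain ⟨a, ha⟩ := range_of_mono K X f (le_max_left i n) ⟨b, rfl⟩
    obtain ⟨c, hc⟩ := range_of_mono K X f (le_max_right i n) ⟨y, rfl⟩
    refine ⟨max i n, a + c, ?_⟩
    rw [map_add]
    refine (congrArg₂ (· + ·) (ha.trans ?_) (hc.trans hy)).trans
      (Submodule.Quotient.mk_add _).symm
    rfl

variable {K X f}

theorem hom_ext {N : Type*} [AddCommGroup N] [Module K N] {g h : SeqColim K X f →ₗ[K] N}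
    (H : ∀ n, g ∘ₗ (of K X f n).toLinearMap = h ∘ₗ (of K X f n).toLinearMap) : g = h := by
  refine LinearMap.ext fun x => ?_
  obtain ⟨n, y, rfl⟩ := exists_of K X f x
  exact LinearMap.congr_fun (H n) y

/-- A map on one term of the sequence which can be extended step by step extends to the union. -/
theorem exists_extension {N : Type*} [AddCommGroup N] [Module K N]
    (P : ∀ n, (X n →ₗ[K] N) → Prop)
    (hP : ∀ n φ, P n φ → ∃ ψ : X (n + 1) →ₗ[K] N, P (n + 1) ψ ∧ ψ ∘ₗ (f n).toLinearMap = φ)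
    (m : ℕ) (φ : X m →ₗ[K] N) (hφ : P m φ) :
    ∃ Φ : SeqColim K X f →ₗ[K] N, Φ ∘ₗ (of K X f m).toLinearMap = φ ∧
      ∀ n, m ≤ n → P n (Φ ∘ₗ (of K X f n).toLinearMap) := by
  classical
  -- Below m the maps are forced: they are pullbacks of φ. The values of ψ beyond m are arbitrary
  -- and never used.
  have hdown : ∀ (m : ℕ) (φ : X m →ₗ[K] N), ∃ ψ : ∀ n, X n →ₗ[K] N, ψ m = φ ∧
      ∀ n < m, ψ (n + 1) ∘ₗ (f n).toLinearMap = ψ n := by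
    intro m
    induction m with
    | zero => exact fun φ => ⟨Function.update 0 0 φ, by simp, by simp⟩
    | succ m ih =>
      intro φ
      obtain ⟨ψ, hm, hψ⟩ := ih (φ ∘ₗ (f m).toLinearMap)
      refine ⟨Function.update ψ (m + 1) φ, by simp, fun n hn => ?_⟩
      rcases Nat.lt_succ_iff_lt_or_eq.1 hn with h | rfl
      · rw [Function.update_of_ne (by omega), Function.update_of_ne (by omega), hψ n h]
      · rw [Function.update_self, Function.update_of_ne (by omega), hm]
  obtain ⟨ψ, hm, hψ⟩ := hdown m φ
  choose! E hEP hE using hP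
  -- The compatible family: pullbacks of φ up to m, then chosen extensions one step at a time.
  let χ : ∀ n, X n →ₗ[K] N := fun n =>
    Nat.rec (ψ 0) (fun n prev => if n < m then ψ (n + 1) else E n prev) n
  have hχs : ∀ n, χ (n + 1) = if n < m then ψ (n + 1) else E n (χ n) := fun n => rfl
  have hχψ : ∀ n ≤ m, χ n = ψ n := by
    intro n hn
    cases n with
    | zero => rfl
    | succ n => rw [hχs, if_pos (by omega)]
  have hχP : ∀ n, m ≤ n → P n (χ n) := by
    intro n hn
    induction n, hn using Nat.le_induction with
    | base => rwa [hχψ m le_rfl, hm]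
    | succ n hn ih =>
      rw [hχs, if_neg (by omega)]
      exact hEP n _ ih
  have hχ : ∀ n, χ (n + 1) ∘ₗ (f n).toLinearMap = χ n := by
    intro n
    rcases lt_or_ge n m with h | h
    · rw [hχψ _ h, hχψ _ h.le, hψ n h]
    · rw [hχs, if_neg (by omega)]
      exact hE n _ (hχP n h)
  have hker : seqRel K X f ≤ LinearMap.ker (DFinsupp.lsum ℕ χ) := by
    refine Submodule.span_le.2 ?_
    rintro _ ⟨n, y, rfl⟩
    have := LinearMap.congr_fun (hχ n) y
    simp only [LinearMap.comp_apply] at this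
    simp only [SetLike.mem_coe, LinearMap.mem_ker, map_sub, sub_eq_zero, DFinsupp.lsingle_apply,
      DFinsupp.lsum_single]
    exact this.symm
  have hof : ∀ n, (seqRel K X f).liftQ (DFinsupp.lsum ℕ χ) hker ∘ₗ (of K X f n).toLinearMap =
      χ n := fun n => LinearMap.ext fun y => DFinsupp.lsum_single (S := ℕ) χ n y
  refine ⟨(seqRel K X f).liftQ (DFinsupp.lsum ℕ χ) hker, ?_, fun n hn => ?_⟩
  · rw [hof, hχψ m le_rfl, hm]
  · rw [hof]
    exact hχP n hn

/-- The identity of X n extends linearly to the whole union, since each inclusion has a linear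
retraction. The extension is a left inverse of the canonical map. -/
theorem of_injective (hf : ∀ n, Function.Injective (f n)) (n : ℕ) :
    Function.Injective (of K X f n) := by
  obtain ⟨Φ, hΦ, -⟩ := exists_extension (f := f) (N := X n) (fun _ _ => True)
    (fun k φ _ => by
      obtain ⟨r, hr⟩ := (f k).toLinearMap.exists_leftInverse_of_injective
        (LinearMap.ker_eq_bot.2 (hf k))
      exact ⟨φ ∘ₗ r, trivial, by rw [LinearMap.comp_assoc, hr, LinearMap.comp_id]⟩)
    n LinearMap.id trivial
  intro x y hxy
  rw [← LinearMap.id_apply (R := K) x, ← hΦ, ← LinearMap.id_apply (R := K) y, ← hΦ]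
  exact congrArg Φ hxy

/-- The coefficients of a finite dimensional comodule over a union lie in one of the terms. -/
theorem exists_hasCoeffsIn {M : Type*} [AddCommGroup M] [Module K M]
    [RightComodule K (SeqColim K X f) M] {P : Submodule K M} [FiniteDimensional K P]
    (hP : IsRightSubcomodule K (SeqColim K X f) P) : ∃ n, HasCoeffsIn (of K X f n) P := by
  have hmono : Monotone fun n => LinearMap.range
      (TensorProduct.map P.subtype (of K X f n).toLinearMap) := fun a b hab =>
    TensorProduct.range_map_mono le_rfl (range_of_mono K X f hab)
  have hel : ∀ x : P ⊗[K] SeqColim K X f, ∃ n, P.subtype.rTensor _ x ∈ LinearMap.range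
      (TensorProduct.map P.subtype (of K X f n).toLinearMap) := by
    intro x
    induction x using TensorProduct.induction_on with
    | zero => exact ⟨0, by simp⟩
    | tmul p d =>
      obtain ⟨n, y, rfl⟩ := exists_of K X f d
      exact ⟨n, p ⊗ₜ y, rfl⟩
    | add x y hx hy =>
      obtain ⟨a, ha⟩ := hx
      obtain ⟨b, hb⟩ := hy
      refine ⟨max a b, ?_⟩
      rw [map_add]
      exact add_mem (hmono (le_max_left a b) ha) (hmono (le_max_right a b) hb)
  have hel' : ∀ p ∈ P, ∃ n, rcoact K _ M p ∈ LinearMap.range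
      (TensorProduct.map P.subtype (of K X f n).toLinearMap) := by
    intro p hp
    obtain ⟨x, hx⟩ := hP p hp
    rw [← hx]
    exact hel x
  obtain ⟨s, hs⟩ := (Submodule.fg_iff_finiteDimensional P).2 ‹_›
  have hsP : ∀ p ∈ s, p ∈ P := fun p hp => hs ▸ Submodule.subset_span hp
  choose! ν hν using hel'
  refine ⟨s.sup ν, fun p hp => ?_⟩
  have : P ≤ (LinearMap.range (TensorProduct.map P.subtype
      (of K X f (s.sup ν)).toLinearMap)).comap (rcoact K _ M) := by
    conv_lhs => rw [← hs]
    exact Submodule.span_le.2 fun p hp => hmono (Finset.le_sup hp) (hν p (hsP p hp))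
  exact this hp

end

end SeqColim

/-! ### A criterion for a sequential union to satisfy the generating condition -/

section GeneratingStep

variable {K : Type u} [Field K]

/-- Comodule maps from `X` killing `x` extend to `Y`, and images of indecomposable
`X`-comodules are images of `Y`. -/
structure IsGeneratingStep {X Y : Type u} [AddCommGroup X] [Module K X] [Coalgebra K X]
    [AddCommGroup Y] [Module K Y] [Coalgebra K Y] (f : X →ₗc[K] Y) (x : X) (y : Y) : Prop where
  extend : ∀ {D M : Type u} [AddCommGroup D] [Module K D] [Coalgebra K D] [AddCommGroup M]
    [Module K M] [RightComodule K D M] (ψ : Y →ₗc[K] D) (p : X →ₗ[K] M),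
    IsRightHomAlong (ψ.comp f) p → p x = 0 →
    ∃ p' : Y →ₗ[K] M, IsRightHomAlong ψ p' ∧ p' y = 0 ∧ p' ∘ₗ f.toLinearMap = p
  cover : ∀ {D M : Type u} [AddCommGroup D] [Module K D] [Coalgebra K D] [AddCommGroup M]
    [Module K M] [RightComodule K D M] (ψ : Y →ₗc[K] D) (N : FinRightComodule K X)
    (j : N.carrier →ₗ[K] M), IsIndecomposable K X N.carrier → IsRightHomAlong (ψ.comp f) j →
    ∃ p' : Y →ₗ[K] M, IsRightHomAlong ψ p' ∧ p' y = 0 ∧ LinearMap.range j ≤ LinearMap.range p'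

/-- An element generates a finite dimensional subcomodule with coefficients in some X n. Its
indecomposable constituents are covered by X (n + 1), and the covering maps extend through all later
terms, hence to the union. -/
theorem isRightGenerating_seqColim {X : ℕ → Type u} [∀ n, AddCommGroup (X n)]
    [∀ n, Module K (X n)] [∀ n, Coalgebra K (X n)] {f : ∀ n, X n →ₗc[K] X (n + 1)}
    (hf : ∀ n, Function.Injective (f n)) (x : ∀ n, X n)
    (h : ∀ n, IsGeneratingStep (f n) (x n) (x (n + 1))) :
    IsRightGenerating K (SeqColim K X f) := by
  refine isRightGenerating_of_forall_mem_iSup fun M _ _ _ m => ?_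
  obtain ⟨n, hn⟩ := SeqColim.exists_hasCoeffsIn
    (isRightSubcomodule_rightGen K (SeqColim K X f) m)
  refine hn.le_of_indecomposable (SeqColim.of_injective hf n) (fun N j hN hj => ?_) _
    (mem_rightGen_self K (SeqColim K X f) m)
  rw [← SeqColim.of_succ_comp] at hj
  obtain ⟨p, hp, hpx, hjp⟩ := (h n).cover (SeqColim.of K X f (n + 1)) N j hN hj
  obtain ⟨Φ, hΦ, hΦP⟩ := SeqColim.exists_extension (f := f)
    (fun k φ => IsRightHomAlong (SeqColim.of K X f k) φ ∧ φ (x k) = 0)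
    -- A map over X k → union is viewed over X k → X (k + 1) → union, which is the form the
    -- extension property needs.
    (fun k φ hφ => by
      rw [← SeqColim.of_succ_comp] at hφ
      obtain ⟨ψ, h1, h2, h3⟩ := (h k).extend _ φ hφ.1 hφ.2
      exact ⟨ψ, ⟨h1, h2⟩, h3⟩) (n + 1) p ⟨hp, hpx⟩
  refine hjp.trans (le_trans ?_ (le_iSup (fun F : {F : SeqColim K X f →ₗ[K] M //
    IsRightComoduleHom K _ F} => LinearMap.range F.1) ⟨Φ, ?_⟩))
  · rw [← hΦ]
    exact LinearMap.range_comp_le_range _ _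
  · refine LinearMap.ext fun y => ?_
    obtain ⟨k, z, rfl⟩ := SeqColim.exists_of K X f y
    -- Compatibility with the coactions is known only from stage n + 1 on, so the element is first
    -- pushed to such a stage.
    obtain ⟨b, hb⟩ := SeqColim.range_of_mono K X f (le_max_left k (n + 1)) ⟨z, rfl⟩
    change SeqColim.of K X f _ b = SeqColim.of K X f k z at hb
    rw [← hb]
    have h1 := LinearMap.congr_fun (hΦP _ (le_max_right k (n + 1))).1 b
    have h2 : rcoact K (SeqColim K X f) (SeqColim K X f) (SeqColim.of K X f _ b) =
        TensorProduct.map _ _ (Coalgebra.comul (R := K) b) :=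
      (LinearMap.congr_fun (SeqColim.of K X f (max k (n + 1))).map_comp_comul b).symm
    rw [LinearMap.comp_apply, h2, ← LinearMap.comp_apply, LinearMap.rTensor_comp_map]
    exact h1

end GeneratingStep

/-! ### Comodule maps out of the coalgebras `C'` and `C^∨` -/

section ExtMaps

variable {K : Type*} [Field K] {C : Type*} [AddCommGroup C] [Module K C] [Coalgebra K C]
  {ι : Type*} {M : ι → Type*} [∀ i, AddCommGroup (M i)] [∀ i, Module K (M i)]
  [∀ i, RightComodule K C (M i)] [∀ i, FiniteDimensional K (M i)]
  {D V : Type*} [AddCommGroup D] [Module K D] [Coalgebra K D] [AddCommGroup V] [Module K V]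
  [RightComodule K D V]

/-- Comodule maps on the `M i` and on `C` give a comodule map on `(⨁ A_{M_i}) ⊕ (⨁ M_i) ⊕ C`
which vanishes on the `A_{M_i}`. -/
theorem isRightHomAlong_desc (ψ : ExtCoalg K C M →ₗc[K] D) (j : ∀ i, M i →ₗ[K] V)
    (p : C →ₗ[K] V) (hj : ∀ i, IsRightHomAlong (ψ.comp (ExtCoalg.inCCoalg K C M)) (j i))
    (hp : IsRightHomAlong (ψ.comp (ExtCoalg.inCCoalg K C M)) p) :
    IsRightHomAlong ψ (ExtCoalg.desc K C M (fun _ => 0) j p) := by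
  have hψ : (ψ.comp (ExtCoalg.inCCoalg K C M)).toLinearMap =
    ψ.toLinearMap ∘ₗ ExtCoalg.inC K C M := rfl
  have hΔ : rcoact K (ExtCoalg K C M) (ExtCoalg K C M) = Coalgebra.comul := rfl
  unfold IsRightHomAlong at *
  rw [hΔ]
  refine ExtCoalg.hom_ext (fun i => ?_) (fun i => ?_) ?_
  · rw [LinearMap.comp_assoc, ExtCoalg.comul_inA, ← LinearMap.comp_assoc, ← TensorProduct.map_comp,
      LinearMap.comp_assoc, ExtCoalg.desc_inA, TensorProduct.map_zero_left, LinearMap.zero_comp,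
      LinearMap.comp_zero]
  -- In Δ(m) = m₋₁ ⊗ m₀ + m₀ ⊗ m₁ the first term has its left leg in A_{M_i} and is killed; the
  -- second is the coaction of M_i.
  · rw [LinearMap.comp_assoc, ExtCoalg.comul_inM, LinearMap.comp_add, ← LinearMap.comp_assoc,
      ← LinearMap.comp_assoc, ← TensorProduct.map_comp, ← TensorProduct.map_comp,
      LinearMap.comp_assoc, ExtCoalg.desc_inA, ExtCoalg.desc_inM, TensorProduct.map_zero_left,
      LinearMap.zero_comp, zero_add, ← hψ, hj]
  · rw [LinearMap.comp_assoc, ExtCoalg.comul_inC, ← LinearMap.comp_assoc, ← TensorProduct.map_comp,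
      LinearMap.comp_assoc, ExtCoalg.desc_inC, ← hψ]
    exact hp

section DescApply

variable {N : Type*} [AddCommGroup N] [Module K N] (a : ∀ i, EndCoalg K C (M i) →ₗ[K] N)
  (m : ∀ i, M i →ₗ[K] N) (c : C →ₗ[K] N)

theorem desc_inACoalg_apply (i : ι) (x : EndCoalg K C (M i)) :
    ExtCoalg.desc K C M a m c (ExtCoalg.inACoalg K C M i x) = a i x :=
  LinearMap.congr_fun (ExtCoalg.desc_inA a m c i) x

theorem desc_inM_apply (i : ι) (x : M i) :
    ExtCoalg.desc K C M a m c (ExtCoalg.inM K C M i x) = m i x :=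
  LinearMap.congr_fun (ExtCoalg.desc_inM a m c i) x

theorem desc_inCCoalg_apply (x : C) :
    ExtCoalg.desc K C M a m c (ExtCoalg.inCCoalg K C M x) = c x :=
  LinearMap.congr_fun (ExtCoalg.desc_inC a m c) x

end DescApply

theorem isRightHomAlong_zero {N : Type*} [AddCommGroup N] [Module K N] [RightComodule K C N]
    (φ : C →ₗc[K] D) : IsRightHomAlong φ (0 : N →ₗ[K] V) := by
  simp [IsRightHomAlong]

theorem IsRightHomAlong.comp_hom {N N' : Type*} [AddCommGroup N] [Module K N]
    [RightComodule K C N] [AddCommGroup N'] [Module K N'] [RightComodule K C N'] {φ : C →ₗc[K] D}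
    {f : N →ₗ[K] V} (hf : IsRightHomAlong φ f) {e : N' →ₗ[K] N}
    (he : IsRightComoduleHom K C e) : IsRightHomAlong φ (f ∘ₗ e) := by
  unfold IsRightHomAlong IsRightComoduleHom at *
  rw [← LinearMap.comp_assoc, ← hf, LinearMap.comp_assoc, ← he, ← LinearMap.comp_assoc,
    LinearMap.map_comp_rTensor]

theorem isRightHomAlong_single [DecidableEq ι] {φ : C →ₗc[K] D} {i : ι} {f : M i →ₗ[K] V}
    (hf : IsRightHomAlong φ f) (k : ι) :
    IsRightHomAlong φ (Function.update (fun i => (0 : M i →ₗ[K] V)) i f k) := by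
  by_cases h : k = i
  · subst h
    rwa [Function.update_self]
  · rw [Function.update_of_ne h]
    exact isRightHomAlong_zero φ

end ExtMaps

/-! ### Right subcomodules and indecomposability under morphisms -/

section RightSub

variable {K : Type*} [Field K] {C : Type*} [AddCommGroup C] [Module K C] [Coalgebra K C]
  {M N : Type*} [AddCommGroup M] [Module K M] [RightComodule K C M]
  [AddCommGroup N] [Module K N] [RightComodule K C N]

theorem IsRightComoduleHom.apply_contractR {f : M →ₗ[K] N} (hf : IsRightComoduleHom K C f) (m : M)
    (g : C →ₗ[K] K) : f (contractR g (rcoact K C M m)) = contractR g (rcoact K C N (f m)) := by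
  rw [← contractR_rTensor]
  exact congrArg _ (LinearMap.congr_fun hf m)

theorem IsRightSubcomodule.map {f : M →ₗ[K] N} (hf : IsRightComoduleHom K C f)
    {P : Submodule K M} (hP : IsRightSubcomodule K C P) : IsRightSubcomodule K C (P.map f) := by
  rw [isRightSubcomodule_iff] at *
  rintro _ ⟨m, hm, rfl⟩ g
  rw [← hf.apply_contractR]
  exact ⟨_, hP m hm g, rfl⟩

theorem IsRightComoduleHom.isRightSubcomodule_ker {f : M →ₗ[K] N}
    (hf : IsRightComoduleHom K C f) : IsRightSubcomodule K C (LinearMap.ker f) := by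
  rw [isRightSubcomodule_iff]
  intro m hm g
  rw [LinearMap.mem_ker] at hm ⊢
  rw [hf.apply_contractR, hm, map_zero, map_zero]

theorem IsRightComoduleHom.isRightSubcomodule_range {f : M →ₗ[K] N}
    (hf : IsRightComoduleHom K C f) : IsRightSubcomodule K C (LinearMap.range f) := by
  rw [LinearMap.range_eq_map]
  refine IsRightSubcomodule.map hf ?_
  rw [isRightSubcomodule_iff]
  exact fun _ _ _ => trivial

/-- Only chosen representatives index C^~, so indecomposability has to be carried from a given
comodule to its representative. -/
theorem IsIndecomposable.of_equiv (h : IsIndecomposable K C N) (e : M ≃ₗ[K] N)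
    (he : IsRightComoduleHom K C e.toLinearMap) : IsIndecomposable K C M := by
  have := h.1
  refine ⟨e.toEquiv.nontrivial, fun P Q hP hQ hPQ => ?_⟩
  have key : ∀ R : Submodule K M, R.map e.toLinearMap = ⊥ → R = ⊥ := fun R hR =>
    Submodule.map_injective_of_injective e.injective (hR.trans (Submodule.map_bot _).symm)
  exact (h.2 _ _ (hP.map he) (hQ.map he)
    ((Submodule.orderIsoMapComap e).isCompl hPQ)).imp (key P) (key Q)

end RightSub

/-! ### The embeddings of C in C' and in C^∨ as generating steps -/

section Steps

variable {K : Type u} [Field K] {C : Type u} [AddCommGroup C] [Module K C] [Coalgebra K C]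

variable (C) in
/-- The family of the indecomposable finite dimensional right comodules. -/
abbrev indecFamily (q : IndecType K C) : Type u := q.rep.carrier

/-- The isomorphism type of a finite dimensional comodule. -/
def IsoType.mk (N : FinRightComodule K C) : IsoType K C :=
  Quotient.mk (FinRightComodule.isoSetoid K C) N

theorem IsoType.exists_equiv_rep_mk (N : FinRightComodule K C) :
    ∃ e : (IsoType.mk N).rep.carrier ≃ₗ[K] N.carrier, IsRightComoduleHom K C e.toLinearMap :=
  Quotient.exact (Quotient.out_eq (Quotient.mk (FinRightComodule.isoSetoid K C) N))

/-- Extension is by zero on the new summands, and a comodule is covered by the projection onto its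
copy in C'. There is no quotient here, so the base points are 0 and their conditions are void. -/
theorem isGeneratingStep_prime :
    IsGeneratingStep (ExtCoalg.inCCoalg K C (fun q : IsoType K C => q.rep.carrier)) 0 0 where
  extend ψ p hp _ := ⟨ExtCoalg.desc K C _ (fun _ => 0) (fun _ => 0) p,
    isRightHomAlong_desc ψ _ p (fun _ => isRightHomAlong_zero _) hp, map_zero _,
    ExtCoalg.desc_inC _ _ _⟩
  cover ψ N j _ hj := by
    classical
    obtain ⟨e, he⟩ := IsoType.exists_equiv_rep_mk N
    refine ⟨ExtCoalg.desc K C _ (fun _ => 0)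
      (Function.update (fun _ => 0) (IsoType.mk N) (j ∘ₗ e.toLinearMap)) 0,
      isRightHomAlong_desc ψ _ 0 (isRightHomAlong_single (hj.comp_hom he))
        (isRightHomAlong_zero _), map_zero _, ?_⟩
    rintro _ ⟨n, rfl⟩
    obtain ⟨m, rfl⟩ := e.surjective n
    refine ⟨ExtCoalg.inM K C _ (IsoType.mk N) m, ?_⟩
    rw [desc_inM_apply, Function.update_self]
    rfl

variable {g : C} (hg : IsGroupLikeElem K g)

theorem veeCoideal_le_ker_iff {V : Type*} [AddCommGroup V] [Module K V]
    (r : TildeCoalg K C →ₗ[K] V) : veeCoideal K g ≤ LinearMap.ker r ↔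
    ∀ (q : IndecType K C) (h : EndCoalg K C (indecFamily C q)), IsGroupLikeElem K h →
      r (ExtCoalg.inCCoalg K C (indecFamily C) g) =
        r (ExtCoalg.inACoalg K C (indecFamily C) q h) := by
  constructor
  · intro hr q h hh
    rw [← sub_eq_zero, ← map_sub]
    exact hr (Submodule.subset_span ⟨q, h, hh, rfl⟩)
  · intro hr
    refine Submodule.span_le.2 ?_
    rintro _ ⟨q, h, hh, rfl⟩
    rw [SetLike.mem_coe, LinearMap.mem_ker, map_sub, sub_eq_zero]
    exact hr q h hh

/-- A map that kills all A_M and also g kills every generator g - g_M. This is what the vanishing at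
base points is for. -/
theorem veeCoideal_le_ker_desc {V : Type*} [AddCommGroup V] [Module K V]
    (j : ∀ q : IndecType K C, indecFamily C q →ₗ[K] V) {p : C →ₗ[K] V} (hp : p g = 0) :
    veeCoideal K g ≤ LinearMap.ker (ExtCoalg.desc K C (indecFamily C) (fun _ => 0) j p) := by
  rw [veeCoideal_le_ker_iff]
  intro q h _
  rw [desc_inCCoalg_apply, desc_inACoalg_apply, hp, LinearMap.zero_apply]

/-- The canonical map `C → C^∨`. -/
def veeMap : haveI := isCoideal_veeCoideal K hg
    C →ₗc[K] TildeCoalg K C ⧸ veeCoideal K g :=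
  haveI := isCoideal_veeCoideal K hg
  (Coalgebra.Quotient.mkQCoalgHom (R := K) (veeCoideal K g)).comp (ExtCoalg.inCCoalg K C _)

theorem isRightHomAlong_liftQ {Y : Type*} [AddCommGroup Y] [Module K Y] [Coalgebra K Y]
    {I : Submodule K Y} [I.IsCoideal] {D V : Type*} [AddCommGroup D] [Module K D] [Coalgebra K D]
    [AddCommGroup V] [Module K V] [RightComodule K D V] (ψ : Y ⧸ I →ₗc[K] D) {p : Y →ₗ[K] V}
    (hp : IsRightHomAlong (ψ.comp (Coalgebra.Quotient.mkQCoalgHom (R := K) I)) p)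
    (hI : I ≤ LinearMap.ker p) : IsRightHomAlong ψ (I.liftQ p hI) := by
  refine Submodule.linearMap_qext I ?_
  have h1 : rcoact K (Y ⧸ I) (Y ⧸ I) ∘ₗ I.mkQ =
      TensorProduct.map I.mkQ I.mkQ ∘ₗ Coalgebra.comul :=
    (Coalgebra.Quotient.mkQCoalgHom (R := K) I).map_comp_comul.symm
  rw [LinearMap.comp_assoc, h1, ← LinearMap.comp_assoc, ← TensorProduct.map_comp,
    LinearMap.comp_assoc, Submodule.liftQ_mkQ]
  exact hp

theorem liftQ_veeMap {V : Type*} [AddCommGroup V] [Module K V]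
    {a : ∀ q, EndCoalg K C (indecFamily C q) →ₗ[K] V} {m : ∀ q, indecFamily C q →ₗ[K] V}
    {c : C →ₗ[K] V} (h : veeCoideal K g ≤ LinearMap.ker (ExtCoalg.desc K C (indecFamily C) a m c))
    (x : C) : (veeCoideal K g).liftQ _ h (veeMap hg x) = c x :=
  desc_inCCoalg_apply a m c x

/-- The maps used for C' also work on C^~; since they vanish at g they descend to C^∨ and still
vanish at the new base point. -/
theorem isGeneratingStep_veeMap :
    haveI := isCoideal_veeCoideal K hg
    IsGeneratingStep (veeMap hg) g (veeMap hg g) := by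
  have := isCoideal_veeCoideal K hg
  constructor
  · intro D V _ _ _ _ _ _ ψ p hp hpg
    refine ⟨(veeCoideal K g).liftQ _ (veeCoideal_le_ker_desc (fun _ => 0) hpg),
      isRightHomAlong_liftQ ψ (isRightHomAlong_desc _ _ p (fun _ => isRightHomAlong_zero _) hp) _,
      ?_, LinearMap.ext (liftQ_veeMap hg (veeCoideal_le_ker_desc (fun _ => 0) hpg))⟩
    rw [liftQ_veeMap, hpg]
  · intro D V _ _ _ _ _ _ ψ N j hN hj
    classical
    obtain ⟨e, he⟩ := IsoType.exists_equiv_rep_mk N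
    let q : IndecType K C := ⟨IsoType.mk N, hN.of_equiv e he⟩
    let e' : indecFamily C q ≃ₗ[K] N.carrier := e
    have he' : IsRightComoduleHom K C e'.toLinearMap := he
    refine ⟨(veeCoideal K g).liftQ _ (veeCoideal_le_ker_desc
      (Function.update (fun _ => 0) q (j ∘ₗ e'.toLinearMap)) (p := 0) rfl),
      isRightHomAlong_liftQ ψ (isRightHomAlong_desc _ _ 0
        (isRightHomAlong_single (hj.comp_hom he')) (isRightHomAlong_zero _)) _,
      liftQ_veeMap hg _ g, ?_⟩
    rintro _ ⟨n, rfl⟩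
    obtain ⟨m, rfl⟩ := e'.surjective n
    refine ⟨Submodule.Quotient.mk (ExtCoalg.inM K C (indecFamily C) q m), ?_⟩
    rw [Submodule.liftQ_apply, desc_inM_apply, Function.update_self]
    rfl

theorem inCCoalg_injective {ι : Type*} (M : ι → Type*) [∀ i, AddCommGroup (M i)]
    [∀ i, Module K (M i)] [∀ i, RightComodule K C (M i)] [∀ i, FiniteDimensional K (M i)] :
    Function.Injective (ExtCoalg.inCCoalg K C M) :=
  Function.LeftInverse.injective
    (g := ExtCoalg.desc K C M (fun _ => 0) (fun _ => 0) LinearMap.id)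
    fun x => desc_inCCoalg_apply _ _ _ x

/-- A linear retraction is given by α ↦ ε(α) g on each A_M, zero on each M and the identity on C. It
respects the quotient because group-like elements have counit 1. -/
theorem veeMap_injective :
    haveI := isCoideal_veeCoideal K hg
    Function.Injective (veeMap hg) := by
  have := isCoideal_veeCoideal K hg
  have hr : veeCoideal K g ≤ LinearMap.ker (ExtCoalg.desc K C (indecFamily C)
      (fun _ => (LinearMap.toSpanSingleton K C g) ∘ₗ Coalgebra.counit) (fun _ => 0)
      LinearMap.id) := by
    rw [veeCoideal_le_ker_iff]
    intro q h hh
    rw [desc_inCCoalg_apply, desc_inACoalg_apply, LinearMap.comp_apply, hh.counit_eq_one,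
      LinearMap.toSpanSingleton_apply, one_smul, LinearMap.id_apply]
  exact Function.LeftInverse.injective (g := (veeCoideal K g).liftQ _ hr)
    fun x => liftQ_veeMap hg hr x

end Steps

/-! ### Simple subcoalgebras and connected coalgebras -/

section Subcoalgebra

variable {K : Type u} [Field K] {C D : Type u} [AddCommGroup C] [Module K C] [Coalgebra K C]
  [AddCommGroup D] [Module K D] [Coalgebra K D]

theorem IsSubcoalgebra.inf {S T : Submodule K C} (hS : IsSubcoalgebra K S)
    (hT : IsSubcoalgebra K T) : IsSubcoalgebra K (S ⊓ T) := by
  rw [isSubcoalgebra_iff] at *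
  exact fun d hd => ⟨fun f => ⟨(hS d hd.1).1 f, (hT d hd.2).1 f⟩,
    fun f => ⟨(hS d hd.1).2 f, (hT d hd.2).2 f⟩⟩

theorem IsSubcoalgebra.sup {S T : Submodule K C} (hS : IsSubcoalgebra K S)
    (hT : IsSubcoalgebra K T) : IsSubcoalgebra K (S ⊔ T) := by
  rw [isSubcoalgebra_iff] at *
  intro d hd
  obtain ⟨s, hs, t, ht, rfl⟩ := Submodule.mem_sup.1 hd
  simp only [map_add]
  exact ⟨fun f => Submodule.add_mem_sup ((hS s hs).1 f) ((hT t ht).1 f),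
    fun f => Submodule.add_mem_sup ((hS s hs).2 f) ((hT t ht).2 f)⟩

theorem IsSubcoalgebra.map {S : Submodule K C} (hS : IsSubcoalgebra K S) (φ : C →ₗc[K] D) :
    IsSubcoalgebra K (S.map φ.toLinearMap) := by
  rw [isSubcoalgebra_iff] at *
  rintro _ ⟨c, hc, rfl⟩
  exact ⟨fun f => ⟨_, (hS c hc).1 _, (contractR_comul_coalgHom φ f c).symm⟩,
    fun f => ⟨_, (hS c hc).2 _, (contractL_comul_coalgHom φ f c).symm⟩⟩

variable (K C) in
theorem isSubcoalgebra_top : IsSubcoalgebra K (⊤ : Submodule K C) := by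
  rw [isSubcoalgebra_iff]
  exact fun _ _ => ⟨fun _ => trivial, fun _ => trivial⟩

theorem isSubcoalgebra_range (φ : C →ₗc[K] D) :
    IsSubcoalgebra K (LinearMap.range φ.toLinearMap) := by
  rw [LinearMap.range_eq_map]
  exact (isSubcoalgebra_top K C).map φ

theorem IsSubcoalgebra.comap {S : Submodule K D} (hS : IsSubcoalgebra K S) {φ : C →ₗc[K] D}
    (hφ : Function.Injective φ) : IsSubcoalgebra K (S.comap φ.toLinearMap) := by
  rw [isSubcoalgebra_iff] at *
  intro c hc
  refine ⟨fun f => ?_, fun f => ?_⟩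
  · obtain ⟨g, rfl⟩ := exists_comp_eq_of_injective (i := φ.toLinearMap) hφ f
    change φ _ ∈ S
    rw [← contractR_comul_coalgHom]
    exact (hS _ hc).1 g
  · obtain ⟨g, rfl⟩ := exists_comp_eq_of_injective (i := φ.toLinearMap) hφ f
    change φ _ ∈ S
    rw [← contractL_comul_coalgHom]
    exact (hS _ hc).2 g

theorem IsSubcoalgebra.isLeftSubcomodule {S : Submodule K C} (hS : IsSubcoalgebra K S) :
    IsLeftSubcomodule K C S := by
  rw [isLeftSubcomodule_iff]
  exact fun c hc f => ((isSubcoalgebra_iff.1 hS) c hc).2 f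

/-- Δ(s) lies in S ⊗ S, so only the restriction of the functional to S matters. -/
theorem IsSubcoalgebra.contractL_eq {S : Submodule K C} (hS : IsSubcoalgebra K S)
    {f g : C →ₗ[K] K} (hfg : ∀ s ∈ S, f s = g s) {s : C} (hs : s ∈ S) :
    contractL f (Coalgebra.comul s) = contractL g (Coalgebra.comul (R := K) s) := by
  obtain ⟨y, hy⟩ := hS s hs
  rw [← hy, contractL_map, contractL_map]
  have : f ∘ₗ S.subtype = g ∘ₗ S.subtype := LinearMap.ext fun x => hfg x x.2
  rw [this]

/-- If ε vanished on S, then s = ε(s₁) s₂ would be 0 for all s in S. -/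
theorem IsSubcoalgebra.exists_counit_ne_zero {S : Submodule K C} (hS : IsSubcoalgebra K S)
    (hne : S ≠ ⊥) : ∃ s ∈ S, Coalgebra.counit (R := K) s ≠ 0 := by
  by_contra! hcon
  refine hne ((Submodule.eq_bot_iff S).2 fun s hs => ?_)
  rw [← contractL_counit_comul (K := K) s,
    hS.contractL_eq (f := Coalgebra.counit) (g := 0) hcon hs]
  simp [contractL]

theorem IsSimpleSubcoalgebra.inf_eq_bot_or_le {S T : Submodule K C}
    (hS : IsSimpleSubcoalgebra K S) (hT : IsSubcoalgebra K T) : S ⊓ T = ⊥ ∨ S ≤ T :=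
  (hS.2.2 _ inf_le_left (hS.1.inf hT)).imp_right inf_eq_left.1

theorem IsSimpleSubcoalgebra.comap {S : Submodule K D} (hS : IsSimpleSubcoalgebra K S)
    {φ : C →ₗc[K] D} (hφ : Function.Injective φ) (hle : S ≤ LinearMap.range φ.toLinearMap) :
    IsSimpleSubcoalgebra K (S.comap φ.toLinearMap) := by
  have hmap : (S.comap φ.toLinearMap).map φ.toLinearMap = S := Submodule.map_comap_eq_self hle
  refine ⟨hS.1.comap hφ, fun h0 => hS.2.1 (by rw [← hmap, h0, Submodule.map_bot]), ?_⟩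
  intro T hT hTsub
  have hinj := Submodule.map_injective_of_injective (f := φ.toLinearMap) hφ
  refine (hS.2.2 (T.map φ.toLinearMap) ((Submodule.map_mono hT).trans hmap.le)
    (hTsub.map φ)).imp (fun h => hinj (h.trans (Submodule.map_bot _).symm))
    fun h => hinj (h.trans hmap.symm)

theorem isSubcoalgebra_span_singleton {g : C} (hg : IsGroupLikeElem K g) :
    IsSubcoalgebra K (Submodule.span K {g}) := by
  rw [isSubcoalgebra_iff]
  intro d hd
  obtain ⟨a, rfl⟩ := Submodule.mem_span_singleton.1 hd
  rw [map_smul, hg.comul_eq_tmul_self]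
  refine ⟨fun f => ?_, fun f => ?_⟩ <;>
  · simp only [map_smul, contractR_tmul, contractL_tmul]
    exact Submodule.smul_mem _ _ (Submodule.smul_mem _ _ (Submodule.mem_span_singleton_self g))

theorem mem_of_le_span_singleton {S : Submodule K C} {g : C} (hS : S ≤ Submodule.span K {g})
    (hne : S ≠ ⊥) : g ∈ S := by
  obtain ⟨x, hx, hx0⟩ := (Submodule.ne_bot_iff S).1 hne
  obtain ⟨a, rfl⟩ := Submodule.mem_span_singleton.1 (hS hx)
  exact (Submodule.smul_mem_iff S fun h0 => hx0 (by rw [h0, zero_smul])).1 hx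

/-- The line Kg is itself a simple subcoalgebra, so a simple subcoalgebra containing g must equal
it. -/
theorem isConnectedAt_iff {g : C} : IsConnectedAt K g ↔
    IsGroupLikeElem K g ∧ ∀ S, IsSimpleSubcoalgebra K S → g ∈ S := by
  refine and_congr_right fun hg => ⟨fun h S hS => ?_, fun h => le_antisymm ?_ ?_⟩
  · exact mem_of_le_span_singleton (h ▸ le_sSup (s := {D | IsSimpleSubcoalgebra K D}) hS) hS.2.1
  · refine sSup_le fun S hS => ?_
    have hle : Submodule.span K {g} ≤ S := (Submodule.span_singleton_le_iff_mem g S).2 (h S hS)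
    rcases hS.2.2 _ hle (isSubcoalgebra_span_singleton hg) with h0 | h1
    · have : g = 0 := by simpa using h0
      have hε := hg.counit_eq_one
      rw [this, map_zero] at hε
      exact absurd hε zero_ne_one
    · exact h1.ge
  · refine le_sSup ⟨isSubcoalgebra_span_singleton hg, ?_, fun T hT _ => ?_⟩
    · intro h0
      have : g = 0 := by simpa using h0
      have hε := hg.counit_eq_one
      rw [this, map_zero] at hε
      exact absurd hε zero_ne_one
    · by_cases hne : T = ⊥
      · exact Or.inl hne
      · exact Or.inr (le_antisymm hT
          ((Submodule.span_singleton_le_iff_mem g T).2 (mem_of_le_span_singleton hT hne)))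

/-- Some functional agrees with the counit on `S` and vanishes on `T`. -/
def IsSeparated (S T : Submodule K C) : Prop :=
  ∃ f : C →ₗ[K] K, (∀ s ∈ S, f s = Coalgebra.counit s) ∧ ∀ t ∈ T, f t = 0

theorem IsSubcoalgebra.conv_eq_counit {S : Submodule K C} (hS : IsSubcoalgebra K S)
    {f g : C →ₗ[K] K} (hf : ∀ s ∈ S, f s = Coalgebra.counit s)
    (hg : ∀ s ∈ S, g s = Coalgebra.counit s) {s : C} (hs : s ∈ S) :
    conv f g s = Coalgebra.counit s := by
  rw [conv_apply_eq_contractL, hS.contractL_eq hf hs, contractL_counit_comul, hg s hs]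

/-- If f separates S from T₁ and g separates it from T₂, the convolution f * g is still ε on S, and
it vanishes on x when Δ(x) lies in T₁ ⊗ C + C ⊗ T₂. -/
theorem IsSubcoalgebra.isSeparated_wedge {S T₁ T₂ X : Submodule K C} (hS : IsSubcoalgebra K S)
    (h₁ : IsSeparated S T₁) (h₂ : IsSeparated S T₂)
    (hX : ∀ x ∈ X, Coalgebra.comul (R := K) x ∈
      LinearMap.range (T₁.subtype.rTensor C) ⊔ LinearMap.range (T₂.subtype.lTensor C)) :
    IsSeparated S X := by
  obtain ⟨f, hfS, hfT⟩ := h₁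
  obtain ⟨g, hgS, hgT⟩ := h₂
  refine ⟨conv f g, fun s hs => hS.conv_eq_counit hfS hgS hs, fun x hx => ?_⟩
  obtain ⟨_, ⟨a, rfl⟩, _, ⟨b, rfl⟩, hab⟩ := Submodule.mem_sup.1 (hX x hx)
  have hf0 : f ∘ₗ T₁.subtype = 0 := LinearMap.ext fun y => hfT y y.2
  have hg0 : g ∘ₗ T₂.subtype = 0 := LinearMap.ext fun y => hgT y y.2
  change LinearMap.mul' K K (TensorProduct.map f g (Coalgebra.comul x)) = 0
  rw [← hab, map_add, ← LinearMap.comp_apply, ← LinearMap.comp_apply (TensorProduct.map f g),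
    LinearMap.map_comp_rTensor, LinearMap.map_comp_lTensor, hf0, hg0]
  simp

theorem IsSubcoalgebra.comul_mem_range_rTensor {T : Submodule K C} (hT : IsSubcoalgebra K T)
    {x : C} (hx : x ∈ T) : Coalgebra.comul (R := K) x ∈ LinearMap.range (T.subtype.rTensor C) :=
  mem_range_rTensor_subtype.2 ((isSubcoalgebra_iff.1 hT) x hx).1

theorem IsSubcoalgebra.comul_mem_range_lTensor {T : Submodule K C} (hT : IsSubcoalgebra K T)
    {x : C} (hx : x ∈ T) : Coalgebra.comul (R := K) x ∈ LinearMap.range (T.subtype.lTensor C) :=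
  mem_range_lTensor_subtype.2 ((isSubcoalgebra_iff.1 hT) x hx).2

/-- The sum of two subcoalgebras is contained in their wedge. -/
theorem IsSubcoalgebra.isSeparated_sup {S T₁ T₂ : Submodule K C} (hS : IsSubcoalgebra K S)
    (hT₁ : IsSubcoalgebra K T₁) (hT₂ : IsSubcoalgebra K T₂)
    (h₁ : IsSeparated S T₁) (h₂ : IsSeparated S T₂) : IsSeparated S (T₁ ⊔ T₂) := by
  refine hS.isSeparated_wedge h₁ h₂ fun x hx => ?_
  obtain ⟨t₁, ht₁, t₂, ht₂, rfl⟩ := Submodule.mem_sup.1 hx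
  rw [map_add]
  exact Submodule.add_mem_sup (hT₁.comul_mem_range_rTensor ht₁) (hT₂.comul_mem_range_lTensor ht₂)

/-- The elements of the subcoalgebras separated from `S`. -/
def separatedPart {S : Submodule K C} (hS : IsSubcoalgebra K S) : Submodule K C where
  carrier := {x | ∃ T, IsSubcoalgebra K T ∧ IsSeparated S T ∧ x ∈ T}
  add_mem' := by
    rintro x y ⟨T, hT, hST, hx⟩ ⟨T', hT', hST', hy⟩
    exact ⟨T ⊔ T', hT.sup hT', hS.isSeparated_sup hT hT' hST hST', Submodule.add_mem_sup hx hy⟩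
  zero_mem' := ⟨⊥, by rintro _ rfl; simp, ⟨Coalgebra.counit, by simp, by simp⟩, Submodule.zero_mem _⟩
  smul_mem' := by
    rintro a x ⟨T, hT, hST, hx⟩
    exact ⟨T, hT, hST, T.smul_mem a hx⟩

/-- An element of S with nonzero counit cannot lie in a subspace separated from S. -/
theorem IsSubcoalgebra.separatedPart_ne_top {S : Submodule K C} (hS : IsSubcoalgebra K S)
    (hne : S ≠ ⊥) : separatedPart hS ≠ ⊤ := by
  intro htop
  obtain ⟨s, hs, hεs⟩ := hS.exists_counit_ne_zero hne
  have : s ∈ separatedPart hS := htop ▸ Submodule.mem_top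
  obtain ⟨T, -, ⟨f, hfS, hfT⟩, hsT⟩ := this
  exact hεs ((hfS s hs).symm.trans (hfT s hsT))

/-- A simple subcoalgebra meets the image of some X n, hence lies in it, and its preimage is simple
in X n. -/
theorem SeqColim.isConnectedAt {X : ℕ → Type u} [∀ n, AddCommGroup (X n)]
    [∀ n, Module K (X n)] [∀ n, Coalgebra K (X n)] {f : ∀ n, X n →ₗc[K] X (n + 1)}
    (hf : ∀ n, Function.Injective (f n)) (x : ∀ n, X n) (hx : ∀ n, f n (x n) = x (n + 1))
    (h : ∀ n, IsConnectedAt K (x n)) : IsConnectedAt K (SeqColim.of K X f 0 (x 0)) := by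
  have hpt : ∀ n, SeqColim.of K X f n (x n) = SeqColim.of K X f 0 (x 0) := by
    intro n
    induction n with
    | zero => rfl
    | succ n ih => rw [← ih, ← hx, SeqColim.of_succ]
  refine isConnectedAt_iff.2 ⟨(h 0).1.map _, fun S hS => ?_⟩
  obtain ⟨s, hs, hs0⟩ := (Submodule.ne_bot_iff S).1 hS.2.1
  obtain ⟨n, y, rfl⟩ := SeqColim.exists_of K X f s
  have hle : S ≤ LinearMap.range (SeqColim.of K X f n).toLinearMap :=
    (hS.inf_eq_bot_or_le (isSubcoalgebra_range _)).resolve_left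
      ((Submodule.ne_bot_iff _).2 ⟨_, ⟨hs, ⟨y, rfl⟩⟩, hs0⟩)
  have := (isConnectedAt_iff.1 (h n)).2 _ (hS.comap (SeqColim.of_injective hf n) hle)
  rw [← hpt n]
  exact this

end Subcoalgebra

/-! ### The dual of the endomorphism algebra of an indecomposable comodule -/

section Local

variable {K : Type*} [Field K] {C : Type*} [AddCommGroup C] [Module K C] [Coalgebra K C]
  {M : Type*} [AddCommGroup M] [Module K M] [RightComodule K C M] [FiniteDimensional K M]

/-- Fitting's lemma. -/
theorem IsIndecomposable.isNilpotent_or_surjective (h : IsIndecomposable K C M)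
    (x : comodEnd K C M) : IsNilpotent x ∨ Function.Surjective (x : Module.End K M) := by
  obtain ⟨n, hn, hn1⟩ := ((x : Module.End K M).eventually_isCompl_ker_pow_range_pow.and
    (Filter.eventually_ge_atTop 1)).exists
  have hpow : IsRightComoduleHom K C ((x : Module.End K M) ^ n) := (x ^ n).2
  rcases h.2 _ _ hpow.isRightSubcomodule_ker hpow.isRightSubcomodule_range hn with h0 | h0
  · right
    have hinj : Function.Injective ((x : Module.End K M) ^ n) := LinearMap.ker_eq_bot.1 h0
    have hsurj := LinearMap.injective_iff_surjective.1 hinj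
    intro m
    obtain ⟨m', rfl⟩ := hsurj m
    obtain ⟨k, rfl⟩ := Nat.exists_eq_add_of_le' hn1
    exact ⟨((x : Module.End K M) ^ k) m', by rw [pow_succ']; rfl⟩
  · left
    exact ⟨n, Subtype.ext (LinearMap.range_eq_bot.1 h0)⟩

theorem IsNilpotent.not_surjective_comodEnd [Nontrivial M] {x : comodEnd K C M}
    (hx : IsNilpotent x) : ¬ Function.Surjective (x : Module.End K M) := by
  intro hs
  obtain ⟨n, hn⟩ := hx
  have hn' : (x : Module.End K M) ^ n = 0 := congrArg Subtype.val hn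
  have : Function.Surjective ((x : Module.End K M) ^ n) := by
    rw [Module.End.coe_pow]
    exact hs.iterate n
  rw [hn'] at this
  obtain ⟨m, hm⟩ := exists_ne (0 : M)
  obtain ⟨y, hy⟩ := this m
  exact hm hy.symm

/-- If x y were not nilpotent it would be surjective, and then so would x. With `isNilpotent_add`
this shows that the nilpotent endomorphisms form an ideal. -/
theorem IsIndecomposable.isNilpotent_mul (h : IsIndecomposable K C M) {x : comodEnd K C M}
    (hx : IsNilpotent x) (y : comodEnd K C M) : IsNilpotent (x * y) := by
  have := h.1
  refine (h.isNilpotent_or_surjective (x * y)).resolve_right fun hs =>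
    IsNilpotent.not_surjective_comodEnd hx fun m => ?_
  obtain ⟨m', rfl⟩ := hs m
  exact ⟨(y : Module.End K M) m', rfl⟩

/-- Left multiplication by x is injective on a finite dimensional algebra, hence surjective; so the
inverse is automatically a comodule map. -/
theorem comodEnd_exists_mul_eq_one {x : comodEnd K C M}
    (hx : Function.Surjective (x : Module.End K M)) : ∃ y : comodEnd K C M, x * y = 1 := by
  have hinj := LinearMap.injective_iff_surjective.2 hx
  have : Function.Injective (LinearMap.mulLeft K x) := fun a b hab => by
    refine Subtype.ext (LinearMap.ext fun m => hinj ?_)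
    exact LinearMap.congr_fun (congrArg Subtype.val hab) m
  exact LinearMap.injective_iff_surjective.1 this 1

/-- Otherwise (x + y) z = 1 for some z, and y z = 1 - x z would be both a unit and nilpotent. -/
theorem IsIndecomposable.isNilpotent_add (h : IsIndecomposable K C M) {x y : comodEnd K C M}
    (hx : IsNilpotent x) (hy : IsNilpotent y) : IsNilpotent (x + y) := by
  have := h.1
  refine (h.isNilpotent_or_surjective (x + y)).resolve_right fun hs => ?_
  obtain ⟨z, hz⟩ := comodEnd_exists_mul_eq_one hs
  have hxz := (h.isNilpotent_mul hx z).isUnit_one_sub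
  have hyz : y * z = 1 - x * z := by rw [← hz, add_mul, add_sub_cancel_left]
  rw [← hyz] at hxz
  exact hxz.not_isNilpotent (h.isNilpotent_mul hy z)

/-- Over an algebraically closed field an endomorphism x has an eigenvalue a. Then x - a is not
injective, hence nilpotent, and χ(x) = a is the residue map of the local algebra. -/
theorem IsIndecomposable.exists_character [IsAlgClosed K] (h : IsIndecomposable K C M) :
    ∃ χ : comodEnd K C M →ₐ[K] K, ∀ x, χ x = 0 → IsNilpotent x := by
  have := h.1
  have hex : ∀ x : comodEnd K C M, ∃ a : K, IsNilpotent (x - algebraMap K _ a) := by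
    intro x
    obtain ⟨a, ha⟩ := Module.End.exists_eigenvalue (x : Module.End K M)
    refine ⟨a, (h.isNilpotent_or_surjective _).resolve_right fun hs => ?_⟩
    have hinj := LinearMap.injective_iff_surjective.2 hs
    obtain ⟨v, hv⟩ := ha.exists_hasEigenvector
    refine hv.2 (hinj ?_)
    rw [map_zero]
    have : (x : Module.End K M) v = a • v := hv.apply_eq_smul
    change (x : Module.End K M) v - algebraMap K (Module.End K M) a v = 0
    rw [this, Module.algebraMap_end_apply, sub_self]
  choose χ hχ using hex
  -- A nilpotent scalar is 0, so the eigenvalue is unique. Linearity and multiplicativity of χ then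
  -- follow by exhibiting nilpotent differences.
  have huniq : ∀ x a, IsNilpotent (x - algebraMap K (comodEnd K C M) a) → χ x = a := by
    intro x a ha
    have h1 := h.isNilpotent_add ha (hχ x).neg
    have h2 : x - algebraMap K (comodEnd K C M) a + -(x - algebraMap K _ (χ x)) =
        algebraMap K _ (χ x - a) := by
      rw [map_sub]
      abel
    rw [h2] at h1
    by_contra hne
    exact ((isUnit_iff_ne_zero.2 (sub_ne_zero.2 hne)).map
      (algebraMap K (comodEnd K C M))).not_isNilpotent h1
  refine ⟨AlgHom.ofLinearMap ⟨⟨χ, fun x y => huniq _ _ ?_⟩, fun a x => huniq _ _ ?_⟩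
    (huniq _ _ ?_) fun x y => huniq _ _ ?_, fun x hx => ?_⟩
  · rw [map_add, add_sub_add_comm]
    exact h.isNilpotent_add (hχ x) (hχ y)
  · rw [RingHom.id_apply, smul_eq_mul, map_mul, ← Algebra.smul_def, ← smul_sub]
    exact (hχ x).smul a
  · simp
  · have : x * y - algebraMap K (comodEnd K C M) (χ x * χ y) =
        (x - algebraMap K _ (χ x)) * y + (y - algebraMap K _ (χ y)) * algebraMap K _ (χ x) := by
      rw [sub_mul, sub_mul, ← Algebra.commutes (χ x) y, mul_comm (χ x) (χ y), map_mul]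
      abel
    change IsNilpotent (x * y - algebraMap K (comodEnd K C M) (χ x * χ y))
    rw [this]
    exact h.isNilpotent_add (h.isNilpotent_mul (hχ x) y) (h.isNilpotent_mul (hχ y) _)
  · have hx' : χ x = 0 := hx
    have := hχ x
    rwa [hx', map_zero, sub_zero] at this

end Local

/-! ### Functionals and group-like elements of the dual of an algebra -/

section DualFunctionals

variable {K : Type*} [Field K] {A : Type*} [Ring A] [Algebra K A] [FiniteDimensional K A]

/-- Evaluation at an element of `A` as a functional on `A*`. -/
def dualEval (a : A) : DualCoalg K A →ₗ[K] K := Module.Dual.eval K A a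

theorem exists_dualEval_eq (f : DualCoalg K A →ₗ[K] K) : ∃ a : A, dualEval a = f :=
  (Module.evalEquiv K A).surjective f

/-- Under A ≅ A** the convolution of functionals on A* is the product of A, so a nilpotent of A
gives a functional with a vanishing convolution power. -/
theorem conv_dualEval (a b : A) :
    conv (dualEval (K := K) a) (dualEval b) = dualEval (a * b) := by
  have key : ∀ x : DualCoalg K A ⊗[K] DualCoalg K A,
      LinearMap.mul' K K (TensorProduct.map (dualEval a) (dualEval b) x) =
      dualEval b (dualTensorEquiv K A (DualCoalg K A) x a) := by
    intro x
    induction x using TensorProduct.induction_on with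
    | zero => simp
    | tmul α β =>
      rw [dualTensorEquiv_tmul, map_smul]
      rfl
    | add x y hx hy => simp only [map_add, LinearMap.add_apply, hx, hy]
  refine LinearMap.ext fun α => (key _).trans ?_
  rw [dualTensorEquiv_comul]
  rfl

/-- A character of `A` is a group-like element of `A*`. -/
theorem isGroupLikeElem_of_algHom (χ : A →ₐ[K] K) :
    IsGroupLikeElem K (show DualCoalg K A from χ.toLinearMap) where
  counit_eq_one := map_one χ
  comul_eq_tmul_self := by
    refine dualTensor_ext fun a => ?_
    rw [dualTensorEquiv_comul, dualTensorEquiv_tmul]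
    exact LinearMap.ext fun b => map_mul χ a b

end DualFunctionals

/-! ### Simple subcoalgebras in images of A_M -/

section EndCoalgFunctionals

variable {K : Type u} [Field K] {C D M : Type u} [AddCommGroup C] [Module K C] [Coalgebra K C]
  [AddCommGroup M] [Module K M] [RightComodule K C M] [FiniteDimensional K M]
  [AddCommGroup D] [Module K D] [Coalgebra K D]

theorem conv_comp_coalgHom (φ : C →ₗc[K] D) (f g : D →ₗ[K] K) :
    conv f g ∘ₗ φ.toLinearMap = conv (f ∘ₗ φ.toLinearMap) (g ∘ₗ φ.toLinearMap) := by
  refine LinearMap.ext fun c => ?_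
  rw [LinearMap.comp_apply, conv_apply_eq_contractL, conv_apply_eq_contractL]
  exact congrArg g (contractL_comul_coalgHom φ f c)

/-- The coalgebra of an indecomposable comodule has a group-like element whose image lies in
every simple subcoalgebra of each of its homomorphic images. -/
theorem IsIndecomposable.exists_isGroupLikeElem [IsAlgClosed K] (h : IsIndecomposable K C M) :
    ∃ γ : EndCoalg K C M, IsGroupLikeElem K γ ∧ ∀ {D : Type u} [AddCommGroup D] [Module K D]
      [Coalgebra K D] (φ : EndCoalg K C M →ₗc[K] D) (S : Submodule K D), IsSimpleSubcoalgebra K S →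
      S ≤ LinearMap.range φ.toLinearMap → φ γ ∈ S := by
  obtain ⟨χ, hχ⟩ := h.exists_character
  -- K is commutative, so a character of an algebra is also one of the opposite algebra.
  let χ' : EndOp K C M →ₐ[K] K := AlgHom.ofLinearMap
    (χ.toLinearMap ∘ₗ (MulOpposite.opLinearEquiv K).symm.toLinearMap) (map_one χ)
    fun a b => (map_mul χ _ _).trans (mul_comm _ _)
  have hγ := isGroupLikeElem_of_algHom χ'
  refine ⟨show DualCoalg K (EndOp K C M) from χ'.toLinearMap, hγ, ?_⟩
  intro D _ _ _ φ S hS hle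
  set γ : EndCoalg K C M := show DualCoalg K (EndOp K C M) from χ'.toLinearMap with hγdef
  by_contra hmem
  have hinf : S ⊓ Submodule.span K {φ γ} = ⊥ := by
    refine (hS.inf_eq_bot_or_le (isSubcoalgebra_span_singleton (hγ.map φ))).resolve_right
      fun hle' => hmem (mem_of_le_span_singleton hle' hS.2.1)
  obtain ⟨f, hfS, hf0⟩ := exists_functional_of_inf_eq_bot hinf Coalgebra.counit
  -- The functional f is ε on S and 0 at φ(γ). Pulled back to A_M it is evaluation at an
  -- endomorphism a; vanishing at γ says χ(a) = 0, so a is nilpotent.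
  obtain ⟨a, ha⟩ := exists_dualEval_eq (A := EndOp K C M) (f ∘ₗ φ.toLinearMap)
  have hχa : χ a.unop = 0 := by
    have h1 : dualEval a γ = f (φ γ) := LinearMap.congr_fun ha γ
    rw [hf0 _ (Submodule.mem_span_singleton_self _)] at h1
    exact h1
  obtain ⟨n, hn⟩ := hχ _ hχa
  -- Powers of a correspond to convolution powers of f, all equal to ε on S. A vanishing power
  -- forces ε = 0 on S, since S lies in the image of φ.
  have hpow : ∀ k : ℕ, ∃ f : D →ₗ[K] K, (∀ s ∈ S, f s = Coalgebra.counit s) ∧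
      dualEval (a ^ (k + 1)) = f ∘ₗ φ.toLinearMap := by
    intro k
    induction k with
    | zero => exact ⟨f, hfS, by rw [zero_add, pow_one]; exact ha⟩
    | succ k ih =>
      obtain ⟨f', hf', ha'⟩ := ih
      refine ⟨conv f' f, fun s hs => hS.1.conv_eq_counit hf' hfS hs, ?_⟩
      rw [conv_comp_coalgHom, pow_succ, ← conv_dualEval, ha, ha']
      rfl
  obtain ⟨f', hf', ha'⟩ := hpow n
  have h0 : a ^ (n + 1) = 0 := by
    rw [pow_succ]
    have : a ^ n = 0 := MulOpposite.unop_injective (by rw [MulOpposite.unop_pow, hn]; rfl)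
    rw [this, zero_mul]
  obtain ⟨s, hs, hεs⟩ := hS.1.exists_counit_ne_zero hS.2.1
  obtain ⟨α, rfl⟩ := hle hs
  apply hεs
  have := LinearMap.congr_fun ha' α
  rw [h0] at this
  rw [← hf' _ hs]
  refine this.symm.trans ?_
  exact LinearMap.congr_fun (map_zero (Module.Dual.eval K (EndOp K C M))) α

end EndCoalgFunctionals

/-! ### Connectedness of C^∨ -/

section VeeConnected

variable {K : Type u} [Field K] {C : Type u} [AddCommGroup C] [Module K C] [Coalgebra K C]

/-- A simple S avoiding the base point would be separated from the images of C and of all A_M. Since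
each M lies in a wedge of these, all of C^∨ would consist of elements of subcoalgebras separated
from S. -/
theorem isConnectedAt_veeMap [IsAlgClosed K] {g : C} (hg : IsConnectedAt K g) :
    haveI := isCoideal_veeCoideal K hg.1
    IsConnectedAt K (veeMap hg.1 g) := by
  have := isCoideal_veeCoideal K hg.1
  refine isConnectedAt_iff.2 ⟨hg.1.map _, fun S hS => ?_⟩
  by_contra hmem
  let π : TildeCoalg K C →ₗc[K] TildeCoalg K C ⧸ veeCoideal K g :=
    Coalgebra.Quotient.mkQCoalgHom (R := K) (veeCoideal K g)
  let πA := fun q : IndecType K C => π.comp (ExtCoalg.inACoalg K C (indecFamily C) q)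
  let TC := LinearMap.range (veeMap hg.1).toLinearMap
  let TA := fun q : IndecType K C => LinearMap.range (πA q).toLinearMap
  have hTC : IsSubcoalgebra K TC := isSubcoalgebra_range _
  have hTA : ∀ q, IsSubcoalgebra K (TA q) := fun q => isSubcoalgebra_range _
  have hSC : IsSeparated S TC := by
    refine exists_functional_of_inf_eq_bot ((hS.inf_eq_bot_or_le hTC).resolve_right fun hle =>
      hmem ?_) Coalgebra.counit
    exact (isConnectedAt_iff.1 hg).2 _ (hS.comap (veeMap_injective hg.1) hle)
  have hSA : ∀ q, IsSeparated S (TA q) := by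
    intro q
    refine exists_functional_of_inf_eq_bot ((hS.inf_eq_bot_or_le (hTA q)).resolve_right fun hle =>
      hmem ?_) Coalgebra.counit
    have hq : IsIndecomposable K C (indecFamily C q) := q.2
    obtain ⟨γ, hγ, hγS⟩ := hq.exists_isGroupLikeElem
    have h1 : veeMap hg.1 g = πA q γ :=
      (Submodule.Quotient.eq _).2 (Submodule.subset_span ⟨q, γ, hγ, rfl⟩)
    rw [h1]
    exact hγS (πA q) S hS hle
  refine hS.1.separatedPart_ne_top hS.2.1 ?_
  have hzero : (separatedPart hS.1).mkQ ∘ₗ π.toLinearMap = 0 := by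
    have hmk : ∀ x, (separatedPart hS.1).mkQ (π x) = 0 ↔ ∃ T, IsSubcoalgebra K T ∧
        IsSeparated S T ∧ π x ∈ T := fun x => Submodule.Quotient.mk_eq_zero _
    refine ExtCoalg.hom_ext (fun q => LinearMap.ext fun x => (hmk _).2 ?_)
      (fun q => LinearMap.ext fun x => (hmk _).2 ?_) (LinearMap.ext fun x => (hmk _).2 ?_)
    · exact ⟨TA q, hTA q, hSA q, x, rfl⟩
    -- For m in M the coproduct lies in TA ⊗ TM + TM ⊗ TC. Hence TM + T is a subcoalgebra, and it
    -- lies in the wedge of T with itself, so it inherits separation from T.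
    · let T := TC ⊔ TA q
      have hT : IsSubcoalgebra K T := hTC.sup (hTA q)
      have hST : IsSeparated S T := hS.1.isSeparated_sup hTC (hTA q) hSC (hSA q)
      let TM := LinearMap.range (π.toLinearMap ∘ₗ ExtCoalg.inM K C (indecFamily C) q)
      have hcomul : ∀ m, Coalgebra.comul (R := K) (π (ExtCoalg.inM K C (indecFamily C) q m)) =
          TensorProduct.map (πA q).toLinearMap
            (π.toLinearMap ∘ₗ ExtCoalg.inM K C (indecFamily C) q) (endCoact K C _ m) +
          TensorProduct.map (π.toLinearMap ∘ₗ ExtCoalg.inM K C (indecFamily C) q)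
            (veeMap hg.1).toLinearMap (rcoact K C (indecFamily C q) m) := by
        intro m
        have h1 : Coalgebra.comul (R := K) (π (ExtCoalg.inM K C (indecFamily C) q m)) =
            TensorProduct.map π.toLinearMap π.toLinearMap
              (Coalgebra.comul (R := K) (ExtCoalg.inM K C (indecFamily C) q m)) :=
          (LinearMap.congr_fun π.map_comp_comul _).symm
        have h2 := LinearMap.congr_fun (ExtCoalg.comul_inM (K := K) (C := C)
          (M := indecFamily C) q) m
        rw [LinearMap.comp_apply] at h2
        rw [h1, h2, LinearMap.add_apply, map_add]
        simp only [LinearMap.comp_apply, TensorProduct.map_map]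
        rfl
      have hTM : ∀ y ∈ TM, (∀ f, contractR f (Coalgebra.comul (R := K) y) ∈ TM ⊔ T) ∧
          (∀ f, contractL f (Coalgebra.comul (R := K) y) ∈ TM ⊔ T) := by
        rintro _ ⟨m, rfl⟩
        rw [LinearMap.comp_apply, CoalgHom.toLinearMap_eq_coe, CoalgHom.coe_toLinearMap, hcomul]
        simp only [map_add, contractR_map, contractL_map]
        refine ⟨fun f => add_mem ?_ ?_, fun f => add_mem ?_ ?_⟩
        · exact Submodule.mem_sup_right (Submodule.mem_sup_right ⟨_, rfl⟩)
        · exact Submodule.mem_sup_left ⟨_, rfl⟩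
        · exact Submodule.mem_sup_left ⟨_, rfl⟩
        · exact Submodule.mem_sup_right (Submodule.mem_sup_left ⟨_, rfl⟩)
      refine ⟨TM ⊔ T, ?_, ?_, Submodule.mem_sup_left ⟨x, rfl⟩⟩
      · rw [isSubcoalgebra_iff]
        intro d hd
        obtain ⟨y, hy, t, ht, rfl⟩ := Submodule.mem_sup.1 hd
        simp only [map_add]
        have ht' := (isSubcoalgebra_iff.1 hT) t ht
        exact ⟨fun f => add_mem ((hTM y hy).1 f) (Submodule.mem_sup_right (ht'.1 f)),
          fun f => add_mem ((hTM y hy).2 f) (Submodule.mem_sup_right (ht'.2 f))⟩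
      · refine hS.1.isSeparated_wedge hST hST fun z hz => ?_
        obtain ⟨_, ⟨m, rfl⟩, t, ht, rfl⟩ := Submodule.mem_sup.1 hz
        rw [map_add]
        refine add_mem ?_ (Submodule.mem_sup_left (hT.comul_mem_range_rTensor ht))
        rw [LinearMap.comp_apply, CoalgHom.toLinearMap_eq_coe, CoalgHom.coe_toLinearMap, hcomul]
        refine Submodule.add_mem_sup (mem_range_rTensor_subtype.2 fun f => ?_)
          (mem_range_lTensor_subtype.2 fun f => ?_)
        · rw [contractR_map]
          exact Submodule.mem_sup_right ⟨_, rfl⟩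
        · rw [contractL_map]
          exact Submodule.mem_sup_left ⟨_, rfl⟩
    · exact ⟨TC, hTC, hSC, x, rfl⟩
  rw [eq_top_iff]
  intro y _
  obtain ⟨x, rfl⟩ := Submodule.Quotient.mk_surjective _ y
  exact (Submodule.Quotient.mk_eq_zero _).1 (LinearMap.congr_fun hzero x)

end VeeConnected

/-! ### The coalgebras `C_∞` and `C_∞^∨` -/

section Main

variable {K : Type u} [Field K] {C : Type u} [AddCommGroup C] [Module K C] [Coalgebra K C]

theorem isRightGenerating_CInfty : IsRightGenerating K (CInfty K C) :=
  isRightGenerating_seqColim (X := fun n => (primeTower K ⟨C⟩ n).carrier)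
    (f := primeTowerMap K ⟨C⟩) (fun _ => inCCoalg_injective _) (fun _ => 0)
    fun _ => isGeneratingStep_prime

theorem hasLargeMonolithic_CInfty (h : HasLargeMonolithic K C) :
    HasLargeMonolithic K (CInfty K C) :=
  h.of_injective (SeqColim.of K (fun n => (primeTower K ⟨C⟩ n).carrier) (primeTowerMap K ⟨C⟩) 0)
    (SeqColim.of_injective (fun _ => inCCoalg_injective _) 0)

theorem veeTowerMap_injective (X : PointedCoalgObj K) (n : ℕ) :
    Function.Injective (veeTowerMap K X n) :=
  veeMap_injective (veeTower K X n).isGroupLike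

variable {g : C} (hg : IsGroupLikeElem K g)

theorem isRightGenerating_CInftyVee : IsRightGenerating K (CInftyVee K hg) :=
  isRightGenerating_seqColim (X := fun n => (veeTower K ⟨⟨C⟩, g, hg⟩ n).carrier)
    (f := veeTowerMap K ⟨⟨C⟩, g, hg⟩) (veeTowerMap_injective _)
    (fun n => (veeTower K ⟨⟨C⟩, g, hg⟩ n).point)
    fun n => isGeneratingStep_veeMap (veeTower K ⟨⟨C⟩, g, hg⟩ n).isGroupLike

theorem hasLargeMonolithic_CInftyVee (h : HasLargeMonolithic K C) :
    HasLargeMonolithic K (CInftyVee K hg) :=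
  h.of_injective (SeqColim.of K (fun n => (veeTower K ⟨⟨C⟩, g, hg⟩ n).carrier)
    (veeTowerMap K ⟨⟨C⟩, g, hg⟩) 0) (SeqColim.of_injective (veeTowerMap_injective _) 0)

theorem isConnectedAt_CInftyVee [IsAlgClosed K] (h : IsConnectedAt K g) :
    IsConnectedAt K (CInftyVee.point K h.1) :=
  SeqColim.isConnectedAt (X := fun n => (veeTower K ⟨⟨C⟩, g, h.1⟩ n).carrier)
    (f := veeTowerMap K ⟨⟨C⟩, g, h.1⟩) (veeTowerMap_injective _)
    (fun n => (veeTower K ⟨⟨C⟩, g, h.1⟩ n).point) (fun _ => rfl) fun n => by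
      induction n with
      | zero => exact h
      | succ n ih => exact isConnectedAt_veeMap ih

theorem CInftyVee_properties [IsAlgClosed K] (h : IsConnectedAt K g)
    (hsp : ¬ IsRightSemiperfect K C) :
    IsConnectedAt K (CInftyVee.point K h.1) ∧ IsRightGenerating K (CInftyVee K h.1) ∧
      ¬ IsRightSemiperfect K (CInftyVee K h.1) ∧ ¬ IsRightQcF K (CInftyVee K h.1) ∧
      ¬ IsProjectiveLeftComodule K (CInftyVee K h.1) (CInftyVee K h.1) := by
  have hL := hasLargeMonolithic_CInftyVee h.1 (hasLargeMonolithic_of_not_isRightSemiperfect hsp)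
  exact ⟨isConnectedAt_CInftyVee h, isRightGenerating_CInftyVee h.1, hL.not_isRightSemiperfect,
    hL.not_isRightQcF, hL.not_isProjectiveLeftComodule⟩

end Main

/-! ### The divided power coalgebra -/

namespace DividedPower

/-- The n-th coordinate functional acts as the shift of the index by n. -/
theorem contractL_comul_basis {K : Type*} [Field K] (n m : ℕ) :
    contractL ((basis K).coord n) (Coalgebra.comul (R := K) (basis K m)) =
      if n ≤ m then basis K (m - n) else 0 := by
  rw [comul_basis, map_sum]
  simp only [contractL_tmul, Module.Basis.coord_apply, Module.Basis.repr_self]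
  split_ifs with h
  · rw [Finset.sum_eq_single (n, m - n)]
    · simp
    · rintro ⟨i, j⟩ hij hne
      have : i ≠ n := by
        rintro rfl
        rw [Finset.HasAntidiagonal.mem_antidiagonal] at hij
        exact hne (Prod.ext rfl (by dsimp only; omega))
      simp [this]
    · intro hn
      exact absurd (Finset.HasAntidiagonal.mem_antidiagonal.2 (by lia)) hn
  · refine Finset.sum_eq_zero ?_
    rintro ⟨i, j⟩ hij
    rw [Finset.HasAntidiagonal.mem_antidiagonal] at hij
    have : i ≠ n := by
      simp only at hij
      omega
    simp [this]

/-- Shifting an element by its degree leaves its leading coefficient times c_0. So c_0 lies in every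
nonzero coideal, which gives both connectedness and, with E the whole coalgebra, the failure of
semiperfectness. -/
theorem basis_zero_mem {K : Type*} [Field K] {P : Submodule K (DividedPower K)}
    (hP : IsLeftSubcomodule K (DividedPower K) P) (hne : P ≠ ⊥) : basis K 0 ∈ P := by
  obtain ⟨x, hx, hx0⟩ := (Submodule.ne_bot_iff P).1 hne
  have hsupp : ((basis K).repr x).support.Nonempty := by
    rw [Finsupp.support_nonempty_iff]
    simpa using hx0
  set n := ((basis K).repr x).support.max' hsupp with hn
  have hxn : (basis K).repr x n ≠ 0 :=
    Finsupp.mem_support_iff.1 (Finset.max'_mem _ hsupp)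
  have key : contractL ((basis K).coord n) (Coalgebra.comul (R := K) x) =
      (basis K).repr x n • basis K 0 := by
    conv_lhs => rw [← (basis K).linearCombination_repr x, Finsupp.linearCombination_apply,
      Finsupp.sum, map_sum, map_sum]
    rw [Finset.sum_eq_single n]
    · rw [map_smul, map_smul, contractL_comul_basis, if_pos le_rfl, Nat.sub_self]
    · intro m hm hmn
      have : m < n := lt_of_le_of_ne (Finset.le_max' _ m hm) hmn
      rw [map_smul, map_smul, contractL_comul_basis, if_neg (by omega), smul_zero]
    · intro h0
      exact absurd (Finsupp.mem_support_iff.2 hxn) h0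
  have hmem := (isLeftSubcomodule_iff K (DividedPower K)).1 hP x hx ((basis K).coord n)
  change contractL ((basis K).coord n) (Coalgebra.comul (R := K) x) ∈ P at hmem
  rw [key] at hmem
  exact (Submodule.smul_mem_iff P hxn).1 hmem

theorem isConnectedAt_zero {K : Type u} [Field K] : IsConnectedAt K (basis K 0) :=
  isConnectedAt_iff.2 ⟨isGroupLikeElem_zero K,
    fun _ hS => basis_zero_mem hS.1.isLeftSubcomodule hS.2.1⟩

theorem hasLargeMonolithic {K : Type*} [Field K] : HasLargeMonolithic K (DividedPower K) := by
  refine ⟨basis K 0, ⊤, isLeftSubcomodule_top K _, ?_, trivial, (basis K).ne_zero 0,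
    fun P _ hP hne => basis_zero_mem hP hne⟩
  intro hfd
  have : FiniteDimensional K (DividedPower K) := LinearEquiv.finiteDimensional Submodule.topEquiv
  exact not_finite_iff_infinite.2 (inferInstance : Infinite ℕ) (Module.Finite.finite_basis (basis K))

end DividedPower

end Comod

/-! ### The three statements -/

theorem mainTheorem4 :
    -- `C` any coalgebra over a field which is not right semiperfect
    (∀ (K : Type u) [Field K] (C : Type u) [AddCommGroup C] [Module K C] [Coalgebra K C],
      ¬ Comod.IsRightSemiperfect K C →
        Comod.IsRightGenerating K (Comod.CInfty K C) ∧
        ¬ Comod.IsRightSemiperfect K (Comod.CInfty K C) ∧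
        ¬ Comod.IsRightQcF K (Comod.CInfty K C) ∧
        ¬ Comod.IsProjectiveLeftComodule K (Comod.CInfty K C) (Comod.CInfty K C)) ∧
    -- `C` connected over an algebraically closed field and not right semiperfect
    (∀ (K : Type u) [Field K] [IsAlgClosed K]
      (C : Type u) [AddCommGroup C] [Module K C] [Coalgebra K C]
      (g : C) (hg : Comod.IsConnectedAt K g),
      ¬ Comod.IsRightSemiperfect K C →
        Comod.IsConnectedAt K (Comod.CInftyVee.point K hg.1) ∧
        Comod.IsRightGenerating K (Comod.CInftyVee K hg.1) ∧
        ¬ Comod.IsRightSemiperfect K (Comod.CInftyVee K hg.1) ∧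
        ¬ Comod.IsRightQcF K (Comod.CInftyVee K hg.1) ∧
        ¬ Comod.IsProjectiveLeftComodule K (Comod.CInftyVee K hg.1) (Comod.CInftyVee K hg.1)) ∧
    -- the divided power coalgebra over `ℂ` is an instance
    (∃ hc : Comod.IsConnectedAt ℂ (Comod.DividedPower.basis ℂ 0),
      ¬ Comod.IsRightSemiperfect ℂ (Comod.DividedPower ℂ) ∧
      Comod.IsConnectedAt ℂ (Comod.CInftyVee.point ℂ hc.1) ∧
      FiniteDimensional ℂ (Comod.coradical ℂ (Comod.CInftyVee ℂ hc.1)) ∧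
      Comod.IsRightGenerating ℂ (Comod.CInftyVee ℂ hc.1) ∧
      ¬ Comod.IsRightSemiperfect ℂ (Comod.CInftyVee ℂ hc.1) ∧
      ¬ Comod.IsRightQcF ℂ (Comod.CInftyVee ℂ hc.1) ∧
      ¬ Comod.IsProjectiveLeftComodule ℂ (Comod.CInftyVee ℂ hc.1) (Comod.CInftyVee ℂ hc.1)) := by
  refine ⟨fun K _ C _ _ _ hsp => ?_, fun K _ _ C _ _ _ g hg hsp =>
    Comod.CInftyVee_properties hg hsp, Comod.DividedPower.isConnectedAt_zero, ?_⟩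
  · have hL := Comod.hasLargeMonolithic_CInfty
      (Comod.hasLargeMonolithic_of_not_isRightSemiperfect hsp)
    exact ⟨Comod.isRightGenerating_CInfty, hL.not_isRightSemiperfect, hL.not_isRightQcF,
      hL.not_isProjectiveLeftComodule⟩
  · have hsp := (Comod.DividedPower.hasLargeMonolithic (K := ℂ)).not_isRightSemiperfect
    obtain ⟨h1, h2⟩ := Comod.CInftyVee_properties Comod.DividedPower.isConnectedAt_zero hsp
    refine ⟨hsp, h1, ?_, h2⟩
    -- By connectedness the coradical is spanned by a single element.
    rw [h1.2]
    infer_instance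

end
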